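/- A \emph{lookup scheme} for $N = 2^n$ one-bit memory locations, named by their $n$-bit addresses, consists of a finite set of qubits placed at distinct points of the planar square lattice $\mathbb{Z}^2$, among them $n$ address qubits and one output qubit (the others are ancillas, initially in $|0\rangle$), and a circuit of finitely many time steps. In each time step every qubit takes part in exactly one of the operations: idling, reset to $|0\rangle$, $X$, $H$, $S$, $T$, CNOT, SWAP, Toffoli, controlled-SWAP, or a memory-controlled CNOT (a CNOT if the classical bit stored at a given address is $1$, the identity otherwise). The circuit itself does not depend on the memory content $x\in\{0,1\}^N$. The scheme has \emph{local planar connectivity} if two-qubit operations act only on nearest neighbours of the lattice and three-qubit operations only on three lattice points that are connected through nearest-neighbour pairs. Its \emph{qubit count} is the number of all its qubits, and its \emph{T count} is the number of $T$ gates, where a Toffoli or controlled-SWAP gate counts as $7$. Noise: each operation, idling included, fails independently with probability $\varepsilon$, and a failed operation is replaced by an arbitrary quantum channel on the qubits it acts on. The \emph{infidelity} of a query $\sum_a \psi_a |a\rangle|0\rangle$ (with $\sum_a|\psi_a|^2=1$) is $1-\langle\Phi|\rho|\Phi\rangle$, where $\Phi=\sum_a\psi_a|a\rangle|x_a\rangle$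 and $\rho$ is the final reduced state of the address and output qubits. \textbf{Corollary.} There are lookup schemes, one for each $N = 2^n$, and constants $C>0$ and $k\in\mathbb{N}$ such that for every $n\ge 1$ the scheme for $N=2^n$ locations has the following properties. (i) Without errors it maps $\sum_a \psi_a |a\rangle|0\rangle$ to $\sum_a\psi_a|a\rangle|x_a\rangle$ for every memory content $x$ and all amplitudes $\psi$, and returns all ancillas to $|0\rangle$. (ii) It has local planar connectivity. (iii) Its qubit count is at most $C\sqrt N$. (iv) Its T count is at most $C N^{3/4}$. (v) For every $\varepsilon\in[0,1]$, every memory content, every choice of the failure channels and every normalized query, its infidelity is at most $C N^{3/4}(\log N)^k\,\varepsilon$. That is, the scheme has $\tilde O(N^{3/4})$ infidelity (in units of the gate error $\varepsilon$), $O(N^{3/4})$ T count and $O(\sqrt N)$ qubit count. -/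

import Mathlib

open scoped Matrix BigOperators

noncomputable section

namespace QLookup

/-- Computational basis states of a set `Q` of qubits. -/
abbrev Basis (Q : Type) := Q → Bool

/-- Operators (in particular density operators) on the state space of the qubits in `Q`. -/
abbrev Op (Q : Type) := Matrix (Basis Q) (Basis Q) ℂ

/-- The elementary operations of a lookup circuit with `n` address bits on the qubits `Q`.
A memory location is named by its `n`-bit address. `load a c t` consults the classical memory cell
`a`: it is a CNOT from `c` to `t` if the stored bit is `1`, and the identity otherwise.
`idle q` is a qubit waiting for one time step, `reset q` discards `q` and replaces it by `|0⟩`. -/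
inductive Gate (n : ℕ) (Q : Type) : Type
  | idle (q : Q)
  | reset (q : Q)
  | not (q : Q)
  | hadamard (q : Q)
  | phaseS (q : Q)
  | phaseT (q : Q)
  | cnot (c t : Q)
  | swap (a b : Q)
  | ccnot (c d t : Q)
  | cswap (c a b : Q)
  | load (cell : Fin n → Bool) (c t : Q)

section Semantics

variable {n : ℕ} {Q : Type} [Fintype Q] [DecidableEq Q]

/-- The permutation operator `|y⟩ ↦ |f y⟩`. -/
def permOp (f : Basis Q → Basis Q) : Op Q := fun z y => if z = f y then 1 else 0

/-- The single-qubit operator with matrix entries `m` applied to the qubit `q`. -/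
def oneQubitOp (q : Q) (m : Bool → Bool → ℂ) : Op Q :=
  fun z y => if ∀ r, r ≠ q → z r = y r then m (z q) (y q) else 0

/-- The basis map of CNOT. -/
def cnotMap (c t : Q) (y : Basis Q) : Basis Q := Function.update y t (xor (y t) (y c))

/-- The operators `K` in the Kraus form `ρ ↦ ∑ K ρ Kᴴ` of the ideal operation, for the memory
content `data`. All operations but `reset` are unitary and have a single one. -/
def Gate.kraus (data : (Fin n → Bool) → Bool) : Gate n Q → List (Op Q)
  | .idle _ => [1]
  | .reset q => [oneQubitOp q (fun z y => if z = false ∧ y = false then 1 else 0),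
                 oneQubitOp q (fun z y => if z = false ∧ y = true then 1 else 0)]
  | .not q => [permOp (fun y => Function.update y q (!(y q)))]
  | .hadamard q => [oneQubitOp q (fun z y => (if z = true ∧ y = true then -1 else 1) / (Real.sqrt 2 : ℂ))]
  | .phaseS q => [oneQubitOp q (fun z y => if z = y then (if y = true then Complex.I else 1) else 0)]
  | .phaseT q => [oneQubitOp q (fun z y =>
      if z = y then (if y = true then Complex.exp (Real.pi * Complex.I / 4) else 1) else 0)]
  | .cnot c t => [permOp (cnotMap c t)]
  | .swap a b => [permOp (fun y => y ∘ Equiv.swap a b)]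
  | .ccnot c d t => [permOp (fun y => Function.update y t (xor (y t) (y c && y d)))]
  | .cswap c a b => [permOp (fun y => if y c = true then y ∘ Equiv.swap a b else y)]
  | .load cell c t => [if data cell = true then permOp (cnotMap c t) else 1]

/-- The action of an ideal operation on density operators. -/
def Gate.apply (data : (Fin n → Bool) → Bool) (g : Gate n Q) (ρ : Op Q) : Op Q :=
  ((g.kraus data).map (fun K => K * ρ * Kᴴ)).sum

/-- The qubits that an operation touches. -/
def Gate.support : Gate n Q → Finset Q
  | .idle q => {q}
  | .reset q => {q}
  | .not q => {q}
  | .hadamard q => {q}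
  | .phaseS q => {q}
  | .phaseT q => {q}
  | .cnot c t => {c, t}
  | .swap a b => {a, b}
  | .ccnot c d t => {c, d, t}
  | .cswap c a b => {c, a, b}
  | .load _ c t => {c, t}

/-- The number of T gates an operation costs. Toffoli and controlled swap are counted through
their standard Clifford+T decompositions with seven T gates. -/
def Gate.tCost : Gate n Q → ℕ
  | .phaseT _ => 1
  | .ccnot _ _ _ => 7
  | .cswap _ _ _ => 7
  | _ => 0

/-- The operator that acts as `B` on the qubits in `s` and as the identity on all others. -/
def extend (s : Finset Q) (B : Op s) : Op Q :=
  fun z y => if ∀ r, r ∉ s → z r = y r then B (fun r => z r) (fun r => y r) else 0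

/-- An arbitrary quantum channel (completely positive trace-preserving map) on the qubits in `s`,
in Kraus form. -/
structure LocalChannel (s : Finset Q) where
  /-- the number of Kraus operators -/
  rank : ℕ
  /-- the Kraus operators -/
  K : Fin rank → Op s
  tracePreserving : ∑ i, (K i)ᴴ * K i = 1

/-- The action of a channel on the qubits in `s` on the density operators of all qubits. -/
def LocalChannel.apply {s : Finset Q} (E : LocalChannel s) (ρ : Op Q) : Op Q :=
  ∑ i, extend s (E.K i) * ρ * (extend s (E.K i))ᴴ

/-- What a faulty operation does: a choice, for the `k`-th operation of a circuit, of an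
arbitrary channel on the qubits which that operation touches. -/
abbrev Noise (n : ℕ) (Q : Type) [Fintype Q] [DecidableEq Q] :=
  ℕ → (g : Gate n Q) → LocalChannel g.support

/-- The error-free execution of a sequence of operations. -/
def idealRun (data : (Fin n → Bool) → Bool) : List (Gate n Q) → Op Q → Op Q
  | [], ρ => ρ
  | g :: gs, ρ => idealRun data gs (g.apply data ρ)

/-- The noisy execution: each operation (idling included) fails independently with
probability `ε`, and is then replaced by the channel that `noise` prescribes.
The counter `k` numbers the operations. -/
def noisyRun (data : (Fin n → Bool) → Bool) (ε : ℝ) (noise : Noise n Q) :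
    ℕ → List (Gate n Q) → Op Q → Op Q
  | _, [], ρ => ρ
  | k, g :: gs, ρ => noisyRun data ε noise (k + 1) gs
      (((1 - ε : ℝ) : ℂ) • g.apply data ρ + (ε : ℂ) • (noise k g).apply ρ)

end Semantics

/-- Nearest neighbours in the planar square lattice. -/
def GridAdj (p q : ℤ × ℤ) : Prop := |p.1 - q.1| + |p.2 - q.2| = 1

/-- Three distinct lattice points that form a connected piece of the lattice. -/
def GridTriple (p q r : ℤ × ℤ) : Prop :=
  p ≠ q ∧ q ≠ r ∧ p ≠ r ∧
    ((GridAdj p q ∧ GridAdj q r) ∨ (GridAdj q p ∧ GridAdj p r) ∨ (GridAdj p r ∧ GridAdj r q))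

/-- Locality of an operation on qubits that sit at points of the planar lattice. -/
def Gate.IsLocal {n : ℕ} {sites : Finset (ℤ × ℤ)} : Gate n sites → Prop
  | .cnot c t => GridAdj c t
  | .swap a b => GridAdj a b
  | .ccnot c d t => GridTriple c d t
  | .cswap c a b => GridTriple c a b
  | .load _ c t => GridAdj c t
  | _ => True

/-- A lookup scheme with `n` address bits, that is for `N = 2 ^ n` one-bit memory locations:
a finite set of lattice points carrying one qubit each, the places of the address qubits and of the
output qubit, and a circuit given as a list of time steps. In each time step every qubit takes part
in exactly one operation, which may be `idle`. The circuit does not depend on the memory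
content, which enters only when the `load` operations are executed. -/
structure LookupScheme (n : ℕ) where
  /-- the places of all qubits -/
  sites : Finset (ℤ × ℤ)
  /-- the places of the address qubits -/
  addr : Fin n → sites
  /-- the place of the output qubit -/
  out : sites
  addr_injective : Function.Injective addr
  out_ne_addr : ∀ i, out ≠ addr i
  /-- the time steps -/
  steps : List (List (Gate n sites))
  disjoint_in_step : ∀ st ∈ steps, st.Pairwise (fun g g' => Disjoint g.support g'.support)
  covered_in_step : ∀ st ∈ steps, ∀ q, ∃ g ∈ st, q ∈ g.support

namespace LookupScheme

variable {n : ℕ} (S : LookupScheme n)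

/-- The operations of all time steps in order of execution. Operations of one time step act on
disjoint sets of qubits, so that their relative order is immaterial. -/
def ops : List (Gate n S.sites) := S.steps.flatten

/-- All gates act on nearest neighbours of the planar lattice. -/
def IsPlanarLocal : Prop := ∀ g ∈ S.ops, g.IsLocal

/-- The total number of qubits, with address, output and ancilla qubits. -/
def qubitCount : ℕ := S.sites.card

/-- The number of T gates. -/
def tCount : ℕ := (S.ops.map Gate.tCost).sum

/-- `q` is neither an address qubit nor the output qubit. -/
def IsAncilla (q : S.sites) : Prop := q ≠ S.out ∧ ∀ i, q ≠ S.addr i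

/-- The address and the output bit of a basis state. -/
def readout (y : Basis S.sites) : (Fin n → Bool) × Bool := (fun i => y (S.addr i), y S.out)

open Classical in
/-- A vector of the address and output registers, with all ancilla qubits in `|0⟩`. -/
def withAncillas (v : (Fin n → Bool) × Bool → ℂ) : Basis S.sites → ℂ :=
  fun y => if ∀ q, S.IsAncilla q → y q = false then v (S.readout y) else 0

/-- The density operator `|v⟩⟨v|`. -/
def pureState {Q : Type} (v : Basis Q → ℂ) : Op Q := Matrix.vecMulVec v (star v)

/-- The query `∑ ψ_a |a⟩|0⟩`. -/
def query (ψ : (Fin n → Bool) → ℂ) : (Fin n → Bool) × Bool → ℂ :=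
  fun p => if p.2 = false then ψ p.1 else 0

/-- The correct answer `∑ ψ_a |a⟩|data a⟩`. -/
def answer (data : (Fin n → Bool) → Bool) (ψ : (Fin n → Bool) → ℂ) :
    (Fin n → Bool) × Bool → ℂ :=
  fun p => if p.2 = data p.1 then ψ p.1 else 0

/-- Without errors the circuit maps `∑ ψ_a |a⟩|0⟩` to `∑ ψ_a |a⟩|data a⟩`, for all memory
contents and all superpositions of addresses, and returns all ancilla qubits to `|0⟩`. -/
def IsLookup : Prop :=
  ∀ (data : (Fin n → Bool) → Bool) (ψ : (Fin n → Bool) → ℂ),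
    idealRun data S.ops (pureState (S.withAncillas (query ψ))) =
      pureState (S.withAncillas (answer data ψ))

open Classical in
/-- The reduced state of the address and output registers (partial trace over the ancillas). -/
def reduced (ρ : Op S.sites) : Matrix ((Fin n → Bool) × Bool) ((Fin n → Bool) × Bool) ℂ :=
  fun p p' => ∑ z, ∑ y,
    if S.readout z = p ∧ S.readout y = p' ∧ (∀ q, S.IsAncilla q → z q = y q) then ρ z y else 0

/-- The infidelity `1 - ⟨answer| ρ |answer⟩` of one noisy query, where `ρ` is the final state of
the address and output registers. -/
def infidelity (data : (Fin n → Bool) → Bool) (ε : ℝ) (noise : Noise n S.sites)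
    (ψ : (Fin n → Bool) → ℂ) : ℝ :=
  1 - (star (answer data ψ) ⬝ᵥ
    (S.reduced (noisyRun data ε noise 0 S.ops (pureState (S.withAncillas (query ψ)))) *ᵥ
      answer data ψ)).re

end LookupScheme

end QLookup

end

/-! Split an address into a leaf number `b`, an offset `l` and a row `h` of about n/4, n/4 and n/2
bits, so that the numbers of values satisfy L, R ≈ N^(1/4) and H ≈ N^(1/2). A cyclic rail of 2L
qubits runs past L leaves, each with a cyclic ring of R qubits and R accumulators; rail and rings
turn by one place per tick. A flag raised at leaf `b` (in superposition over the addresses) controls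
a swap that splices ring `b` into the rail, so that each address sees one cycle of length 2L + R. A
control qubit put on the rail at tick `h` is thus led into ring `b` only, where it triggers the
loading of the R bits of row `h` into the accumulators; after a full turn it is erased. The bits are
then exchanged into the ring and ride past the output, where the one with offset `l` is copied;
finally everything is undone. Only permutation gates occur, each its own inverse, so correctness
(`run_program`) is a computation with basis states, and reversing a list of time steps inverts it.

There are O(H + L + R) = O(√N) ticks of O(n) time steps, and O(LR + L + n) = O(√N) qubits. Loading
needs no T gates, so a tick costs O(L + n) of them, which gives N^(3/4) in total
(`CostBound.program`).

For the infidelity, qubits times time would give about N. However, a leaf whose flag is down is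
decoupled: an error inside leaf `b'` leaves all branches with another leaf in the ideal state,
tensored with a state of leaf `b'` that does not depend on the address (`IsSliced`). Such an error
costs at most 4p, where p is the weight of leaf `b'` in the query (`fidelity_answer_ge`). The
weights sum to 1, so in each time step all leaves together count like O(R) qubits. With the O(L + n)
shared qubits, whose errors are charged in full, this gives O(n √N) · O(N^(1/4))
(`fidelity_noisyRun_ge`, `infidelity_le`). That unused leaves do stay decoupled is
`shieldedLayers_program`. -/

noncomputable section

namespace QLookup

/-! ### Reversible gates and time steps as permutations of basis states -/

section Action

variable {n : ℕ} {Q : Type} [DecidableEq Q]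

/-- The action of a classical reversible gate on basis states (the identity for all other gates). -/
def Gate.act (data : (Fin n → Bool) → Bool) : Gate n Q → Basis Q → Basis Q
  | .not q, y => Function.update y q (!(y q))
  | .cnot c t, y => cnotMap c t y
  | .swap a b, y => y ∘ Equiv.swap a b
  | .ccnot c d t, y => Function.update y t (xor (y t) (y c && y d))
  | .cswap c a b, y => if y c = true then y ∘ Equiv.swap a b else y
  | .load cell c t, y => if data cell = true then cnotMap c t y else y
  | _, y => y

/-- A permutation of the basis states that is an involution. -/
def Gate.IsReversible : Gate n Q → Prop
  | .idle _ => True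
  | .not _ => True
  | .cnot c t => c ≠ t
  | .swap _ _ => True
  | .ccnot c d t => c ≠ t ∧ d ≠ t
  | .cswap c a b => c ≠ a ∧ c ≠ b
  | .load _ c t => c ≠ t
  | _ => False

theorem Gate.act_act (data : (Fin n → Bool) → Bool) {g : Gate n Q} (hg : g.IsReversible)
    (y : Basis Q) : g.act data (g.act data y) = y := by
  have hc : ∀ c t : Q, c ≠ t → cnotMap c t (cnotMap c t y) = y := by
    intro c t h
    funext q
    by_cases hq : q = t
    · subst hq; simp [cnotMap, Function.update_of_ne h]
    · simp [cnotMap, Function.update_of_ne hq]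
  cases g with
  | idle q => rfl
  | reset q => rfl
  | hadamard q => rfl
  | phaseS q => rfl
  | phaseT q => rfl
  | not q => funext r; by_cases h : r = q <;> simp [Gate.act, h]
  | cnot c t => exact hc c t hg
  | swap a b => funext r; simp [Gate.act]
  | ccnot c d t =>
    obtain ⟨h1, h2⟩ := hg
    funext q
    by_cases hq : q = t
    · subst hq; simp [Gate.act, Function.update_of_ne h1, Function.update_of_ne h2]
    · simp [Gate.act, Function.update_of_ne hq]
  | cswap c a b =>
    obtain ⟨h1, h2⟩ := hg
    by_cases h : y c = true
    · simp only [Gate.act, h, if_true, Function.comp_apply, Equiv.swap_apply_of_ne_of_ne h1 h2]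
      funext r; simp
    · simp [Gate.act, h]
  | load cell c t =>
    by_cases h : data cell = true
    · simpa [Gate.act, h] using hc c t hg
    · simp [Gate.act, h]

theorem Gate.act_of_notMem (data : (Fin n → Bool) → Bool) (g : Gate n Q) (y : Basis Q) {q : Q}
    (hq : q ∉ g.support) : g.act data y q = y q := by
  cases g with
  | swap a b =>
    simp only [Gate.support, Finset.mem_insert, Finset.mem_singleton, not_or] at hq
    simp [Gate.act, Equiv.swap_apply_of_ne_of_ne hq.1 hq.2]
  | cswap c a b =>
    simp only [Gate.support, Finset.mem_insert, Finset.mem_singleton, not_or] at hq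
    by_cases h : y c = true <;> simp [Gate.act, h, Equiv.swap_apply_of_ne_of_ne hq.2.1 hq.2.2]
  | load cell c t =>
    simp only [Gate.support, Finset.mem_insert, Finset.mem_singleton, not_or] at hq
    by_cases h : data cell = true <;> simp [Gate.act, h, cnotMap, hq]
  | _ => simp_all [Gate.act, Gate.support, cnotMap]

theorem Gate.act_congr (data : (Fin n → Bool) → Bool) (g : Gate n Q) {y y' : Basis Q}
    (h : ∀ q ∈ g.support, y q = y' q) {q : Q} (hq : q ∈ g.support) :
    g.act data y q = g.act data y' q := by
  have hc : ∀ c t : Q, y c = y' c → y t = y' t → q = c ∨ q = t →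
      cnotMap c t y q = cnotMap c t y' q := by
    intro c t h1 h2 h3
    by_cases hq : q = t
    · subst hq; simp [cnotMap, h1, h2]
    · simp only [cnotMap, Function.update_of_ne hq]
      rcases h3 with rfl | rfl <;> assumption
  have hs : ∀ a b : Q, y a = y' a → y b = y' b → y q = y' q →
      y (Equiv.swap a b q) = y' (Equiv.swap a b q) := by
    intro a b h1 h2 h3
    by_cases ha : q = a
    · subst ha; simpa using h2
    · by_cases hb : q = b
      · subst hb; simpa using h1
      · simpa [Equiv.swap_apply_of_ne_of_ne ha hb] using h3
  cases g with
  | idle r => exact h q hq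
  | reset r => exact h q hq
  | hadamard r => exact h q hq
  | phaseS r => exact h q hq
  | phaseT r => exact h q hq
  | not r =>
    simp only [Gate.support, Finset.mem_singleton] at h hq
    subst hq
    simp [Gate.act, h]
  | cnot c t =>
    exact hc c t (h _ (by simp [Gate.support])) (h _ (by simp [Gate.support]))
      (by simpa [Gate.support] using hq)
  | swap a b =>
    exact hs a b (h _ (by simp [Gate.support])) (h _ (by simp [Gate.support])) (h q hq)
  | ccnot c d t =>
    have h1 := h c (by simp [Gate.support])
    have h2 := h d (by simp [Gate.support])
    have h3 := h t (by simp [Gate.support])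
    by_cases hqt : q = t
    · subst hqt; simp [Gate.act, h1, h2, h3]
    · simp [Gate.act, Function.update_of_ne hqt, h q hq]
  | cswap c a b =>
    have h1 := h c (by simp [Gate.support])
    by_cases hcc : y' c = true
    · simpa [Gate.act, h1, hcc] using
        hs a b (h _ (by simp [Gate.support])) (h _ (by simp [Gate.support])) (h q hq)
    · simpa [Gate.act, h1, hcc] using h q hq
  | load cell c t =>
    by_cases hcc : data cell = true
    · simpa [Gate.act, hcc] using
        hc c t (h _ (by simp [Gate.support])) (h _ (by simp [Gate.support]))
          (by simpa [Gate.support] using hq)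
    · simpa [Gate.act, hcc] using h q hq

/-- The basis action of a sequence of gates. -/
def runActs (data : (Fin n → Bool) → Bool) : List (Gate n Q) → Basis Q → Basis Q
  | [], y => y
  | g :: gs, y => runActs data gs (g.act data y)

theorem runActs_append (data : (Fin n → Bool) → Bool) (l l' : List (Gate n Q)) (y : Basis Q) :
    runActs data (l ++ l') y = runActs data l' (runActs data l y) := by
  induction l generalizing y with
  | nil => rfl
  | cons g gs ih => exact ih _

theorem runActs_bijective (data : (Fin n → Bool) → Bool) {gs : List (Gate n Q)}
    (hgs : ∀ g ∈ gs, g.IsReversible) : Function.Bijective (runActs data gs) := by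
  induction gs with
  | nil => exact Function.bijective_id
  | cons g gs ih =>
    simp only [List.mem_cons, forall_eq_or_imp] at hgs
    exact (ih hgs.2).comp
      (Function.Involutive.bijective (f := g.act data) fun y => Gate.act_act data hgs.1 y)

theorem runActs_of_notMem (data : (Fin n → Bool) → Bool) (l : List (Gate n Q)) (y : Basis Q) {q : Q}
    (hq : ∀ g ∈ l, q ∉ g.support) : runActs data l y q = y q := by
  induction l generalizing y with
  | nil => rfl
  | cons g gs ih =>
    simp only [List.mem_cons, forall_eq_or_imp] at hq
    rw [runActs, ih _ hq.2, Gate.act_of_notMem data g y hq.1]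

/-- Gates before `g` do not alter its inputs and gates after it do not touch its outputs. Hence the
arbitrary order in which `Layer.gates` lists a time step is harmless. -/
theorem runActs_of_mem (data : (Fin n → Bool) → Bool) (l : List (Gate n Q))
    (hl : l.Pairwise fun g g' => Disjoint g.support g'.support) (y : Basis Q) {g : Gate n Q}
    (hg : g ∈ l) {q : Q} (hq : q ∈ g.support) : runActs data l y q = g.act data y q := by
  induction l generalizing y with
  | nil => simp at hg
  | cons g' gs ih =>
    rw [List.pairwise_cons] at hl
    rw [runActs]
    rcases List.mem_cons.1 hg with rfl | hg'
    · exact runActs_of_notMem data gs _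
        fun g'' hg'' => Finset.disjoint_left.1 (hl.1 g'' hg'') hq
    · rw [ih hl.2 _ hg']
      exact Gate.act_congr data g (fun r hr => Gate.act_of_notMem data g' y
        (Finset.disjoint_right.1 (hl.1 g hg') hr)) hq

end Action

/-- A time step, given by the operation in which each qubit takes part. -/
structure Layer (n : ℕ) (Q : Type) [DecidableEq Q] where
  /-- the operation in which a qubit takes part -/
  gateAt : Q → Gate n Q
  mem_support : ∀ q, q ∈ (gateAt q).support
  gateAt_eq : ∀ q, ∀ r ∈ (gateAt q).support, gateAt r = gateAt q

namespace Layer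

variable {n : ℕ} {Q : Type} [DecidableEq Q]

/-- The basis action of a time step. -/
def act (data : (Fin n → Bool) → Bool) (l : Layer n Q) (y : Basis Q) : Basis Q :=
  fun q => (l.gateAt q).act data y q

/-- On the support of one gate the whole layer acts as that gate does, so involutivity passes from
gates to layers. This is what lets a computation be undone by its own layers in reverse order. -/
theorem act_act (data : (Fin n → Bool) → Bool) (l : Layer n Q)
    (hl : ∀ q, (l.gateAt q).IsReversible) (y : Basis Q) : l.act data (l.act data y) = y := by
  funext q
  have h : ∀ r ∈ (l.gateAt q).support, l.act data y r = (l.gateAt q).act data y r := by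
    intro r hr
    rw [act, l.gateAt_eq q r hr]
  rw [act, Gate.act_congr data _ h (l.mem_support q), Gate.act_act data (hl q)]

variable [Fintype Q]

open Classical in
/-- The operations of a time step. -/
def gates (l : Layer n Q) : List (Gate n Q) := (Finset.univ.image l.gateAt).toList

theorem mem_gates {l : Layer n Q} {g : Gate n Q} : g ∈ l.gates ↔ ∃ q, l.gateAt q = g := by
  simp [gates]

theorem pairwise_gates (l : Layer n Q) :
    l.gates.Pairwise fun g g' => Disjoint g.support g'.support := by
  classical
  have h : l.gates.Nodup := Finset.nodup_toList _
  refine List.Pairwise.imp_of_mem ?_ h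
  intro g g' hg hg' hne
  obtain ⟨q, rfl⟩ := mem_gates.1 hg
  obtain ⟨q', rfl⟩ := mem_gates.1 hg'
  rw [Finset.disjoint_left]
  intro r hr hr'
  exact hne ((l.gateAt_eq q r hr).symm.trans (l.gateAt_eq q' r hr'))

theorem runActs_gates (data : (Fin n → Bool) → Bool) (l : Layer n Q) (y : Basis Q) :
    runActs data l.gates y = l.act data y := by
  funext q
  exact runActs_of_mem data _ l.pairwise_gates y (mem_gates.2 ⟨q, rfl⟩) (l.mem_support q)

/-- A quantity that is dominated, for each operation, by its value at one of the qubits that the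
operation touches is dominated in total by the sum over all qubits. -/
theorem sum_gates_le {M : Type*} [AddCommMonoid M] [PartialOrder M] [IsOrderedAddMonoid M]
    (l : Layer n Q) (cost : Gate n Q → M) (bound : Q → M) (hpos : ∀ q, 0 ≤ bound q)
    (h : ∀ q, ∃ r, l.gateAt r = l.gateAt q ∧ cost (l.gateAt q) ≤ bound r) :
    (l.gates.map cost).sum ≤ ∑ q, bound q := by
  classical
  rcases isEmpty_or_nonempty Q with _ | _
  · simp [gates]
  have h' : ∀ g ∈ Finset.univ.image l.gateAt, ∃ r, l.gateAt r = g ∧ cost g ≤ bound r := by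
    intro g hg
    obtain ⟨q, -, rfl⟩ := Finset.mem_image.1 hg
    exact h q
  choose! r hr hcost using h'
  rw [gates, Finset.sum_map_toList]
  calc ∑ g ∈ Finset.univ.image l.gateAt, cost g
      ≤ ∑ g ∈ Finset.univ.image l.gateAt, bound (r g) := Finset.sum_le_sum hcost
    _ = ∑ q ∈ (Finset.univ.image l.gateAt).image r, bound q := by
        refine (Finset.sum_image ?_).symm
        -- Distinct gates have distinct representatives, because `gateAt` recovers the gate from its
        -- representative.
        intro g hg g' hg' e
        rw [← hr g hg, ← hr g' hg', e]
    _ ≤ ∑ q, bound q := Finset.sum_le_sum_of_subset_of_nonneg (Finset.subset_univ _)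
        fun q _ _ => hpos q

end Layer

/-! ### Renaming of qubits -/

section Relabel

variable {n : ℕ} {Q Q' : Type}

/-- The same operation on renamed qubits. -/
def Gate.relabel (e : Q ≃ Q') : Gate n Q → Gate n Q'
  | .idle q => .idle (e q)
  | .reset q => .reset (e q)
  | .not q => .not (e q)
  | .hadamard q => .hadamard (e q)
  | .phaseS q => .phaseS (e q)
  | .phaseT q => .phaseT (e q)
  | .cnot c t => .cnot (e c) (e t)
  | .swap a b => .swap (e a) (e b)
  | .ccnot c d t => .ccnot (e c) (e d) (e t)
  | .cswap c a b => .cswap (e c) (e a) (e b)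
  | .load cell c t => .load cell (e c) (e t)

theorem Gate.tCost_relabel (e : Q ≃ Q') (g : Gate n Q) : (g.relabel e).tCost = g.tCost := by
  cases g <;> rfl

theorem Gate.isReversible_relabel (e : Q ≃ Q') {g : Gate n Q} (hg : g.IsReversible) :
    (g.relabel e).IsReversible := by
  cases g <;> simp_all [Gate.relabel, Gate.IsReversible]

variable [DecidableEq Q] [DecidableEq Q']

theorem Gate.mem_support_relabel (e : Q ≃ Q') (g : Gate n Q) (q : Q') :
    q ∈ (g.relabel e).support ↔ e.symm q ∈ g.support := by
  cases g <;> simp [Gate.relabel, Gate.support, Equiv.symm_apply_eq]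

theorem Gate.act_relabel (data : (Fin n → Bool) → Bool) (e : Q ≃ Q') (g : Gate n Q)
    (y : Basis Q') : (g.relabel e).act data y = g.act data (y ∘ e) ∘ e.symm := by
  have hu : ∀ (t : Q) (x : Bool), Function.update y (e t) x
      = Function.update (y ∘ e) t x ∘ e.symm := by
    intro t x
    funext q
    by_cases h : q = e t
    · subst h; simp
    · have h' : e.symm q ≠ t := fun h' => h (by rw [← h']; simp)
      simp [Function.update_of_ne h, Function.update_of_ne h']
  have hs : ∀ a b : Q, y ∘ Equiv.swap (e a) (e b) = ((y ∘ e) ∘ Equiv.swap a b) ∘ e.symm := by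
    intro a b
    funext q
    obtain ⟨q, rfl⟩ := e.surjective q
    simp only [Function.comp_apply, Equiv.symm_apply_apply]
    congr 1
    by_cases ha : q = a
    · subst ha; simp
    · by_cases hb : q = b
      · subst hb; simp
      · rw [Equiv.swap_apply_of_ne_of_ne ha hb, Equiv.swap_apply_of_ne_of_ne] <;> simpa
  have hi : y = (y ∘ e) ∘ e.symm := by funext q; simp
  cases g with
  | cswap c a b =>
    by_cases h : y (e c) = true
    · simpa [Gate.relabel, Gate.act, h] using hs a b
    · simpa [Gate.relabel, Gate.act, h] using hi
  | load cell c t =>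
    by_cases h : data cell = true
    · simpa [Gate.relabel, Gate.act, h, cnotMap] using hu t _
    · simpa [Gate.relabel, Gate.act, h] using hi
  | not q => simpa [Gate.relabel, Gate.act] using hu q _
  | cnot c t => simpa [Gate.relabel, Gate.act, cnotMap] using hu t _
  | ccnot c d t => simpa [Gate.relabel, Gate.act] using hu t _
  | swap a b => exact hs a b
  | _ => exact hi

/-- The same time step on renamed qubits. -/
def Layer.relabel (e : Q ≃ Q') (l : Layer n Q) : Layer n Q' where
  gateAt q := (l.gateAt (e.symm q)).relabel e
  mem_support q := (Gate.mem_support_relabel e _ q).2 (l.mem_support _)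
  gateAt_eq q r hr := by
    rw [l.gateAt_eq _ _ ((Gate.mem_support_relabel e _ r).1 hr)]

theorem Layer.act_relabel (data : (Fin n → Bool) → Bool) (e : Q ≃ Q') (l : Layer n Q)
    (y : Basis Q') : (l.relabel e).act data y = l.act data (y ∘ e) ∘ e.symm := by
  funext q
  simp only [Layer.act, Layer.relabel, Gate.act_relabel, Function.comp_apply]

end Relabel

end QLookup

namespace QLookup

/-! ### Gates and channels on density operators -/

section Channels

open scoped ComplexOrder

variable {n : ℕ} {Q : Type} [Fintype Q] [DecidableEq Q]

theorem permOp_conj_apply {f : Basis Q → Basis Q} (hf : Function.Involutive f) (ρ : Op Q)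
    (z z' : Basis Q) : (permOp f * ρ * (permOp f)ᴴ) z z' = ρ (f z) (f z') := by
  have h : ∀ x y : Basis Q, x = f y ↔ y = f x := fun x y =>
    ⟨fun e => by rw [e, hf], fun e => by rw [e, hf]⟩
  simp only [Matrix.mul_apply, permOp, Matrix.conjTranspose_apply, h z, h z', ite_mul, one_mul,
    zero_mul, apply_ite star, star_one, star_zero, mul_ite, mul_one, mul_zero,
    Finset.sum_ite_eq', Finset.mem_univ, if_true]

theorem Gate.kraus_eq (data : (Fin n → Bool) → Bool) {g : Gate n Q} (hg : g.IsReversible) :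
    g.kraus data = [permOp (g.act data)] := by
  have h1 : (1 : Op Q) = permOp fun y => y := by
    ext z y
    simp [permOp, Matrix.one_apply]
  cases g with
  | idle q => exact congrArg (fun K => [K]) h1
  | load cell c t =>
    have h2 : (Gate.load cell c t).act data = if data cell = true then cnotMap c t else id := by
      funext y
      by_cases h : data cell = true <;> simp [Gate.act, h]
    by_cases h : data cell = true
    · simp [Gate.kraus, h2, h]
    · have h3 : (1 : Op Q) = permOp id := h1
      simp [Gate.kraus, h2, h, h3]
  | reset q => exact hg.elim
  | hadamard q => exact hg.elim
  | phaseS q => exact hg.elim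
  | phaseT q => exact hg.elim
  | _ => rfl

theorem Gate.apply_eq (data : (Fin n → Bool) → Bool) {g : Gate n Q} (hg : g.IsReversible)
    (ρ : Op Q) : g.apply data ρ = permOp (g.act data) * ρ * (permOp (g.act data))ᴴ := by
  simp [Gate.apply, Gate.kraus_eq data hg]

theorem Gate.apply_apply (data : (Fin n → Bool) → Bool) {g : Gate n Q} (hg : g.IsReversible)
    (ρ : Op Q) (z z' : Basis Q) :
    g.apply data ρ z z' = ρ (g.act data z) (g.act data z') := by
  rw [Gate.apply_eq data hg, permOp_conj_apply fun y => Gate.act_act data hg y]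

theorem Gate.trace_apply (data : (Fin n → Bool) → Bool) {g : Gate n Q} (hg : g.IsReversible)
    (ρ : Op Q) : (g.apply data ρ).trace = ρ.trace := by
  simp only [Matrix.trace, Matrix.diag_apply, Gate.apply_apply data hg]
  exact Equiv.sum_comp (Function.Involutive.toPerm (g.act data) fun y => Gate.act_act data hg y)
    fun y => ρ y y

theorem Gate.posSemidef_apply (data : (Fin n → Bool) → Bool) {g : Gate n Q}
    (hg : g.IsReversible) {ρ : Op Q} (hρ : ρ.PosSemidef) : (g.apply data ρ).PosSemidef := by
  rw [Gate.apply_eq data hg]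
  exact hρ.mul_mul_conjTranspose_same _

/-- Overwrite the qubits in `s`. -/
def overwrite (s : Finset Q) (y : Basis Q) (p : Basis s) : Basis Q :=
  fun q => if h : q ∈ s then p ⟨q, h⟩ else y q

theorem extend_overwrite (s : Finset Q) (B : Op s) (z : Basis Q) (p : Basis s) :
    extend s B z (overwrite s z p) = B (fun r => z r) p := by
  simp +contextual [extend, overwrite]

/-- Row `z` of the extended operator lives on the states that differ from `z` only inside `s`, and
`overwrite s z` parametrizes exactly these. -/
theorem sum_extend_mul (s : Finset Q) (B : Op s) (z : Basis Q) (F : Basis Q → ℂ) :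
    ∑ y, extend s B z y * F y = ∑ p, B (fun r => z r) p * F (overwrite s z p) := by
  symm
  refine Finset.sum_of_injOn (overwrite s z) ?_ (by simp) ?_ ?_
  · intro p _ p' _ h
    funext r
    simpa [overwrite] using congrFun h r
  · intro y _ hy
    have : ¬ ∀ r, r ∉ s → z r = y r := by
      intro h
      refine hy ⟨fun r => y r, by simp, ?_⟩
      funext q
      by_cases hq : q ∈ s
      · simp [overwrite, hq]
      · simp [overwrite, hq, h q hq]
    simp [extend, this]
  · intro p _
    rw [extend_overwrite]

theorem extend_conjTranspose (s : Finset Q) (B : Op s) : (extend s B)ᴴ = extend s Bᴴ := by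
  ext z y
  simp only [Matrix.conjTranspose_apply, extend, apply_ite star, star_zero]
  simp only [eq_comm]

theorem extend_mul (s : Finset Q) (A B : Op s) : extend s A * extend s B = extend s (A * B) := by
  ext z y
  rw [Matrix.mul_apply, sum_extend_mul]
  by_cases h : ∀ r, r ∉ s → z r = y r
  · rw [extend, if_pos h, Matrix.mul_apply]
    refine Finset.sum_congr rfl fun p _ => ?_
    rw [extend, if_pos]
    · simp [overwrite]
    · intro r hr
      simp [overwrite, hr, h r hr]
  · rw [extend, if_neg h]
    refine Finset.sum_eq_zero fun p _ => ?_
    rw [extend, if_neg, mul_zero]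
    intro h'
    refine h fun r hr => ?_
    simpa [overwrite, hr] using h' r hr

theorem extend_one (s : Finset Q) : extend s (1 : Op s) = 1 := by
  ext z y
  by_cases h : z = y
  · subst h; simp [extend]
  · rw [Matrix.one_apply_ne h, extend]
    split_ifs with h1
    · refine Matrix.one_apply_ne fun h2 => h (funext fun q => ?_)
      by_cases hq : q ∈ s
      · exact congrFun h2 ⟨q, hq⟩
      · exact h1 q hq
    · rfl

theorem extend_sum (s : Finset Q) {κ : Type*} (t : Finset κ) (B : κ → Op s) :
    extend s (∑ i ∈ t, B i) = ∑ i ∈ t, extend s (B i) := by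
  ext z y
  by_cases h : ∀ r, r ∉ s → z r = y r
  · simp [extend, Matrix.sum_apply]
  · simp [extend, Matrix.sum_apply, h]

theorem LocalChannel.trace_apply {s : Finset Q} (E : LocalChannel s) (ρ : Op Q) :
    (E.apply ρ).trace = ρ.trace := by
  have h : ∑ i, (extend s (E.K i))ᴴ * extend s (E.K i) = 1 := by
    simp only [extend_conjTranspose, extend_mul]
    rw [← extend_sum, E.tracePreserving, extend_one]
  rw [LocalChannel.apply, Matrix.trace_sum]
  simp only [Matrix.trace_mul_cycle _ ρ]
  rw [← Matrix.trace_sum, ← Finset.sum_mul, h, one_mul]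

theorem LocalChannel.posSemidef_apply {s : Finset Q} (E : LocalChannel s) {ρ : Op Q}
    (hρ : ρ.PosSemidef) : (E.apply ρ).PosSemidef :=
  Matrix.posSemidef_sum _ fun _ _ => hρ.mul_mul_conjTranspose_same _

/-- An entry of the output involves only input entries with the same bits outside of `s`; this is
how a channel inside damaged regions will be seen to act on one tensor factor. -/
theorem LocalChannel.apply_apply {s : Finset Q} (E : LocalChannel s) (ρ : Op Q)
    (z z' : Basis Q) :
    E.apply ρ z z' = ∑ i, ∑ p', ∑ p, E.K i (fun r => z r) p *
      ρ (overwrite s z p) (overwrite s z' p') * star (E.K i (fun r => z' r) p') := by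
  rw [LocalChannel.apply, Matrix.sum_apply]
  refine Finset.sum_congr rfl fun i _ => ?_
  have h : ∀ M : Op Q, (M * (extend s (E.K i))ᴴ) z z' =
      ∑ p', M z (overwrite s z' p') * star (E.K i (fun r => z' r) p') := by
    intro M
    have := congrArg star (sum_extend_mul s (E.K i) z' fun y => star (M z y))
    simpa [Matrix.mul_apply, mul_comm] using this
  rw [h]
  refine Finset.sum_congr rfl fun p' _ => ?_
  rw [Matrix.mul_apply, sum_extend_mul, Finset.sum_mul]

theorem Gate.apply_add (data : (Fin n → Bool) → Bool) (g : Gate n Q) (ρ ρ' : Op Q) :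
    g.apply data (ρ + ρ') = g.apply data ρ + g.apply data ρ' := by
  simp only [Gate.apply, Matrix.mul_add, Matrix.add_mul, List.sum_map_add]

theorem Gate.apply_smul (data : (Fin n → Bool) → Bool) (g : Gate n Q) (t : ℂ) (ρ : Op Q) :
    g.apply data (t • ρ) = t • g.apply data ρ := by
  simp only [Gate.apply, Matrix.mul_smul, Matrix.smul_mul, List.smul_sum, List.map_map]
  rfl

theorem LocalChannel.apply_add {s : Finset Q} (E : LocalChannel s) (ρ ρ' : Op Q) :
    E.apply (ρ + ρ') = E.apply ρ + E.apply ρ' := by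
  simp only [LocalChannel.apply, Matrix.mul_add, Matrix.add_mul, Finset.sum_add_distrib]

theorem LocalChannel.apply_smul {s : Finset Q} (E : LocalChannel s) (t : ℂ) (ρ : Op Q) :
    E.apply (t • ρ) = t • E.apply ρ := by
  simp only [LocalChannel.apply, Matrix.mul_smul, Matrix.smul_mul, Finset.smul_sum]

theorem noisyRun_add (data : (Fin n → Bool) → Bool) (ε : ℝ) (noise : Noise n Q)
    (gs : List (Gate n Q)) (k : ℕ) (ρ ρ' : Op Q) :
    noisyRun data ε noise k gs (ρ + ρ') =
      noisyRun data ε noise k gs ρ + noisyRun data ε noise k gs ρ' := by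
  induction gs generalizing k ρ ρ' with
  | nil => rfl
  | cons g gs ih =>
    simp only [noisyRun]
    rw [← ih, Gate.apply_add, LocalChannel.apply_add, smul_add, smul_add, add_add_add_comm]

theorem noisyRun_smul (data : (Fin n → Bool) → Bool) (ε : ℝ) (noise : Noise n Q)
    (gs : List (Gate n Q)) (k : ℕ) (t : ℂ) (ρ : Op Q) :
    noisyRun data ε noise k gs (t • ρ) = t • noisyRun data ε noise k gs ρ := by
  induction gs generalizing k ρ with
  | nil => rfl
  | cons g gs ih =>
    simp only [noisyRun]
    rw [← ih, Gate.apply_smul, LocalChannel.apply_smul, smul_add, smul_comm t, smul_comm t]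

theorem posSemidef_noisyRun (data : (Fin n → Bool) → Bool) {ε : ℝ} (h0 : 0 ≤ ε) (h1 : ε ≤ 1)
    (noise : Noise n Q) {gs : List (Gate n Q)} (hgs : ∀ g ∈ gs, g.IsReversible) (k : ℕ)
    {ρ : Op Q} (hρ : ρ.PosSemidef) : (noisyRun data ε noise k gs ρ).PosSemidef := by
  induction gs generalizing k ρ with
  | nil => exact hρ
  | cons g gs ih =>
    simp only [List.mem_cons, forall_eq_or_imp] at hgs
    refine ih hgs.2 _ (Matrix.PosSemidef.add ?_ ?_)
    · exact (Gate.posSemidef_apply data hgs.1 hρ).smul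
        (Complex.zero_le_real.2 (sub_nonneg.2 h1))
    · exact ((noise k g).posSemidef_apply hρ).smul (Complex.zero_le_real.2 h0)

theorem idealRun_apply (data : (Fin n → Bool) → Bool) {gs : List (Gate n Q)}
    (hgs : ∀ g ∈ gs, g.IsReversible) (ρ : Op Q) (y y' : Basis Q) :
    idealRun data gs ρ (runActs data gs y) (runActs data gs y') = ρ y y' := by
  induction gs generalizing ρ y y' with
  | nil => rfl
  | cons g gs ih =>
    simp only [List.mem_cons, forall_eq_or_imp] at hgs
    rw [idealRun, runActs, runActs, ih hgs.2, Gate.apply_apply data hgs.1,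
      Gate.act_act data hgs.1, Gate.act_act data hgs.1]

end Channels

end QLookup

namespace QLookup

/-! ### Errors inside a leaf do not reach the other branches -/

section Shielding

open scoped ComplexOrder

variable {n : ℕ} {Q : Type} [Fintype Q] [DecidableEq Q] {ι A : Type}

open Classical in
/-- Replace the part of `s` in the regions of `B` by that of `c`. -/
def graft (region : Q → Option ι) (B : Finset ι) (s c : Basis Q) : Basis Q :=
  fun q => if ∃ b ∈ B, region q = some b then c q else s q

omit [Fintype Q] [DecidableEq Q] in
theorem graft_of_mem {region : Q → Option ι} {B : Finset ι} {s c : Basis Q} {q : Q}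
    (h : ∃ b ∈ B, region q = some b) : graft region B s c q = c q := if_pos h

omit [Fintype Q] [DecidableEq Q] in
theorem graft_of_not {region : Q → Option ι} {B : Finset ι} {s c : Basis Q} {q : Q}
    (h : ¬ ∃ b ∈ B, region q = some b) : graft region B s c q = s q := if_neg h

/-- In the basis state `s`, which belongs to the region `ℓ`, the gate does not couple
any other region to the qubits outside of it. -/
def Gate.Shielded (region : Q → Option ι) (ℓ : ι) (g : Gate n Q) (s : Basis Q) : Prop :=
  (∃ r, ∀ q ∈ g.support, region q = r) ∨
    ∃ c u v, g = .cswap c u v ∧ region c = none ∧ region u = none ∧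
      (s c = true → region v = some ℓ)

/-- All gates of a sequence are shielded when they are executed. -/
def ShieldedRun (region : Q → Option ι) (ℓ : ι) (data : (Fin n → Bool) → Bool) :
    List (Gate n Q) → Basis Q → Prop
  | [], _ => True
  | g :: gs, s => g.Shielded region ℓ s ∧ ShieldedRun region ℓ data gs (g.act data s)

omit [Fintype Q] in
theorem ShieldedRun.exists_shielded {region : Q → Option ι} {ℓ : ι}
    {data : (Fin n → Bool) → Bool} {gs : List (Gate n Q)} {s : Basis Q}
    (h : ShieldedRun region ℓ data gs s) {g : Gate n Q} (hg : g ∈ gs) :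
    ∃ s', g.Shielded region ℓ s' := by
  induction gs generalizing s with
  | nil => simp at hg
  | cons g' gs ih =>
    rcases List.mem_cons.1 hg with rfl | hg
    · exact ⟨s, h.1⟩
    · exact ih h.2 hg

/-- Seen from the branches `a` that do not belong to the regions `B`, the state is a product of
`∑ ψ a |s a⟩` outside of `B` and some state of the qubits in `B`. -/
def IsSliced (region : Q → Option ι) (leaf : A → ι) (ψ : A → ℂ) (B : Finset ι) (s : A → Basis Q)
    (ρ : Op Q) : Prop :=
  ∃ σ : Op Q, σ.trace = 1 ∧
    (∀ y y', σ y y' ≠ 0 → ∀ q, (¬ ∃ b ∈ B, region q = some b) → y q = false) ∧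
    ∀ a a', leaf a ∉ B → leaf a' ∉ B → ∀ c c',
      ρ (graft region B (s a) c) (graft region B (s a') c') =
        ψ a * star (ψ a') * σ (graft region B (fun _ => false) c)
          (graft region B (fun _ => false) c')

variable {region : Q → Option ι} {leaf : A → ι} {ψ : A → ℂ} {B : Finset ι} {s : A → Basis Q}
  {ρ : Op Q}

omit [Fintype Q] in
theorem act_graft_outside (data : (Fin n → Bool) → Bool) {g : Gate n Q}
    (hg : ∀ q ∈ g.support, ¬ ∃ b ∈ B, region q = some b) (y c : Basis Q) :
    g.act data (graft region B y c) = graft region B (g.act data y) c := by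
  funext q
  by_cases hq : q ∈ g.support
  · rw [graft_of_not (hg q hq)]
    exact Gate.act_congr data g (fun r hr => graft_of_not (hg r hr)) hq
  · rw [Gate.act_of_notMem data g _ hq]
    by_cases hb : ∃ b ∈ B, region q = some b
    · rw [graft_of_mem hb, graft_of_mem hb]
    · rw [graft_of_not hb, graft_of_not hb, Gate.act_of_notMem data g _ hq]

omit [Fintype Q] in
theorem act_graft_inside (data : (Fin n → Bool) → Bool) {g : Gate n Q}
    (hg : ∀ q ∈ g.support, ∃ b ∈ B, region q = some b) (y c : Basis Q) :
    g.act data (graft region B y c) = graft region B y (g.act data c) := by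
  funext q
  by_cases hq : q ∈ g.support
  · rw [graft_of_mem (hg q hq)]
    exact Gate.act_congr data g (fun r hr => graft_of_mem (hg r hr)) hq
  · rw [Gate.act_of_notMem data g _ hq]
    by_cases hb : ∃ b ∈ B, region q = some b
    · rw [graft_of_mem hb, graft_of_mem hb, Gate.act_of_notMem data g _ hq]
    · rw [graft_of_not hb, graft_of_not hb]

omit [Fintype Q] in
theorem graft_act_inside (data : (Fin n → Bool) → Bool) {g : Gate n Q}
    (hg : ∀ q ∈ g.support, ∃ b ∈ B, region q = some b) (y c : Basis Q) :
    graft region B (g.act data y) c = graft region B y c := by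
  funext q
  by_cases hb : ∃ b ∈ B, region q = some b
  · rw [graft_of_mem hb, graft_of_mem hb]
  · rw [graft_of_not hb, graft_of_not hb, Gate.act_of_notMem data g _ fun h => hb (hg q h)]

/-- The gate acts on the factor `σ` alone, in the same way for all good branches. -/
theorem IsSliced.apply_inside (data : (Fin n → Bool) → Bool) {g : Gate n Q}
    (hr : g.IsReversible) (hg : ∀ q ∈ g.support, ∃ b ∈ B, region q = some b)
    (h : IsSliced region leaf ψ B s ρ) :
    IsSliced region leaf ψ B (fun a => g.act data (s a)) (g.apply data ρ) := by
  obtain ⟨σ, h1, h2, h3⟩ := h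
  refine ⟨g.apply data σ, by rw [Gate.trace_apply data hr, h1], ?_, ?_⟩
  · intro y y' hy q hq
    rw [Gate.apply_apply data hr] at hy
    rw [← Gate.act_of_notMem data g y fun h => hq (hg q h)]
    exact h2 _ _ hy q hq
  · intro a a' ha ha' c c'
    simp only [graft_act_inside data hg, Gate.apply_apply data hr, act_graft_inside data hg]
    exact h3 a a' ha ha' _ _

/-- Here `σ` is unchanged: the gate avoids `B`, or in each good branch it is a controlled swap whose
control lies outside of `B` and is 0, so that it does nothing. -/
theorem IsSliced.apply_outside (data : (Fin n → Bool) → Bool) {g : Gate n Q}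
    (hr : g.IsReversible)
    (hg : (∀ q ∈ g.support, ¬ ∃ b ∈ B, region q = some b) ∨ ∀ a, leaf a ∉ B →
      ∃ c u v, g = .cswap c u v ∧ (¬ ∃ b ∈ B, region c = some b) ∧ s a c = false)
    (h : IsSliced region leaf ψ B s ρ) :
    IsSliced region leaf ψ B (fun a => g.act data (s a)) (g.apply data ρ) := by
  obtain ⟨σ, h1, h2, h3⟩ := h
  refine ⟨σ, h1, h2, ?_⟩
  have key : ∀ a, leaf a ∉ B → ∀ c, g.act data (graft region B (g.act data (s a)) c) =
      graft region B (s a) c := by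
    intro a ha c
    rcases hg with hg | hg
    · rw [act_graft_outside data hg, Gate.act_act data hr]
    · obtain ⟨x, u, v, rfl, hx, hs⟩ := hg a ha
      have e : ∀ y : Basis Q, y x = false → (Gate.cswap x u v : Gate n Q).act data y = y := by
        intro y hy
        simp [Gate.act, hy]
      rw [e _ hs, e _ (by rw [graft_of_not hx, hs])]
  intro a a' ha ha' c c'
  rw [Gate.apply_apply data hr, key a ha, key a' ha']
  exact h3 a a' ha ha' c c'

/-- A gate that meets both `B` and its complement must be a controlled swap between a shared qubit
and a region. If its control were 1 in a good branch, that region would be the branch's own leaf,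
which is not in `B`, and the gate would avoid `B` altogether. -/
theorem IsSliced.gate_apply [Nonempty A] (data : (Fin n → Bool) → Bool) {g : Gate n Q}
    (hr : g.IsReversible) (hg : ∀ a, g.Shielded region (leaf a) (s a))
    (h : IsSliced region leaf ψ B s ρ) :
    IsSliced region leaf ψ B (fun a => g.act data (s a)) (g.apply data ρ) := by
  by_cases hin : ∀ q ∈ g.support, ∃ b ∈ B, region q = some b
  · exact h.apply_inside data hr hin
  by_cases hout : ∀ q ∈ g.support, ¬ ∃ b ∈ B, region q = some b
  · exact h.apply_outside data hr (Or.inl hout)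
  refine h.apply_outside data hr (Or.inr fun a ha => ?_)
  rcases hg a with ⟨r, hr'⟩ | ⟨c, u, v, rfl, hc, hu, hv⟩
  · push Not at hin hout
    obtain ⟨q, hq, hq'⟩ := hin
    obtain ⟨q', hq1, b, hb, hq2⟩ := hout
    exact absurd (by rw [hr' q hq, ← hr' q' hq1, hq2]) (hq' b hb)
  · refine ⟨c, u, v, rfl, by simp [hc], ?_⟩
    by_contra hs
    have hv' := hv (by simpa using hs)
    apply hout
    intro q hq
    simp only [Gate.support, Finset.mem_insert, Finset.mem_singleton] at hq
    rintro ⟨b, hb, hqb⟩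
    rcases hq with rfl | rfl | rfl
    · simp [hc] at hqb
    · simp [hu] at hqb
    · rw [hv'] at hqb
      exact ha (Option.some.inj hqb ▸ hb)

/-- The channel changes only `σ`. The reference states may nevertheless take the ideal step, since
they matter only outside of `B`, where `g` does nothing; so after an error the bookkeeping continues
with the ideal run. -/
theorem IsSliced.channel_apply (data : (Fin n → Bool) → Bool) {g : Gate n Q}
    (hg : ∀ q ∈ g.support, ∃ b ∈ B, region q = some b) (E : LocalChannel g.support)
    (h : IsSliced region leaf ψ B s ρ) :
    IsSliced region leaf ψ B (fun a => g.act data (s a)) (E.apply ρ) := by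
  obtain ⟨σ, h1, h2, h3⟩ := h
  have ho : ∀ y c p, overwrite g.support (graft region B y c) p =
      graft region B y (overwrite g.support c p) := by
    intro y c p
    funext q
    by_cases hb : ∃ b ∈ B, region q = some b
    · rw [graft_of_mem hb]
      simp [overwrite, graft_of_mem hb]
    · have : q ∉ g.support := fun h => hb (hg q h)
      rw [graft_of_not hb]
      simp [overwrite, this, graft_of_not hb]
  have hp : ∀ y c, (fun r : g.support => graft region B y c r) = fun r : g.support => c r := by
    intro y c
    funext r
    rw [graft_of_mem (hg r r.2)]
  refine ⟨E.apply σ, by rw [E.trace_apply, h1], ?_, ?_⟩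
  · intro y y' hy q hq
    rw [E.apply_apply] at hy
    obtain ⟨i, -, hy⟩ := Finset.exists_ne_zero_of_sum_ne_zero hy
    obtain ⟨p', -, hy⟩ := Finset.exists_ne_zero_of_sum_ne_zero hy
    obtain ⟨p, -, hy⟩ := Finset.exists_ne_zero_of_sum_ne_zero hy
    have := h2 _ _ (right_ne_zero_of_mul (left_ne_zero_of_mul hy)) q hq
    have hq' : q ∉ g.support := fun h => hq (hg q h)
    simpa [overwrite, hq'] using this
  · intro a a' ha ha' c c'
    simp only [graft_act_inside data hg, E.apply_apply, ho, hp, h3 a a' ha ha', Finset.mul_sum]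
    refine Finset.sum_congr rfl fun i _ => Finset.sum_congr rfl fun p' _ =>
      Finset.sum_congr rfl fun p _ => ?_
    ring

/-- A union bound by induction over the gates, with `B` the set of regions hit so far. Without
failure the sliced form persists; a failure inside region `b` enlarges `B` by `b` and loses `4 * p
b`; any other failure is charged 1. The sliced form is carried for all supersets of `B`, so that it
is available when `B` grows. -/
theorem fidelity_noisyRun_ge [Nonempty A] [DecidableEq ι] (data : (Fin n → Bool) → Bool) {ε : ℝ}
    (h0 : 0 ≤ ε) (h1 : ε ≤ 1) (noise : Noise n Q) (p : ι → ℝ) (hp : ∀ b, 0 ≤ p b)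
    (φ : Op Q →ₗ[ℂ] ℂ)
    (hφ : ∀ ρ : Op Q, ρ.PosSemidef → 0 ≤ (φ ρ).re) (fin : A → Basis Q)
    (hfin : ∀ (B : Finset ι) (ρ : Op Q), ρ.PosSemidef → ρ.trace = 1 →
      IsSliced region leaf ψ B fin ρ → 1 - 4 * ∑ b ∈ B, p b ≤ (φ ρ).re)
    (cost : Gate n Q → ℝ) (hc : ∀ g, 0 ≤ cost g)
    (hcost : ∀ g, 1 ≤ cost g ∨
      ∃ b, (∀ q ∈ g.support, region q = some b) ∧ 4 * p b ≤ cost g)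
    (gs : List (Gate n Q)) (hgs : ∀ g ∈ gs, g.IsReversible) (s : A → Basis Q)
    (hrun : ∀ a, ShieldedRun region (leaf a) data gs (s a))
    (hs : ∀ a, runActs data gs (s a) = fin a) (k : ℕ) (B : Finset ι) (ρ : Op Q)
    (hρ : ρ.PosSemidef) (hρ1 : ρ.trace = 1)
    (hsl : ∀ B', B ⊆ B' → IsSliced region leaf ψ B' s ρ) :
    1 - 4 * ∑ b ∈ B, p b - ε * (gs.map cost).sum ≤ (φ (noisyRun data ε noise k gs ρ)).re := by
  induction gs generalizing s k B ρ with
  | nil =>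
    obtain rfl : s = fin := funext hs
    simpa [noisyRun] using hfin B ρ hρ hρ1 (hsl B subset_rfl)
  | cons g gs ih =>
    simp only [List.mem_cons, forall_eq_or_imp] at hgs
    have hr2 : ∀ a, ShieldedRun region (leaf a) data gs (g.act data (s a)) := fun a => (hrun a).2
    have hgood := ih hgs.2 (fun a => g.act data (s a)) hr2 hs (k + 1) B (g.apply data ρ)
      (Gate.posSemidef_apply data hgs.1 hρ) (by rw [Gate.trace_apply data hgs.1, hρ1])
      fun B' hB => (hsl B' hB).gate_apply data hgs.1 fun a => (hrun a).1
    have hcs : 0 ≤ (gs.map cost).sum := List.sum_nonneg fun x hx => by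
      obtain ⟨g', -, rfl⟩ := List.mem_map.1 hx
      exact hc g'
    have hpB : 0 ≤ ∑ b ∈ B, p b := Finset.sum_nonneg fun b _ => hp b
    have hbad : 1 - 4 * ∑ b ∈ B, p b - ε * (gs.map cost).sum - cost g ≤
        (φ (noisyRun data ε noise (k + 1) gs ((noise k g).apply ρ))).re := by
      have hpos := (noise k g).posSemidef_apply hρ
      rcases hcost g with h | ⟨b, hb, h⟩
      -- After a cost of at least 1 the claimed bound is at most 0, and the fidelity is nonnegative.
      · refine le_trans ?_ (hφ _ (posSemidef_noisyRun data h0 h1 noise hgs.2 _ hpos))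
        have := mul_nonneg h0 hcs
        linarith
      · have := ih hgs.2 (fun a => g.act data (s a)) hr2 hs (k + 1) (insert b B)
          ((noise k g).apply ρ) hpos (by rw [(noise k g).trace_apply, hρ1])
          fun B' hB => (hsl B' ((Finset.subset_insert b B).trans hB)).channel_apply data
            (fun q hq => ⟨b, hB (Finset.mem_insert_self b B), hb q hq⟩) (noise k g)
        refine le_trans ?_ this
        have h' : ∑ x ∈ insert b B, p x ≤ p b + ∑ x ∈ B, p x := by
          by_cases hm : b ∈ B
          · rw [Finset.insert_eq_of_mem hm]
            linarith [hp b]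
          · rw [Finset.sum_insert hm]
        linarith
    rw [noisyRun, noisyRun_add, noisyRun_smul, noisyRun_smul, map_add, map_smul, map_smul,
      Complex.add_re, smul_eq_mul, smul_eq_mul, Complex.re_ofReal_mul, Complex.re_ofReal_mul,
      List.map_cons, List.sum_cons]
    -- If X is the bound for the remaining gates, then (1 - ε) X + ε (X - cost g) = X - ε cost g.
    have e1 := mul_le_mul_of_nonneg_left hgood (sub_nonneg.2 h1)
    have e2 := mul_le_mul_of_nonneg_left hbad h0
    nlinarith [e1, e2]

end Shielding

end QLookup

namespace QLookup

/-! ### Fidelity when a set of leaves is damaged -/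

section Fidelity

open scoped ComplexOrder

/-- Each cross term satisfies 2 Re⟨g, w e⟩ ≥ -(‖w‖²‖g‖² + ‖e‖²), with the weight put on `g`; the
square of the remaining sum is dropped. With the amplitudes of the damaged branches as `w`,
interference costs only their total weight. -/
theorem norm_add_sum_smul_sq_ge {E κ : Type*} [NormedAddCommGroup E] [InnerProductSpace ℂ E]
    (g : E) (t : Finset κ) (w : κ → ℂ) (e : κ → E) :
    (1 - ∑ a ∈ t, ‖w a‖ ^ 2) * ‖g‖ ^ 2 - ∑ a ∈ t, ‖e a‖ ^ 2 ≤ ‖g + ∑ a ∈ t, w a • e a‖ ^ 2 := by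
  have h : ∀ a ∈ t, -(‖w a‖ ^ 2 * ‖g‖ ^ 2 + ‖e a‖ ^ 2) ≤
      2 * RCLike.re (inner ℂ g (w a • e a)) := by
    intro a _
    have h1 := norm_add_sq (𝕜 := ℂ) (star (w a) • g) (e a)
    have h2 : inner ℂ (star (w a) • g) (e a) = inner ℂ g (w a • e a) := by
      rw [inner_smul_left, inner_smul_right]
      simp
    rw [h2, norm_smul, norm_star, mul_pow] at h1
    have := sq_nonneg ‖star (w a) • g + e a‖
    linarith
  have h1 := norm_add_sq (𝕜 := ℂ) g (∑ a ∈ t, w a • e a)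
  rw [inner_sum, map_sum, Finset.mul_sum] at h1
  have h2 := Finset.sum_le_sum h
  rw [Finset.sum_neg_distrib, Finset.sum_add_distrib, ← Finset.sum_mul] at h2
  have := sq_nonneg ‖∑ a ∈ t, w a • e a‖
  linarith

/-- Writing ρ = AᴴA turns the form into ‖A x‖². -/
theorem Matrix.PosSemidef.re_form_add_ge {m κ : Type*} [Fintype m] [DecidableEq m]
    {ρ : Matrix m m ℂ} (hρ : ρ.PosSemidef) (g : m → ℂ) (t : Finset κ) (w : κ → ℂ) (e : κ → m → ℂ) :
    (1 - ∑ a ∈ t, ‖w a‖ ^ 2) * (star g ⬝ᵥ (ρ *ᵥ g)).re -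
        ∑ a ∈ t, (star (e a) ⬝ᵥ (ρ *ᵥ e a)).re ≤
      (star (g + ∑ a ∈ t, w a • e a) ⬝ᵥ (ρ *ᵥ (g + ∑ a ∈ t, w a • e a))).re := by
  obtain ⟨k, A, rfl⟩ : ∃ (k : ℕ) (A : Matrix (Fin k) m ℂ), ρ = Aᴴ * A := by
    obtain ⟨k, v, rfl⟩ := Matrix.posSemidef_iff_eq_sum_vecMulVec.1 hρ
    refine ⟨k, Matrix.of fun i y => star (v i y), ?_⟩
    ext z y
    simp [Matrix.mul_apply, Matrix.sum_apply, Matrix.vecMulVec_apply]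
  let f : (m → ℂ) →ₗ[ℂ] EuclideanSpace ℂ (Fin k) :=
    (WithLp.linearEquiv 2 ℂ (Fin k → ℂ)).symm.toLinearMap ∘ₗ Matrix.mulVecLin A
  have hf : ∀ x, (star x ⬝ᵥ ((Aᴴ * A) *ᵥ x)).re = ‖f x‖ ^ 2 := by
    intro x
    rw [← Matrix.mulVec_mulVec, Matrix.dotProduct_mulVec, ← Matrix.star_mulVec,
      EuclideanSpace.norm_sq_eq]
    simp [dotProduct, f, Complex.normSq_eq_norm_sq, ← Complex.normSq_eq_conj_mul_self]
    exact Finset.sum_congr rfl fun i _ => by rw [← Complex.ofReal_pow, Complex.ofReal_re]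
  simp only [hf, map_add, map_sum, map_smul]
  exact norm_add_sum_smul_sq_ge _ _ _ _

namespace LookupScheme

variable {n : ℕ} (S : LookupScheme n) {ι : Type}

open Classical in
/-- The basis state with given address and output bits and all ancilla qubits in `|0⟩`. -/
def config (p : (Fin n → Bool) × Bool) : Basis S.sites :=
  fun q => if q = S.out then p.2 else if h : ∃ i, q = S.addr i then p.1 h.choose else false

theorem config_addr (p : (Fin n → Bool) × Bool) (i : Fin n) : S.config p (S.addr i) = p.1 i := by
  have h : ∃ j, S.addr i = S.addr j := ⟨i, rfl⟩
  rw [config, if_neg (S.out_ne_addr i).symm, dif_pos h, ← S.addr_injective h.choose_spec]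

theorem config_out (p : (Fin n → Bool) × Bool) : S.config p S.out = p.2 := if_pos rfl

theorem config_ancilla (p : (Fin n → Bool) × Bool) {q : S.sites} (hq : S.IsAncilla q) :
    S.config p q = false := by
  rw [config, if_neg hq.1, dif_neg (not_exists.2 hq.2)]

theorem readout_config (p : (Fin n → Bool) × Bool) : S.readout (S.config p) = p := by
  simp [readout, config_addr, config_out]

theorem config_injective : Function.Injective S.config :=
  Function.LeftInverse.injective S.readout_config

theorem eq_of_readout_eq {y y' : Basis S.sites} (h : S.readout y = S.readout y')
    (h' : ∀ q, S.IsAncilla q → y q = y' q) : y = y' := by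
  funext q
  by_cases hq : S.IsAncilla q
  · exact h' q hq
  · simp only [IsAncilla, not_and_or, not_not, not_forall] at hq
    simp only [readout, Prod.mk.injEq] at h
    rcases hq with rfl | ⟨i, rfl⟩
    · exact h.2
    · exact congrFun h.1 i

theorem withAncillas_config (v : (Fin n → Bool) × Bool → ℂ) (p : (Fin n → Bool) × Bool) :
    S.withAncillas v (S.config p) = v p := by
  rw [withAncillas, if_pos fun q hq => S.config_ancilla p hq, readout_config]

theorem withAncillas_eq_zero (v : (Fin n → Bool) × Bool → ℂ) {y : Basis S.sites}
    (hy : ∀ p, v p ≠ 0 → y ≠ S.config p) : S.withAncillas v y = 0 := by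
  rw [withAncillas]
  split_ifs with h
  · by_contra h0
    exact hy _ h0 (S.eq_of_readout_eq (S.readout_config _).symm fun q hq => by
      rw [h q hq, S.config_ancilla _ hq])
  · rfl

theorem trace_pureState_query {ψ : (Fin n → Bool) → ℂ} (hψ : ∑ a, ‖ψ a‖ ^ 2 = 1) :
    (pureState (S.withAncillas (query ψ))).trace = 1 := by
  have h : ∑ a, ((‖ψ a‖ ^ 2 : ℝ) : ℂ) = ∑ y, S.withAncillas (query ψ) y *
      star (S.withAncillas (query ψ) y) := by
    refine Finset.sum_of_injOn (fun a => S.config (a, false)) ?_ (by simp) ?_ ?_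
    · intro a _ a' _ e
      exact congrArg Prod.fst (S.config_injective e)
    · intro y _ hy
      rw [S.withAncillas_eq_zero, zero_mul]
      rintro ⟨a, o⟩ hp rfl
      refine hy ⟨a, by simp, ?_⟩
      cases o
      · rfl
      · simp [query] at hp
    · intro a _
      simp only [withAncillas_config, query, if_true]
      rw [Complex.star_def, Complex.mul_conj, Complex.normSq_eq_norm_sq]
  rw [← Complex.ofReal_sum, hψ] at h
  rw [pureState, Matrix.trace_vecMulVec, dotProduct]
  simpa using h.symm

variable {region : S.sites → Option ι} (hreg : ∀ q, region q ≠ none → S.IsAncilla q)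
include hreg

/-- Regions consist of ancillas, all in |0⟩ at the start, so `σ` is the projector onto the zero
state, for every `B`. -/
theorem isSliced_query {leaf : (Fin n → Bool) → ι} (B : Finset ι) (ψ : (Fin n → Bool) → ℂ) :
    IsSliced region leaf ψ B (fun a => S.config (a, false))
      (pureState (S.withAncillas (query ψ))) := by
  classical
  refine ⟨Matrix.single (fun _ => false) (fun _ => false) 1, Matrix.trace_single_eq_same _ _, ?_, ?_⟩
  · intro y y' hy q _
    rw [Matrix.single_apply] at hy
    by_contra hq
    refine hy (if_neg fun h => hq ?_)
    rw [← h.1]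
  · intro a a' _ _ c c'
    have key : ∀ a c, S.withAncillas (query ψ) (graft region B (S.config (a, false)) c) =
        if (fun _ => false) = graft region B (fun _ => false) c then ψ a else 0 := by
      intro a c
      have hro : S.readout (graft region B (S.config (a, false)) c) = (a, false) := by
        have h1 : ∀ q, ¬ S.IsAncilla q → graft region B (S.config (a, false)) c q =
            S.config (a, false) q := by
          intro q hq
          refine graft_of_not ?_
          rintro ⟨b, -, hb⟩
          exact hq (hreg q (by simp [hb]))
        refine Eq.trans ?_ (S.readout_config (a, false))
        simp only [readout]
        rw [h1 _ fun h => h.1 rfl]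
        simp only [h1 _ fun h => h.2 _ rfl]
      have hiff : (∀ q, S.IsAncilla q → graft region B (S.config (a, false)) c q = false) ↔
          (fun _ => false) = graft region B (fun _ => false) c := by
        constructor
        · intro h
          funext q
          by_cases hb : ∃ b ∈ B, region q = some b
          · rw [graft_of_mem hb]
            have := h q (hreg q (by obtain ⟨b, -, hb⟩ := hb; simp [hb]))
            rw [graft_of_mem hb] at this
            exact this.symm
          · rw [graft_of_not hb]
        · intro h q hq
          by_cases hb : ∃ b ∈ B, region q = some b
          · have := congrFun h q
            rw [graft_of_mem hb] at this ⊢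
            exact this.symm
          · rw [graft_of_not hb, S.config_ancilla _ hq]
      rw [withAncillas, hro]
      simp only [hiff, query, if_true]
    rw [pureState, Matrix.vecMulVec_apply, Pi.star_apply, key, key, Matrix.single_apply]
    by_cases h1 : (fun _ => false) = graft region B (fun _ => false) c
    · by_cases h2 : (fun _ => false) = graft region B (fun _ => false) c'
      · rw [if_pos h1, if_pos h2, if_pos ⟨h1, h2⟩, mul_one]
      · rw [if_pos h1, if_neg h2, star_zero, mul_zero, if_neg fun h : _ ∧ _ => h2 h.2, mul_zero]
    · rw [if_neg h1, zero_mul, if_neg fun h : _ ∧ _ => h1 h.1, mul_zero]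

omit hreg

open Classical in
/-- The fidelity with a pure state `v` of the address and output registers. -/
def fidelity (v : (Fin n → Bool) × Bool → ℂ) : Op S.sites →ₗ[ℂ] ℂ where
  toFun ρ := star v ⬝ᵥ (S.reduced ρ *ᵥ v)
  map_add' ρ ρ' := by
    have : S.reduced (ρ + ρ') = S.reduced ρ + S.reduced ρ' := by
      ext p p'
      simp only [reduced, Matrix.add_apply, ← Finset.sum_add_distrib]
      refine Finset.sum_congr rfl fun z _ => Finset.sum_congr rfl fun y _ => ?_
      split_ifs <;> simp
    rw [this, Matrix.add_mulVec, dotProduct_add]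
  map_smul' t ρ := by
    have : S.reduced (t • ρ) = t • S.reduced ρ := by
      ext p p'
      simp only [reduced, Matrix.smul_apply, Finset.smul_sum]
      refine Finset.sum_congr rfl fun z _ => Finset.sum_congr rfl fun y _ => ?_
      split_ifs <;> simp
    rw [this, Matrix.smul_mulVec, dotProduct_smul, RingHom.id_apply]

open Classical in
/-- The ancilla part of a basis state. -/
def ancillaPart (y : Basis S.sites) : Basis S.sites := fun q => if S.IsAncilla q then y q else false

open Classical in
/-- The vector `v` of the address and output registers together with a basis state of the
ancilla qubits. -/
def attach (v : (Fin n → Bool) × Bool → ℂ) (c : Basis S.sites) : Basis S.sites → ℂ :=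
  fun y => if S.ancillaPart y = c then v (S.readout y) else 0

/-- The partial trace runs over the ancilla basis states `c`. As a sum of nonnegative forms when ρ
is positive semidefinite, the fidelity can be bounded below by keeping only some `c`. -/
theorem fidelity_eq (v : (Fin n → Bool) × Bool → ℂ) (ρ : Op S.sites) :
    S.fidelity v ρ = ∑ c, star (S.attach v c) ⬝ᵥ (ρ *ᵥ S.attach v c) := by
  classical
  have hiff : ∀ z y : Basis S.sites, (∀ q, S.IsAncilla q → z q = y q) ↔
      S.ancillaPart z = S.ancillaPart y := by
    intro z y
    simp only [funext_iff, ancillaPart]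
    refine forall_congr' fun q => ?_
    by_cases h : S.IsAncilla q <;> simp [h]
  have hl : S.fidelity v ρ = ∑ z, ∑ y, if S.ancillaPart z = S.ancillaPart y then
      star (v (S.readout z)) * ρ z y * v (S.readout y) else 0 := by
    change star v ⬝ᵥ (S.reduced ρ *ᵥ v) = _
    simp only [dotProduct, Matrix.mulVec, reduced, hiff, Finset.mul_sum, Finset.sum_mul,
      Pi.star_apply]
    have : ∀ p p', (∑ z, ∑ y, star (v p) * ((if S.readout z = p ∧ S.readout y = p' ∧
        S.ancillaPart z = S.ancillaPart y then ρ z y else 0) * v p')) =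
        ∑ z, ∑ y, if S.readout z = p then if S.readout y = p' then
          (if S.ancillaPart z = S.ancillaPart y then
          star (v (S.readout z)) * ρ z y * v (S.readout y) else 0) else 0 else 0 := by
      intro p p'
      refine Finset.sum_congr rfl fun z _ => Finset.sum_congr rfl fun y _ => ?_
      by_cases h1 : S.readout z = p
      · by_cases h2 : S.readout y = p'
        · subst h1 h2
          by_cases h3 : S.ancillaPart z = S.ancillaPart y <;> simp [h3, mul_assoc]
        · simp [h2]
      · simp [h1]
    simp only [this]
    rw [Finset.sum_congr rfl fun p _ => Finset.sum_comm, Finset.sum_comm]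
    refine Finset.sum_congr rfl fun z _ => ?_
    rw [Finset.sum_congr rfl fun p _ => Finset.sum_comm, Finset.sum_comm]
    refine Finset.sum_congr rfl fun y _ => ?_
    simp
  have hr : ∀ c, star (S.attach v c) ⬝ᵥ (ρ *ᵥ S.attach v c) = ∑ z, ∑ y,
      if S.ancillaPart z = c then if S.ancillaPart y = c then
      star (v (S.readout z)) * ρ z y * v (S.readout y) else 0 else 0 := by
    intro c
    simp only [dotProduct, Matrix.mulVec, Finset.mul_sum, Pi.star_apply, attach]
    refine Finset.sum_congr rfl fun z _ => Finset.sum_congr rfl fun y _ => ?_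
    by_cases h1 : S.ancillaPart z = c <;> by_cases h2 : S.ancillaPart y = c <;>
      simp [h1, h2, mul_assoc]
  simp only [hl, hr]
  conv_rhs => rw [Finset.sum_comm]
  refine Finset.sum_congr rfl fun z _ => ?_
  conv_rhs => rw [Finset.sum_comm]
  refine Finset.sum_congr rfl fun y _ => ?_
  simp [eq_comm]

theorem fidelity_nonneg (v : (Fin n → Bool) × Bool → ℂ) {ρ : Op S.sites} (hρ : ρ.PosSemidef) :
    0 ≤ (S.fidelity v ρ).re := by
  rw [fidelity_eq, Complex.re_sum]
  exact Finset.sum_nonneg fun c _ => hρ.re_dotProduct_nonneg _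

end LookupScheme

end Fidelity

end QLookup

namespace QLookup

namespace LookupScheme

open scoped ComplexOrder

variable {n : ℕ} (S : LookupScheme n) {ι : Type} [Fintype ι] [DecidableEq ι]

/-- The weight of the addresses of a leaf in a superposition. -/
def leafWeight (leaf : (Fin n → Bool) → ι) (ψ : (Fin n → Bool) → ℂ) (b : ι) : ℝ :=
  ∑ a, if leaf a = b then ‖ψ a‖ ^ 2 else 0

omit [Fintype ι] in
theorem sum_leafWeight (leaf : (Fin n → Bool) → ι) (ψ : (Fin n → Bool) → ℂ) (B : Finset ι) :
    ∑ b ∈ B, leafWeight leaf ψ b = ∑ a with leaf a ∈ B, ‖ψ a‖ ^ 2 := by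
  simp only [leafWeight]
  rw [Finset.sum_comm, Finset.sum_filter]
  refine Finset.sum_congr rfl fun a _ => ?_
  simp

omit [Fintype ι] in
-- Let P be the weight of the damaged branches and G = 1 - P. For each state `c` of the damaged
-- regions the good branches contribute G² σ(c,c), and the others spoil at most P G² σ(c,c) plus
-- their own population. Summation over `c`, with tr σ = 1, gives (1 - P) G² - P.
theorem fidelity_answer_ge {region : S.sites → Option ι}
    (hreg : ∀ q, region q ≠ none → S.IsAncilla q) {leaf : (Fin n → Bool) → ι}
    {ψ : (Fin n → Bool) → ℂ} (hψ : ∑ a, ‖ψ a‖ ^ 2 = 1) (data : (Fin n → Bool) → Bool)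
    (B : Finset ι) {ρ : Op S.sites} (hρ : ρ.PosSemidef) (hρ1 : ρ.trace = 1)
    (hsl : IsSliced region leaf ψ B (fun a => S.config (a, data a)) ρ) :
    1 - 4 * ∑ b ∈ B, leafWeight leaf ψ b ≤ (S.fidelity (answer data ψ) ρ).re := by
  classical
  obtain ⟨σ, hσ1, hσ0, hσ⟩ := hsl
  set z : Basis S.sites := fun _ => false with hz
  set P := ∑ a with leaf a ∈ B, ‖ψ a‖ ^ 2 with hP
  set G := ∑ a with leaf a ∉ B, ‖ψ a‖ ^ 2 with hG
  have hPG : P + G = 1 := by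
    rw [← hψ, hP, hG, Finset.sum_filter_add_sum_filter_not]
  have hP0 : 0 ≤ P := Finset.sum_nonneg fun _ _ => sq_nonneg _
  have hG0 : 0 ≤ G := Finset.sum_nonneg fun _ _ => sq_nonneg _
  rw [sum_leafWeight, ← hP]
  rcases hG0.eq_or_lt with hG00 | hGpos
  · have := S.fidelity_nonneg (answer data ψ) hρ
    linarith
  set C : Finset (Basis S.sites) := Finset.univ.filter fun c => graft region B z c = c with hC
  set y : (Fin n → Bool) → Basis S.sites → Basis S.sites :=
    fun a c => graft region B (S.config (a, data a)) c with hy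
  have hnreg : ∀ q, ¬ S.IsAncilla q → ¬ ∃ b ∈ B, region q = some b := by
    rintro q hq ⟨b, -, hb⟩
    exact hq (hreg q (by simp [hb]))
  have hread : ∀ a c, S.readout (y a c) = (a, data a) := by
    intro a c
    refine Eq.trans ?_ (S.readout_config (a, data a))
    have h1 : ∀ q, ¬ S.IsAncilla q → y a c q = S.config (a, data a) q := fun q hq =>
      graft_of_not (hnreg q hq)
    simp only [readout]
    rw [h1 _ fun h => h.1 rfl]
    simp only [h1 _ fun h => h.2 _ rfl]
  have hanc : ∀ a, ∀ c ∈ C, S.ancillaPart (y a c) = c := by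
    intro a c hc
    rw [hC, Finset.mem_filter] at hc
    funext q
    rw [← hc.2, ancillaPart]
    split_ifs with hq
    · by_cases hb : ∃ b ∈ B, region q = some b
      · simp only [hy]
        rw [graft_of_mem hb, graft_of_mem hb, ← hc.2, graft_of_mem hb]
      · simp only [hy]
        rw [graft_of_not hb, graft_of_not hb, S.config_ancilla _ hq]
    · rw [graft_of_not (hnreg q hq)]
  have hyinj : ∀ a a' c c', c ∈ C → c' ∈ C → y a c = y a' c' → a = a' ∧ c = c' := by
    intro a a' c c' hc hc' h
    constructor
    · have := congrArg S.readout h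
      rw [hread, hread] at this
      exact congrArg Prod.fst this
    · rw [← hanc a c hc, h, hanc a' c' hc']
  -- the entries of `ρ` in the good branches
  have hent : ∀ a a', leaf a ∉ B → leaf a' ∉ B → ∀ c ∈ C,
      ρ (y a c) (y a' c) = ψ a * star (ψ a') * σ c c := by
    intro a a' ha ha' c hc
    have := hσ a a' ha ha' c c
    rw [hC, Finset.mem_filter] at hc
    rwa [hc.2] at this
  have hdiag : ∀ x, 0 ≤ (ρ x x).re := fun x => (Complex.le_def.1 hρ.diag_nonneg).1
  have hgood : ∀ c ∈ C, ∑ a with leaf a ∉ B, (ρ (y a c) (y a c)).re = G * (σ c c).re := by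
    intro c hc
    rw [hG, Finset.sum_mul]
    refine Finset.sum_congr rfl fun a ha => ?_
    rw [Finset.mem_filter] at ha
    rw [hent a a ha.2 ha.2 c hc, Complex.star_def, Complex.mul_conj, Complex.normSq_eq_norm_sq,
      Complex.re_ofReal_mul]
  have hθ0 : ∀ c ∈ C, 0 ≤ (σ c c).re := by
    intro c hc
    have := Finset.sum_nonneg fun a (_ : a ∈ Finset.univ.filter fun a => leaf a ∉ B) =>
      hdiag (y a c)
    rw [hgood c hc] at this
    exact nonneg_of_mul_nonneg_right this hGpos
  have hθ : ∑ c ∈ C, (σ c c).re = 1 := by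
    have h1 : ∑ c ∈ C, σ c c = σ.trace := by
      refine Finset.sum_subset (Finset.subset_univ _) fun c _ hc => ?_
      by_contra h0
      refine hc (Finset.mem_filter.2 ⟨Finset.mem_univ _, funext fun q => ?_⟩)
      by_cases hb : ∃ b ∈ B, region q = some b
      · rw [graft_of_mem hb]
      · rw [graft_of_not hb, hσ0 c c h0 q hb]
    rw [← Complex.re_sum, h1, hσ1, Complex.one_re]
  -- Nothing is known about the damaged branches themselves, but the good ones have population
  -- exactly G, and trace 1 leaves at most P for the rest.
  have hbadsum : ∑ c ∈ C, ∑ a with leaf a ∈ B, (ρ (y a c) (y a c)).re ≤ P := by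
    have h1 : ∑ c ∈ C, ∑ a, (ρ (y a c) (y a c)).re ≤ 1 := by
      have h2 : ∑ x, (ρ x x).re = 1 := by
        rw [← Complex.re_sum]
        exact (congrArg Complex.re hρ1).trans Complex.one_re
      rw [← h2, ← Finset.sum_product']
      calc ∑ p ∈ C ×ˢ Finset.univ, (ρ (y p.2 p.1) (y p.2 p.1)).re
          = ∑ x ∈ (C ×ˢ Finset.univ).image fun p => y p.2 p.1, (ρ x x).re := by
            refine (Finset.sum_image (f := fun x => (ρ x x).re) ?_).symm
            rintro ⟨c, a⟩ hp ⟨c', a'⟩ hp' h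
            simp only [Finset.coe_product, Set.mem_prod, Finset.mem_coe] at hp hp'
            obtain ⟨h1, h2⟩ := hyinj a a' c c' hp.1 hp'.1 h
            rw [h1, h2]
        _ ≤ ∑ x, (ρ x x).re := Finset.sum_le_sum_of_subset_of_nonneg (Finset.subset_univ _)
            fun x _ _ => hdiag x
    have h3 : ∑ c ∈ C, ∑ a with leaf a ∉ B, (ρ (y a c) (y a c)).re = G := by
      rw [Finset.sum_congr rfl hgood, ← Finset.mul_sum, hθ, mul_one]
    have h4 : ∑ c ∈ C, ∑ a, (ρ (y a c) (y a c)).re =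
        ∑ c ∈ C, ∑ a with leaf a ∈ B, (ρ (y a c) (y a c)).re + G := by
      rw [← h3, ← Finset.sum_add_distrib]
      exact Finset.sum_congr rfl fun c _ => (Finset.sum_filter_add_sum_filter_not _ _ _).symm
    linarith
  -- the fidelity splits according to the state of the ancilla qubits
  have hattach : ∀ c ∈ C, S.attach (answer data ψ) c =
      (∑ a with leaf a ∉ B, ψ a • (Pi.single (y a c) 1 : Basis S.sites → ℂ)) +
        ∑ a with leaf a ∈ B, ψ a • (Pi.single (y a c) 1 : Basis S.sites → ℂ) := by
    intro c hc
    rw [add_comm, Finset.sum_filter_add_sum_filter_not]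
    funext x
    rw [Finset.sum_apply]
    have hiff : ∀ a, x = y a c ↔ S.ancillaPart x = c ∧ S.readout x = (a, data a) := by
      intro a
      constructor
      · rintro rfl
        exact ⟨hanc a c hc, hread a c⟩
      · rintro ⟨h1, h2⟩
        refine S.eq_of_readout_eq (h2.trans (hread a c).symm) fun q hq => ?_
        have := congrFun (h1.trans (hanc a c hc).symm) q
        simpa [ancillaPart, hq] using this
    simp only [Pi.smul_apply, Pi.single_apply, hiff, smul_eq_mul, mul_ite, mul_one, mul_zero, attach,
      answer]
    by_cases h1 : S.ancillaPart x = c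
    · simp only [h1, true_and, if_true]
      obtain ⟨a, o⟩ := S.readout x
      by_cases h2 : o = data a
      · subst h2
        rw [Finset.sum_eq_single a]
        · simp
        · intro a' _ hne
          rw [if_neg]
          intro h
          exact hne (congrArg Prod.fst h).symm
        · simp
      · rw [if_neg h2]
        symm
        refine Finset.sum_eq_zero fun a' _ => if_neg fun h => h2 ?_
        rw [Prod.mk.injEq] at h
        rw [h.2, h.1]
    · simp [h1]
  have hsingle : ∀ x x', star (Pi.single x 1 : Basis S.sites → ℂ) ⬝ᵥ (ρ *ᵥ Pi.single x' 1) =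
      ρ x x' := by
    intro x x'
    simp
  have hform : ∀ c ∈ C, (star (∑ a with leaf a ∉ B, ψ a • (Pi.single (y a c) 1 : Basis S.sites → ℂ)) ⬝ᵥ
      (ρ *ᵥ ∑ a with leaf a ∉ B, ψ a • (Pi.single (y a c) 1 : Basis S.sites → ℂ))).re =
      G ^ 2 * (σ c c).re := by
    intro c hc
    have h1 : star (∑ a with leaf a ∉ B, ψ a • (Pi.single (y a c) 1 : Basis S.sites → ℂ)) ⬝ᵥ
      (ρ *ᵥ ∑ a with leaf a ∉ B, ψ a • (Pi.single (y a c) 1 : Basis S.sites → ℂ)) =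
      ∑ a with leaf a ∉ B, ∑ a' with leaf a' ∉ B, star (ψ a) * (ψ a' * ρ (y a c) (y a' c)) := by
      simp only [Matrix.mulVec_sum, Matrix.mulVec_smul, star_sum, star_smul, sum_dotProduct,
        dotProduct_sum, smul_dotProduct, dotProduct_smul, smul_eq_mul, hsingle, Finset.mul_sum]
      rw [Finset.sum_comm]
      refine Finset.sum_congr rfl fun a _ => Finset.sum_congr rfl fun a' _ => ?_
      ring
    have h2 : ∑ a with leaf a ∉ B, ∑ a' with leaf a' ∉ B, star (ψ a) *
        (ψ a' * ρ (y a c) (y a' c)) = ((G ^ 2 : ℝ) : ℂ) * σ c c := by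
      rw [sq, hG, Complex.ofReal_mul, Complex.ofReal_sum, Finset.sum_mul_sum, Finset.sum_mul]
      refine Finset.sum_congr rfl fun a ha => ?_
      rw [Finset.sum_mul]
      refine Finset.sum_congr rfl fun a' ha' => ?_
      rw [Finset.mem_filter] at ha ha'
      rw [hent a a' ha.2 ha'.2 c hc, ← Complex.normSq_eq_norm_sq, ← Complex.normSq_eq_norm_sq,
        ← Complex.mul_conj, ← Complex.mul_conj, ← Complex.star_def]
      ring
    rw [h1, h2, Complex.re_ofReal_mul]
  have hterm : ∀ c ∈ C, (1 - P) * (G ^ 2 * (σ c c).re) -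
      ∑ a with leaf a ∈ B, (ρ (y a c) (y a c)).re ≤
      (star (S.attach (answer data ψ) c) ⬝ᵥ (ρ *ᵥ S.attach (answer data ψ) c)).re := by
    intro c hc
    have := Matrix.PosSemidef.re_form_add_ge hρ
      (∑ a with leaf a ∉ B, ψ a • (Pi.single (y a c) 1 : Basis S.sites → ℂ))
      (Finset.univ.filter fun a => leaf a ∈ B) ψ fun a => Pi.single (y a c) 1
    rw [hform c hc, ← hattach c hc] at this
    simpa only [hsingle] using this
  have hfin : (1 - P) * G ^ 2 - P ≤ (S.fidelity (answer data ψ) ρ).re := by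
    rw [fidelity_eq, Complex.re_sum]
    calc (1 - P) * G ^ 2 - P
        ≤ ∑ c ∈ C, ((1 - P) * (G ^ 2 * (σ c c).re) -
            ∑ a with leaf a ∈ B, (ρ (y a c) (y a c)).re) := by
          rw [Finset.sum_sub_distrib, ← Finset.mul_sum, ← Finset.mul_sum, hθ, mul_one]
          linarith
      _ ≤ ∑ c ∈ C, (star (S.attach (answer data ψ) c) ⬝ᵥ
            (ρ *ᵥ S.attach (answer data ψ) c)).re := Finset.sum_le_sum hterm
      _ ≤ _ := Finset.sum_le_sum_of_subset_of_nonneg (Finset.subset_univ _)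
            fun c _ _ => hρ.re_dotProduct_nonneg _
  have hG1 : G = 1 - P := by linarith
  rw [hG1] at hfin
  have hP1 : P ≤ 1 := by linarith
  -- (1 - P)³ - P = 1 - 4P + P² (3 - P).
  nlinarith [mul_nonneg hP0 hP0, mul_nonneg (mul_nonneg hP0 hP0) (sub_nonneg.2 hP1)]

open Classical in
/-- A bound on the infidelity of a scheme whose ancilla qubits are divided into shared ones and
regions such that the regions that an address does not use stay decoupled. -/
theorem infidelity_le {region : S.sites → Option ι}
    (hreg : ∀ q, region q ≠ none → S.IsAncilla q) (leaf : (Fin n → Bool) → ι)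
    (data : (Fin n → Bool) → Bool) (hrev : ∀ g ∈ S.ops, g.IsReversible)
    (hshield : ∀ a, ShieldedRun region (leaf a) data S.ops (S.config (a, false)))
    (hrun : ∀ a, runActs data S.ops (S.config (a, false)) = S.config (a, data a))
    (layers : List (Layer n S.sites)) (hsteps : S.steps = layers.map Layer.gates) (m : ℕ)
    (hm : ∀ b, (Finset.univ.filter fun q => region q = some b).card ≤ m) {ε : ℝ} (h0 : 0 ≤ ε)
    (h1 : ε ≤ 1) (noise : Noise n S.sites) {ψ : (Fin n → Bool) → ℂ} (hψ : ∑ a, ‖ψ a‖ ^ 2 = 1) :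
    S.infidelity data ε noise ψ ≤ ε * (layers.length *
      ((Finset.univ.filter fun q => region q = none).card + 4 * m : ℝ)) := by
  set p := leafWeight leaf ψ with hp
  have hp0 : ∀ b, 0 ≤ p b := fun b => Finset.sum_nonneg fun a _ => by split_ifs <;> positivity
  have hpsum : ∑ b, p b = 1 := by
    rw [hp, sum_leafWeight, ← hψ]
    simp
  let cost : Gate n S.sites → ℝ := fun g =>
    if h : ∃ b, ∀ q ∈ g.support, region q = some b then 4 * p h.choose else 1
  have hc : ∀ g, 0 ≤ cost g := by
    intro g
    simp only [cost]
    split_ifs with h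
    · linarith [hp0 h.choose]
    · exact zero_le_one
  have hcost : ∀ g, 1 ≤ cost g ∨ ∃ b, (∀ q ∈ g.support, region q = some b) ∧ 4 * p b ≤ cost g := by
    intro g
    by_cases h : ∃ b, ∀ q ∈ g.support, region q = some b
    · exact Or.inr ⟨h.choose, h.choose_spec, by simp only [cost, dif_pos h]; exact le_rfl⟩
    · exact Or.inl (by simp only [cost, dif_neg h]; exact le_rfl)
  -- The charge is moved from gates to qubits. A gate not confined to one leaf touches a shared
  -- qubit, which pays 1 for it.
  let bound : S.sites → ℝ := fun q => (region q).elim 1 fun b => 4 * p b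
  have hlayer : ∀ l ∈ layers, (l.gates.map cost).sum ≤
      (Finset.univ.filter fun q => region q = none).card + 4 * m := by
    intro l hl
    refine (l.sum_gates_le cost bound ?_ ?_).trans ?_
    · intro q
      simp only [bound]
      cases region q with
      | none => exact zero_le_one
      | some b => simp only [Option.elim_some]; linarith [hp0 b]
    · intro q
      by_cases h : ∃ b, ∀ q' ∈ (l.gateAt q).support, region q' = some b
      · refine ⟨q, rfl, ?_⟩
        simp only [cost, dif_pos h, bound, h.choose_spec q (l.mem_support q), Option.elim_some]
        exact le_rfl
      · by_cases hn : ∃ r ∈ (l.gateAt q).support, region r = none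
        · obtain ⟨r, hr, hr'⟩ := hn
          refine ⟨r, l.gateAt_eq q r hr, ?_⟩
          simp only [cost, dif_neg h, bound, hr', Option.elim_none]
          exact le_rfl
        · have hmem : l.gateAt q ∈ S.ops := by
            rw [ops, hsteps]
            exact List.mem_flatten.2 ⟨_, List.mem_map_of_mem hl, Layer.mem_gates.2 ⟨q, rfl⟩⟩
          -- Any address will do: only the shape of the gate is used.
          obtain ⟨s, ⟨r, hr⟩ | ⟨c, u, v, hg, hcn, -⟩⟩ :=
            (hshield fun _ => false).exists_shielded hmem
          · cases r with
            | none => exact absurd ⟨q, l.mem_support q, hr q (l.mem_support q)⟩ hn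
            | some b => exact absurd ⟨b, hr⟩ h
          · exact absurd ⟨c, by simp [hg, Gate.support], hcn⟩ hn
    · have : ∀ q, bound q = (if region q = none then 1 else 0) +
          ∑ b, if region q = some b then 4 * p b else 0 := by
        intro q
        simp only [bound]
        cases region q <;> simp
      simp only [this, Finset.sum_add_distrib]
      rw [Finset.sum_comm]
      have h2 : ∀ b, (∑ q, if region q = some b then 4 * p b else 0) ≤ 4 * (p b * m) := by
        intro b
        rw [← Finset.sum_filter, Finset.sum_const, nsmul_eq_mul]
        have : ((Finset.univ.filter fun q => region q = some b).card : ℝ) ≤ m := by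
          exact_mod_cast hm b
        nlinarith [mul_le_mul_of_nonneg_left this (hp0 b)]
      -- Since the weights sum to 1, all leaves together pay at most `4 * m`, however many there
      -- are.
      have h3 := Finset.sum_le_sum fun b (_ : b ∈ Finset.univ) => h2 b
      rw [← Finset.mul_sum, ← Finset.sum_mul, hpsum, one_mul] at h3
      simpa using h3
  have hops : (S.ops.map cost).sum ≤ layers.length *
      ((Finset.univ.filter fun q => region q = none).card + 4 * m : ℝ) := by
    rw [ops, hsteps]
    clear hsteps hrev hshield hrun
    induction layers with
    | nil => simp
    | cons l ls ih =>
      simp only [List.map_cons, List.flatten_cons, List.map_append, List.sum_append,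
        List.length_cons]
      have e1 := hlayer l List.mem_cons_self
      have e2 := ih fun l' hl' => hlayer l' (List.mem_cons_of_mem l hl')
      push_cast
      linarith
  have key := fidelity_noisyRun_ge (leaf := leaf) (ψ := ψ) data h0 h1 noise p hp0
    (S.fidelity (answer data ψ))
    (fun ρ hρ => S.fidelity_nonneg _ hρ) (fun a => S.config (a, data a))
    (fun B ρ hρ hρ1 hsl => S.fidelity_answer_ge hreg hψ data B hρ hρ1 hsl) cost hc hcost S.ops hrev
    (fun a => S.config (a, false)) hshield hrun 0 ∅ (pureState (S.withAncillas (query ψ)))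
    (Matrix.posSemidef_vecMulVec_self_star _) (S.trace_pureState_query hψ)
    fun B _ => S.isSliced_query hreg B ψ
  have h2 := mul_le_mul_of_nonneg_left hops h0
  have h3 : S.infidelity data ε noise ψ = 1 - (S.fidelity (answer data ψ) (noisyRun data ε noise 0
    S.ops (pureState (S.withAncillas (query ψ))))).re := rfl
  rw [h3]
  simp only [Finset.sum_empty, mul_zero, sub_zero] at key
  linarith

end LookupScheme

end QLookup

namespace QLookup

/-! ### Composition of time steps -/

section Layers

variable {n : ℕ} {Q : Type} [DecidableEq Q]

/-- A time step with a single operation. -/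
def Layer.single (g : Gate n Q) : Layer n Q where
  gateAt q := if q ∈ g.support then g else .idle q
  mem_support q := by
    split_ifs with h
    · exact h
    · simp [Gate.support]
  gateAt_eq q r hr := by
    by_cases h : q ∈ g.support
    · rw [if_pos h] at hr ⊢
      rw [if_pos hr]
    · rw [if_neg h] at hr ⊢
      obtain rfl : r = q := by simpa [Gate.support] using hr
      rw [if_neg h]

theorem Layer.act_single (data : (Fin n → Bool) → Bool) (g : Gate n Q) (y : Basis Q) :
    (Layer.single g).act data y = g.act data y := by
  funext q
  by_cases h : q ∈ g.support
  · simp [Layer.act, Layer.single, h]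
  · rw [Gate.act_of_notMem data g y h]
    simp only [Layer.act, Layer.single, h, if_false]
    rfl

/-- The time step in which the qubits are permuted by an involution. The function `key` tells the
two qubits of a swap apart. -/
def Layer.swaps (π : Q → Q) (key : Q → ℕ) (hπ : ∀ q, π (π q) = q)
    (hkey : ∀ q, key q = key (π q) → π q = q) : Layer n Q where
  gateAt q := if key q < key (π q) then .swap q (π q) else
    if key (π q) < key q then .swap (π q) q else .idle q
  mem_support q := by split_ifs <;> simp [Gate.support]
  gateAt_eq q r hr := by
    have h : r = q ∨ r = π q := by
      split_ifs at hr
      · simpa [Gate.support] using hr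
      · simpa [Gate.support, or_comm] using hr
      · exact Or.inl (by simpa [Gate.support] using hr)
    rcases h with rfl | rfl
    · rfl
    · rw [hπ]
      rcases lt_trichotomy (key q) (key (π q)) with h | h | h
      · simp [h, h.not_gt]
      · simp [hkey q h]
      · simp [h, h.not_gt]

theorem Layer.act_swaps (data : (Fin n → Bool) → Bool) (π : Q → Q) (key : Q → ℕ)
    (hπ : ∀ q, π (π q) = q) (hkey : ∀ q, key q = key (π q) → π q = q) (y : Basis Q) :
    (Layer.swaps (n := n) π key hπ hkey).act data y = y ∘ π := by
  funext q
  rcases lt_trichotomy (key q) (key (π q)) with h | h | h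
  · simp [Layer.act, Layer.swaps, h, Gate.act]
  · simp [Layer.act, Layer.swaps, Gate.act, hkey q h]
  · simp [Layer.act, Layer.swaps, h, h.not_gt, Gate.act]

/-- The basis action of a sequence of time steps. -/
def runLayers (data : (Fin n → Bool) → Bool) : List (Layer n Q) → Basis Q → Basis Q
  | [], y => y
  | l :: ls, y => runLayers data ls (l.act data y)

theorem runLayers_append (data : (Fin n → Bool) → Bool) (l l' : List (Layer n Q)) (y : Basis Q) :
    runLayers data (l ++ l') y = runLayers data l' (runLayers data l y) := by
  induction l generalizing y with
  | nil => rfl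
  | cons g gs ih => exact ih _

theorem runLayers_reverse (data : (Fin n → Bool) → Bool) {l : List (Layer n Q)}
    (hl : ∀ k ∈ l, ∀ q, (k.gateAt q).IsReversible) (y : Basis Q) :
    runLayers data l.reverse (runLayers data l y) = y := by
  induction l generalizing y with
  | nil => rfl
  | cons g gs ih =>
    simp only [List.mem_cons, forall_eq_or_imp] at hl
    simp only [List.reverse_cons, runLayers_append, runLayers]
    rw [ih hl.2, Layer.act_act data g hl.1]

/-- The loop rule: `st` is the invariant. -/
theorem runLayers_flatMap_range (data : (Fin n → Bool) → Bool) (tick : ℕ → List (Layer n Q))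
    (st : ℕ → Basis Q) (T : ℕ) (h : ∀ t < T, runLayers data (tick t) (st t) = st (t + 1)) :
    runLayers data ((List.range T).flatMap tick) (st 0) = st T := by
  induction T with
  | zero => rfl
  | succ T ih =>
    rw [List.range_succ, List.flatMap_append, runLayers_append,
      ih fun t ht => h t (ht.trans (Nat.lt_succ_self T))]
    simpa using h T (Nat.lt_succ_self T)

/-- Compute with `U`, apply `M`, and undo the computation. -/
def conjLayers (U M : List (Layer n Q)) : List (Layer n Q) := U ++ M ++ U.reverse

/-- The inverse of `U` need never be computed: it suffices that `U` leads forward from the desired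
final state to `z'`. -/
theorem runLayers_conj (data : (Fin n → Bool) → Bool) {U M : List (Layer n Q)}
    (hU : ∀ k ∈ U, ∀ q, (k.gateAt q).IsReversible) {y z z' y' : Basis Q}
    (h1 : runLayers data U y = z) (h2 : runLayers data M z = z') (h3 : runLayers data U y' = z') :
    runLayers data (conjLayers U M) y = y' := by
  rw [conjLayers, runLayers_append, runLayers_append, h1, h2, ← h3, runLayers_reverse data hU]

end Layers

/-! ### Registers, rotation, routing and loading -/

/-- The qubits of the scheme: `n` address qubits, a chain of `n + 1` qubits for computing
conjunctions of address bits, the output qubit, a cyclic rail of `2 * L` qubits, and for each of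
`L` leaves a flag, a cyclic ring of `R` qubits and `R` accumulators. -/
inductive Qubit (n L R : ℕ) : Type
  | addr (i : Fin n)
  | chain (i : Fin (n + 1))
  | out
  | rail (s : Fin (2 * L))
  | flag (b : Fin L)
  | ring (b : Fin L) (i : Fin R)
  | acc (b : Fin L) (i : Fin R)
  deriving DecidableEq, Fintype

namespace Qubit

variable {n L R : ℕ}

/-- A basis state, given by the contents of the registers. -/
def cfg (a : Fin n → Bool) (c : ℕ → Bool) (o : Bool) (r f : ℕ → Bool) (F A : ℕ → ℕ → Bool) :
    Basis (Qubit n L R)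
  | addr i => a i
  | chain i => c i
  | out => o
  | rail s => r s
  | flag b => f b
  | ring b i => F b i
  | acc b i => A b i

theorem cfg_congr {a : Fin n → Bool} {c c' : ℕ → Bool} {o o' : Bool} {r r' f f' : ℕ → Bool}
    {F F' A A' : ℕ → ℕ → Bool} (hc : ∀ i ≤ n, c i = c' i) (ho : o = o')
    (hr : ∀ s < 2 * L, r s = r' s)
    (hf : ∀ b < L, f b = f' b) (hF : ∀ b < L, ∀ i < R, F b i = F' b i)
    (hA : ∀ b < L, ∀ i < R, A b i = A' b i) :
    (cfg a c o r f F A : Basis (Qubit n L R)) = cfg a c' o' r' f' F' A' := by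
  funext q
  cases q with
  | addr i => rfl
  | chain i => exact hc i (Nat.lt_succ_iff.1 i.2)
  | out => exact ho
  | rail s => exact hr s s.2
  | flag b => exact hf b b.2
  | ring b i => exact hF b b.2 i i.2
  | acc b i => exact hA b b.2 i i.2

/-- A number that tells the partners of a swap apart. -/
def key : Qubit n L R → ℕ
  | rail s => s
  | flag _ => 2 * L
  | ring _ i => i
  | acc _ _ => R
  | _ => 0

/-- The reflection `s ↦ -1 - s` of the rail and of all rings. -/
def reflectOdd : Qubit n L R → Qubit n L R
  | rail s => rail s.rev
  | ring b i => ring b i.rev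
  | q => q

/-- The reflection `s ↦ -s` of the rail and of all rings. -/
def reflectEven : Qubit n L R → Qubit n L R
  | rail s => rail ⟨if s.val = 0 then 0 else 2 * L - s, by split_ifs <;> omega⟩
  | ring b i => ring b ⟨if i.val = 0 then 0 else R - i, by split_ifs <;> omega⟩
  | q => q

/-- The exchange of the first half of the rail with the flags. -/
def dockMap : Qubit n L R → Qubit n L R
  | rail s => if h : s.val < L then flag ⟨s, h⟩ else rail s
  | flag b => rail ⟨b, by omega⟩
  | q => q

/-- The exchange of the rings with the accumulators. -/
def stashMap : Qubit n L R → Qubit n L R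
  | ring b i => acc b i
  | acc b i => ring b i
  | q => q

/-- A time step of a rotation. -/
def reflectOddLayer : Layer n (Qubit n L R) :=
  .swaps reflectOdd key (by rintro (_ | _ | _ | _ | _ | _ | _) <;> simp [reflectOdd])
    (by rintro (_ | _ | _ | _ | _ | _ | _) <;> simp [reflectOdd, key, Fin.ext_iff] <;> omega)

/-- A time step of a rotation. -/
def reflectEvenLayer : Layer n (Qubit n L R) :=
  .swaps reflectEven key
    (by
      rintro (_ | _ | _ | s | _ | ⟨_, i⟩ | _) <;> simp only [reflectEven, rail.injEq, ring.injEq,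
        Fin.ext_iff, true_and] <;> split_ifs <;> omega)
    (by
      rintro (_ | _ | _ | s | _ | ⟨_, i⟩ | _) <;> simp only [reflectEven, rail.injEq, ring.injEq,
        Fin.ext_iff, true_and, key, implies_true] <;> split_ifs <;> omega)

/-- The exchange of the first half of the rail with the flags. -/
def dockLayer : Layer n (Qubit n L R) :=
  .swaps dockMap key
    (by
      rintro (_ | _ | _ | s | b | _ | _) <;> try rfl
      · simp only [dockMap]
        split_ifs with h
        · rfl
        · simp [h]
      · simp [dockMap])
    (by
      rintro (_ | _ | _ | s | b | _ | _) <;> try exact fun _ => rfl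
      · simp only [dockMap]
        split_ifs with h
        · simp only [key]
          omega
        · exact fun _ => rfl
      · simp only [dockMap, key]
        omega)

/-- The exchange of the rings with the accumulators. -/
def stashLayer : Layer n (Qubit n L R) :=
  .swaps stashMap key (by rintro (_ | _ | _ | _ | _ | _ | _) <;> rfl)
    (by
      rintro (_ | _ | _ | _ | _ | ⟨_, i⟩ | ⟨_, i⟩) <;> simp only [stashMap, key, implies_true] <;>
        omega)

/-- The predecessor on a cycle of length `m`. -/
def cyclicPred (m s : ℕ) : ℕ := if s = 0 then m - 1 else s - 1

/-- Rotate the rail and all rings by one. -/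
def rotate : List (Layer n (Qubit n L R)) := [reflectOddLayer, reflectEvenLayer]

section Dynamics

variable (data : (Fin n → Bool) → Bool) (a : Fin n → Bool) (c : ℕ → Bool) (o : Bool)
  (r f : ℕ → Bool) (F A : ℕ → ℕ → Bool)

/-- A rotation is the product of two reflections of the cycle, s ↦ -1 - s and s ↦ -s. Each is one
time step of disjoint swaps, and on a folded cycle these swaps join neighbours. -/
theorem run_rotate : runLayers data rotate (cfg a c o r f F A : Basis (Qubit n L R)) =
    cfg a c o (fun s => r (cyclicPred (2 * L) s)) f (fun b i => F b (cyclicPred R i)) A := by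
  simp only [rotate, runLayers, reflectOddLayer, reflectEvenLayer, Layer.act_swaps]
  have h : ∀ m s : ℕ, s < m → m - ((if s = 0 then 0 else m - s) + 1) = cyclicPred m s := by
    intro m s hs
    rw [cyclicPred]
    split_ifs <;> omega
  funext q
  cases q with
  | rail s =>
    simp only [Function.comp_apply, reflectEven, reflectOdd, cfg, Fin.val_rev]
    rw [h _ _ s.2]
  | ring b i =>
    simp only [Function.comp_apply, reflectEven, reflectOdd, cfg, Fin.val_rev]
    rw [h _ _ i.2]
  | _ => rfl

theorem run_dock : dockLayer.act data (cfg a c o r f F A : Basis (Qubit n L R)) =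
    cfg a c o (fun s => if s < L then f s else r s) r F A := by
  rw [dockLayer, Layer.act_swaps]
  funext q
  cases q with
  | rail s =>
    simp only [Function.comp_apply, dockMap, cfg]
    split_ifs <;> rfl
  | _ => rfl

theorem run_stash : stashLayer.act data (cfg a c o r f F A : Basis (Qubit n L R)) =
    cfg a c o r f A F := by
  rw [stashLayer, Layer.act_swaps]
  funext q
  cases q <;> rfl

end Dynamics

/-- The operation that couples the rail to the ring of the leaf `b`. -/
def routeGate [NeZero R] (b : Fin L) : Gate n (Qubit n L R) :=
  .cswap (flag b) (rail ⟨b, by omega⟩) (ring b 0)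

/-- In the leaf with the raised flag, the rail and the ring exchange a qubit. -/
def routeLayer [NeZero R] : Layer n (Qubit n L R) where
  gateAt q := match q with
    | flag b => routeGate b
    | rail s => if h : s.val < L then routeGate ⟨s, h⟩ else .idle (rail s)
    | ring b i => if i = 0 then routeGate b else .idle (ring b i)
    | q => .idle q
  mem_support := by
    rintro (_ | _ | _ | s | _ | ⟨_, i⟩ | _) <;> try simp [Gate.support, routeGate]
    · split_ifs <;> simp
    · split_ifs with h <;> simp [h]
  gateAt_eq := by
    have h0 : ∀ b : Fin L, ∀ r ∈ (routeGate b : Gate n (Qubit n L R)).support,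
        (match r with
          | flag b => routeGate b
          | rail s => if h : s.val < L then routeGate ⟨s, h⟩ else .idle (rail s)
          | ring b i => if i = 0 then routeGate b else .idle (ring b i)
          | q => .idle q) = (routeGate b : Gate n (Qubit n L R)) := by
      intro b r hr
      simp only [routeGate, Gate.support, Finset.mem_insert, Finset.mem_singleton] at hr
      rcases hr with rfl | rfl | rfl <;> simp [routeGate]
    rintro (_ | _ | _ | s | b | ⟨b, i⟩ | _) r hr
    · simp only [Gate.support, Finset.mem_singleton] at hr; rw [hr]
    · simp only [Gate.support, Finset.mem_singleton] at hr; rw [hr]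
    · simp only [Gate.support, Finset.mem_singleton] at hr; rw [hr]
    · by_cases h : s.val < L
      · simp only [h, dite_true] at hr ⊢
        exact h0 _ r hr
      · simp only [h, dite_false, Gate.support, Finset.mem_singleton] at hr
        rw [hr]
    · exact h0 b r hr
    · by_cases h : i = 0
      · simp only [h, if_true] at hr ⊢
        exact h0 _ r hr
      · simp only [h, if_false, Gate.support, Finset.mem_singleton] at hr
        rw [hr]
    · simp only [Gate.support, Finset.mem_singleton] at hr; rw [hr]

theorem run_route [NeZero R] (data : (Fin n → Bool) → Bool) (a : Fin n → Bool) (c : ℕ → Bool)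
    (o : Bool) (r f : ℕ → Bool) (F A : ℕ → ℕ → Bool) :
    routeLayer.act data (cfg a c o r f F A : Basis (Qubit n L R)) =
    cfg a c o (fun s => if s < L ∧ f s = true then F s 0 else r s) f
      (fun b i => if i = 0 ∧ f b = true then r b else F b i) A := by
  funext q
  cases q with
  | rail s =>
    by_cases h : s.val < L
    · by_cases h' : f s = true <;>
        simp [Layer.act, routeLayer, cfg, h, h', routeGate, Gate.act]
    · simp [Layer.act, routeLayer, cfg, h, Gate.act]
  | ring b i =>
    by_cases h : i = 0
    · by_cases h' : f b = true <;>
        simp [Layer.act, routeLayer, cfg, h, h', routeGate, Gate.act]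
    · have h1 : i.val ≠ 0 := fun e => h (Fin.ext e)
      simp [Layer.act, routeLayer, cfg, h, h1, Gate.act]
  | flag b =>
    by_cases h' : f b = true
    · simp only [Layer.act, routeLayer, routeGate, Gate.act, cfg, h', if_true, Function.comp_apply]
      rw [Equiv.swap_apply_of_ne_of_ne (by simp) (by simp)]
      exact h'
    · simp [Layer.act, routeLayer, cfg, h', routeGate, Gate.act]
  | _ => rfl

/-- Load memory cells into the accumulators, controlled by the corresponding ring qubits. -/
def loadLayer (cell : ℕ → ℕ → Option (Fin n → Bool)) : Layer n (Qubit n L R) where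
  gateAt q := match q with
    | ring b i => (cell b i).elim (.idle (ring b i)) fun x => .load x (ring b i) (acc b i)
    | acc b i => (cell b i).elim (.idle (acc b i)) fun x => .load x (ring b i) (acc b i)
    | q => .idle q
  mem_support := by
    rintro (_ | _ | _ | s | _ | ⟨b, i⟩ | ⟨b, i⟩) <;> try simp [Gate.support]
    · cases cell b i <;> simp
    · cases cell b i <;> simp
  gateAt_eq := by
    rintro (_ | _ | _ | s | _ | ⟨b, i⟩ | ⟨b, i⟩) r hr <;>
      try (simp only [Gate.support, Finset.mem_singleton] at hr; rw [hr])
    · cases h : cell b i with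
      | none =>
        simp only [h, Option.elim_none, Gate.support, Finset.mem_singleton] at hr
        rw [hr]
      | some x =>
        simp only [h, Option.elim_some, Gate.support, Finset.mem_singleton,
          Finset.mem_insert] at hr
        rcases hr with rfl | rfl <;> simp [h]
    · cases h : cell b i with
      | none =>
        simp only [h, Option.elim_none, Gate.support, Finset.mem_singleton] at hr
        rw [hr]
      | some x =>
        simp only [h, Option.elim_some, Gate.support, Finset.mem_singleton,
          Finset.mem_insert] at hr
        rcases hr with rfl | rfl <;> simp [h]

theorem run_load (cell : ℕ → ℕ → Option (Fin n → Bool)) (data : (Fin n → Bool) → Bool)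
    (a : Fin n → Bool) (c : ℕ → Bool) (o : Bool) (r f : ℕ → Bool) (F A : ℕ → ℕ → Bool) :
    (loadLayer cell).act data (cfg a c o r f F A : Basis (Qubit n L R)) =
    cfg a c o r f F (fun b i => xor (A b i) ((cell b i).elim false data && F b i)) := by
  funext q
  cases q with
  | ring b i =>
    cases h : cell b i with
    | none => simp [Layer.act, loadLayer, cfg, h, Gate.act]
    | some x =>
      by_cases h' : data x = true <;> simp [Layer.act, loadLayer, cfg, h, h', Gate.act, cnotMap]
  | acc b i =>
    cases h : cell b i with
    | none => simp [Layer.act, loadLayer, cfg, h, Gate.act]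
    | some x =>
      by_cases h' : data x = true <;> simp [Layer.act, loadLayer, cfg, h, h', Gate.act, cnotMap]
  | _ => rfl

end Qubit

end QLookup

namespace QLookup

theorem Layer.isReversible_single {n : ℕ} {Q : Type} [DecidableEq Q] {g : Gate n Q}
    (hg : g.IsReversible) (q : Q) : ((Layer.single g).gateAt q).IsReversible := by
  simp only [Layer.single]
  split_ifs
  · exact hg
  · trivial

/-! ### Comparing the address with a pattern -/

namespace Qubit

variable {n L R : ℕ}

/-- The first `i` bits of `a` match the pattern. -/
abbrev MatchesUpTo (pat : Fin n → Option Bool) (a : Fin n → Bool) (i : ℕ) : Prop :=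
  ∀ k : Fin n, k.val < i → ∀ v, pat k = some v → a k = v

/-- Extend the conjunction by the comparison of the `i`-th bit with the pattern. -/
def compareBit (pat : Fin n → Option Bool) (i : Fin n) : List (Layer n (Qubit n L R)) :=
  match pat i with
  | none => [.single (.cnot (chain i.castSucc) (chain i.succ))]
  | some true => [.single (.ccnot (chain i.castSucc) (addr i) (chain i.succ))]
  | some false => [.single (.cnot (chain i.castSucc) (chain i.succ)),
      .single (.ccnot (chain i.castSucc) (addr i) (chain i.succ))]

/-- Compare the first `j` address bits with a pattern. -/
def compareBits (pat : Fin n → Option Bool) : ℕ → List (Layer n (Qubit n L R))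
  | 0 => [.single (.not (chain 0))]
  | j + 1 => compareBits pat j ++ if h : j < n then compareBit pat ⟨j, h⟩ else []

theorem mem_compareBits {pat : Fin n → Option Bool} {j : ℕ} {l : Layer n (Qubit n L R)}
    (hl : l ∈ compareBits pat j) : l = .single (.not (chain 0)) ∨
      ∃ i : Fin n, l = .single (.cnot (chain i.castSucc) (chain i.succ)) ∨
        l = .single (.ccnot (chain i.castSucc) (addr i) (chain i.succ)) := by
  induction j with
  | zero => exact Or.inl (by simpa [compareBits] using hl)
  | succ j ih =>
    rw [compareBits, List.mem_append] at hl
    rcases hl with hl | hl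
    · exact ih hl
    · split_ifs at hl with h
      · refine Or.inr ⟨⟨j, h⟩, ?_⟩
        rw [compareBit] at hl
        split at hl <;> simp only [List.mem_cons, List.not_mem_nil, or_false] at hl
        · exact Or.inl hl
        · exact Or.inr hl
        · exact hl
      · simp at hl

theorem isReversible_compareBits (pat : Fin n → Option Bool) (j : ℕ) :
    ∀ l ∈ (compareBits pat j : List (Layer n (Qubit n L R))), ∀ q, (l.gateAt q).IsReversible := by
  intro l hl q
  rcases mem_compareBits hl with rfl | ⟨i, rfl | rfl⟩ <;> apply Layer.isReversible_single
  · trivial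
  · simp [Gate.IsReversible, Fin.ext_iff]
  · simp [Gate.IsReversible, Fin.ext_iff]

section

variable (data : (Fin n → Bool) → Bool) (a : Fin n → Bool) (c : ℕ → Bool) (o : Bool)
  (r f : ℕ → Bool) (F A : ℕ → ℕ → Bool)

theorem update_cfg_chain (i : Fin (n + 1)) (x : Bool) :
    Function.update (cfg a c o r f F A : Basis (Qubit n L R)) (chain i) x =
      cfg a (Function.update c i x) o r f F A := by
  funext q
  cases q with
  | chain j =>
    by_cases h : j = i
    · subst h; simp [cfg]
    · have h' : j.val ≠ i.val := fun e => h (Fin.ext e)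
      rw [Function.update_of_ne (by simpa using h)]
      simp [cfg, Function.update_of_ne h']
  | _ => simp [cfg]

/-- A negated bit uses c ∧ ¬x = c ⊕ (c ∧ x), that is a CNOT and a Toffoli. -/
theorem run_compareBit (pat : Fin n → Option Bool) (i : Fin n) :
    runLayers data (compareBit pat i) (cfg a c o r f F A : Basis (Qubit n L R)) =
      cfg a (Function.update c (i + 1)
        (xor (c (i + 1)) (c i && decide (∀ v, pat i = some v → a i = v)))) o r f F A := by
  have hi : (i : ℕ) ≠ i + 1 := by omega
  cases hp : pat i with
  | none => simp [compareBit, hp, runLayers, Layer.act_single, Gate.act, cnotMap, update_cfg_chain,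
      cfg]
  | some v =>
    cases v
    · simp only [compareBit, hp, runLayers, Layer.act_single, Gate.act, cnotMap, update_cfg_chain,
        cfg]
      simp only [Fin.val_succ, Fin.val_castSucc, Function.update_self, Function.update_of_ne hi,
        Function.update_idem]
      congr 2
      cases c i <;> cases a i <;> cases c (i + 1) <;> simp
    · simp only [compareBit, hp, runLayers, Layer.act_single, Gate.act, update_cfg_chain, cfg]
      congr 2
      cases a i <;> simp

/-- All partial conjunctions are kept, one per chain qubit, so that each gate involves only two
adjacent chain qubits and at most one address qubit. -/
theorem run_compareBits (pat : Fin n → Option Bool) {j : ℕ} (hj : j ≤ n) :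
    runLayers data (compareBits pat j)
      (cfg a (fun _ => false) o r f F A : Basis (Qubit n L R)) =
      cfg a (fun i => decide (i ≤ j ∧ MatchesUpTo pat a i)) o r f F A := by
  induction j with
  | zero =>
    simp only [compareBits, runLayers, Layer.act_single, Gate.act, update_cfg_chain, cfg]
    congr 1
    funext i
    by_cases h : i = 0
    · subst h
      have : MatchesUpTo pat a 0 := fun k hk => absurd hk (Nat.not_lt_zero _)
      simp only [Bool.not_false, le_refl, true_and]
      exact (decide_eq_true this).symm
    · simp [h]
  | succ j ih =>
    rw [compareBits, runLayers_append, ih (by omega), dif_pos (by omega), run_compareBit]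
    congr 1
    funext i
    by_cases h : i = j + 1
    · subst h
      rw [Function.update_self, Bool.eq_iff_iff]
      have hs : MatchesUpTo pat a (j + 1) ↔ MatchesUpTo pat a j ∧
          ∀ v, pat ⟨j, by omega⟩ = some v → a ⟨j, by omega⟩ = v := by
        constructor
        · exact fun h => ⟨fun k hk => h k (by omega), h ⟨j, by omega⟩ (by simp)⟩
        · rintro ⟨h1, h2⟩ k hk
          rcases Nat.lt_succ_iff_lt_or_eq.1 hk with h | h
          · exact h1 k h
          · subst h
            exact h2
      have h1 : ¬ (j + 1 ≤ j) := by omega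
      simp [h1, hs]
    · rw [Function.update_of_ne h]
      have : i ≤ j ↔ i ≤ j + 1 := by omega
      simp [this]

/-- Flip the first qubit of the rail if the address matches the pattern. -/
def emit [NeZero L] (pat : Fin n → Option Bool) : List (Layer n (Qubit n L R)) :=
  conjLayers (compareBits pat n) [.single (.cnot (chain (Fin.last n))
    (rail ⟨0, by have := NeZero.pos L; omega⟩))]

/-- If the address matches the pattern, add the first qubit of the rail to the output. -/
def collect [NeZero L] (pat : Fin n → Option Bool) : List (Layer n (Qubit n L R)) :=
  conjLayers (compareBits pat n) [.single (.ccnot (chain (Fin.last n))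
    (rail ⟨0, by have := NeZero.pos L; omega⟩) out)]

theorem run_emit [NeZero L] (pat : Fin n → Option Bool) :
    runLayers data (emit pat) (cfg a (fun _ => false) o r f F A : Basis (Qubit n L R)) =
      cfg a (fun _ => false) o
        (fun s => if s = 0 then xor (r 0) (decide (MatchesUpTo pat a n)) else r s) f F A := by
  refine runLayers_conj data (isReversible_compareBits pat n)
    (run_compareBits data a o r f F A pat le_rfl) ?_ (run_compareBits data a o _ f F A pat le_rfl)
  simp only [runLayers, Layer.act_single, Gate.act, cnotMap]
  funext q
  cases q with
  | rail s =>
    by_cases h : s = ⟨0, by have := NeZero.pos L; omega⟩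
    · subst h; simp [cfg]
    · have h' : s.val ≠ 0 := fun e => h (Fin.ext e)
      rw [Function.update_of_ne (by simpa using h)]
      simp [cfg, h']
  | _ => simp [cfg]

theorem run_collect [NeZero L] (pat : Fin n → Option Bool) :
    runLayers data (collect pat) (cfg a (fun _ => false) o r f F A : Basis (Qubit n L R)) =
      cfg a (fun _ => false) (xor o (decide (MatchesUpTo pat a n) && r 0)) r f F A := by
  refine runLayers_conj data (isReversible_compareBits pat n)
    (run_compareBits data a o r f F A pat le_rfl) ?_ (run_compareBits data a _ r f F A pat le_rfl)
  simp only [runLayers, Layer.act_single, Gate.act]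
  funext q
  cases q <;> simp [cfg]

end

/-! ### The circuit and its action on basis states -/

/-- A division of addresses into the number of a leaf, an offset `l < R` and a number `h < H`. -/
structure Addressing (n L R H : ℕ) where
  /-- the number of the leaf -/
  b : (Fin n → Bool) → ℕ
  /-- the offset -/
  l : (Fin n → Bool) → ℕ
  /-- the remaining part of the address -/
  h : (Fin n → Bool) → ℕ
  b_lt : ∀ a, b a < L
  l_lt : ∀ a, l a < R
  h_lt : ∀ a, h a < H
  /-- the patterns that recognize the leaves -/
  patB : ℕ → Fin n → Option Bool
  /-- the patterns that recognize the offsets -/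
  patL : ℕ → Fin n → Option Bool
  /-- the patterns that recognize the remaining parts -/
  patH : ℕ → Fin n → Option Bool
  patB_iff : ∀ a, ∀ e < L, MatchesUpTo (patB e) a n ↔ b a = e
  patL_iff : ∀ a, ∀ e < R, MatchesUpTo (patL e) a n ↔ l a = e
  patH_iff : ∀ a, ∀ e < H, MatchesUpTo (patH e) a n ↔ h a = e
  /-- the address with given parts -/
  cell : ℕ → ℕ → ℕ → Fin n → Bool
  cell_eq : ∀ a, cell (b a) (l a) (h a) = a

namespace Addressing

variable {H : ℕ} (D : Addressing n L R H) [NeZero L] [NeZero R]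

/-- Raise the flag of the leaf of the address. -/
def raiseFlag : List (Layer n (Qubit n L R)) :=
  (List.range L).flatMap fun t => rotate ++ emit (D.patB (L - 1 - t))

/-- The memory cells that are loaded in a time step. -/
def cells (t b i : ℕ) : Option (Fin n → Bool) :=
  -- Place `i` of ring `b` is place `b + i` of the spliced cycle, and a control found there at tick
  -- `t` was emitted at tick `t - (b + i)`, which is its row.
  if b + i ≤ t ∧ t - (b + i) < H then some (D.cell b ((b + i) % R) (t - (b + i))) else none

/-- Emission of the control qubits on the rail, and their removal after a full turn. -/
def emissions (t : ℕ) : List (Layer n (Qubit n L R)) :=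
  (if t < H then emit (D.patH t) else []) ++
    if 2 * L + R ≤ t ∧ t < H + (2 * L + R) then emit (D.patH (t - (2 * L + R))) else []

/-- One period of loading. -/
def loadTick (t : ℕ) : List (Layer n (Qubit n L R)) :=
  rotate ++ D.emissions t ++ [routeLayer, loadLayer (D.cells t)]

/-- Load the memory into the accumulators of the leaf and from there into the ring. -/
def loadAll : List (Layer n (Qubit n L R)) :=
  (List.range (H + (2 * L + R))).flatMap D.loadTick ++ [stashLayer]

/-- One period of the collection. -/
def collectTick (t : ℕ) : List (Layer n (Qubit n L R)) :=
  rotate ++ collect (D.patL ((2 * L + R - 1 - t) % R)) ++ [routeLayer]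

/-- Pick the requested bit while the loaded bits move past the output qubit. -/
def collectAll : List (Layer n (Qubit n L R)) :=
  (List.range (2 * L + R)).flatMap D.collectTick

/-- The circuit. -/
def program : List (Layer n (Qubit n L R)) :=
  conjLayers (D.raiseFlag ++ [dockLayer] ++ D.loadAll) D.collectAll

variable (data : (Fin n → Bool) → Bool) (a : Fin n → Bool) (o : Bool)

/-- A basis state with empty chain. -/
abbrev st (o : Bool) (r f : ℕ → Bool) (F A : ℕ → ℕ → Bool) : Basis (Qubit n L R) :=
  cfg a (fun _ => false) o r f F A

omit [NeZero R] in
-- The bit for leaf e is emitted at tick L - 1 - e, and the e ticks that remain carry it to rail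
-- place e. The invariant is an equation of sums, so that it avoids truncated subtraction and fails
-- for all `s` before the emission.
theorem run_raiseFlag : runLayers data D.raiseFlag
    (st a o (fun _ => false) (fun _ => false) (fun _ _ => false) fun _ _ => false) =
      st a o (fun s => decide (s = D.b a)) (fun _ => false) (fun _ _ => false)
        fun _ _ => false := by
  have hb := D.b_lt a
  have := runLayers_flatMap_range data (fun t => rotate ++ emit (D.patB (L - 1 - t)))
    (fun t => (st a o (fun s => decide (D.b a + t = L + s)) (fun _ => false) (fun _ _ => false)
        fun _ _ => false : Basis (Qubit n L R))) L ?_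
  · refine Eq.trans (congrArg _ ?_) (this.trans ?_)
    · refine cfg_congr (fun _ _ => rfl) rfl (fun s _ => ?_) (fun _ _ => rfl) (fun _ _ _ _ => rfl)
        fun _ _ _ _ => rfl
      symm
      simp only [decide_eq_false_iff_not]
      omega
    · refine cfg_congr (fun _ _ => rfl) rfl (fun s _ => ?_) (fun _ _ => rfl) (fun _ _ _ _ => rfl)
        fun _ _ _ _ => rfl
      simp only [decide_eq_decide]
      omega
  · intro t ht
    rw [runLayers_append, run_rotate, run_emit]
    refine cfg_congr (fun _ _ => rfl) rfl (fun s hs => ?_) (fun _ _ => rfl) (fun _ _ _ _ => rfl)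
        fun _ _ _ _ => rfl
    simp only [cyclicPred, D.patB_iff a (L - 1 - t) (by omega)]
    by_cases h0 : s = 0
    · subst h0
      -- Nothing wraps around, since the bit has not left the first half of the rail.
      have h1 : ¬ (D.b a + t = L + (2 * L - 1)) := by omega
      have h2 : D.b a = L - 1 - t ↔ D.b a + (t + 1) = L + 0 := by omega
      simp [h1, h2]
    · simp only [h0, if_false, decide_eq_decide]
      omega

/-- The contents of the rail when the cycle that consists of the rail and the ring of the leaf `b`
has the contents `c`. -/
def railOf (R b : ℕ) (c : ℕ → Bool) (s : ℕ) : Bool := if s < b then c s else c (s + R)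

/-- The contents of the rings when the cycle that consists of the rail and the ring of the leaf `b`
has the contents `c`. -/
def ringOf (b : ℕ) (c : ℕ → Bool) (b' i : ℕ) : Bool := decide (b' = b) && c (b + i)

/-- A basis state in which the cycle that consists of the rail and the ring of the requested leaf
has the contents `c`. -/
abbrev cycleState (o : Bool) (c : ℕ → Bool) (A : ℕ → ℕ → Bool) : Basis (Qubit n L R) :=
  st a o (railOf R (D.b a) c) (fun b => decide (b = D.b a)) (ringOf (D.b a) c) A

omit [NeZero L] in
-- Rail and ring turn separately; the exchange of rail place `b` with ring place 0 then sends what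
-- came along the rail into the ring, and what came from the end of the ring on along the rail.
-- Together this is one turn of a cycle of length 2L + R. The bit `g` enters at rail place 0 before
-- the exchange and ends at cycle place 0 also if b = 0, where this is a ring place.
theorem run_cycle (c : ℕ → Bool) (A : ℕ → ℕ → Bool) (g : Bool) :
    routeLayer.act data (st a o
      (fun s => if s = 0 then xor (railOf R (D.b a) c (cyclicPred (2 * L) 0)) g else
        railOf R (D.b a) c (cyclicPred (2 * L) s)) (fun b => decide (b = D.b a))
      (fun b i => ringOf (D.b a) c b (cyclicPred R i)) A) =
    D.cycleState a o (fun j => if j = 0 then xor (c (2 * L + R - 1)) g else c (j - 1)) A := by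
  have hb := D.b_lt a
  have hR := NeZero.pos R
  rw [st, run_route]
  refine cfg_congr (fun _ _ => rfl) rfl (fun s hs => ?_) (fun _ _ => rfl) (fun b' hb' i hi => ?_)
        fun _ _ _ _ => rfl
  · simp only [decide_eq_true_eq, cyclicPred, if_true, railOf, ringOf]
    have e1 : ¬ (2 * L - 1 < D.b a) := by omega
    have e2 : 2 * L - 1 + R = 2 * L + R - 1 := by omega
    by_cases h1 : s = D.b a
    · subst h1
      have e3 : ¬ (D.b a + R = 0) := by omega
      have e4 : D.b a + (R - 1) = D.b a + R - 1 := by omega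
      simp [hb, e4]
      omega
    · by_cases h0 : s = 0
      · subst h0
        have e3 : 0 < D.b a := by omega
        simp [h1, e1, e2, e3]
      · by_cases h2 : s < D.b a
        · have e3 : s - 1 < D.b a := by omega
          simp [h1, h0, h2, e3]
        · have e3 : ¬ (s - 1 < D.b a) := by omega
          have e4 : s - 1 + R = s + R - 1 := by omega
          simp [h1, h0, h2, e3, e4]
  · simp only [decide_eq_true_eq, cyclicPred, if_true, railOf, ringOf]
    by_cases h1 : b' = D.b a
    · subst h1
      by_cases h0 : i = 0
      · subst h0
        have e1 : ¬ (2 * L - 1 < D.b a) := by omega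
        have e2 : 2 * L - 1 + R = 2 * L + R - 1 := by omega
        by_cases h2 : D.b a = 0
        · rw [h2]
          simp [e2]
        · have e3 : D.b a - 1 < D.b a := by omega
          simp [h2, e3]
      · have e3 : D.b a + (i - 1) = D.b a + i - 1 := by omega
        simp [h0, e3]
    · simp [h1]

omit [NeZero R] in
theorem run_emissions (t : ℕ) (r f : ℕ → Bool) (F A : ℕ → ℕ → Bool) :
    runLayers data (D.emissions t) (st a o r f F A) =
      st a o (fun s => if s = 0 then xor (r 0) (xor (decide (D.h a = t))
        (decide (D.h a + (2 * L + R) = t))) else r s) f F A := by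
  have hh := D.h_lt a
  rw [emissions, runLayers_append]
  have h1 : runLayers data (if t < H then emit (D.patH t) else []) (st a o r f F A) =
      (st a o (fun s => if s = 0 then xor (r 0) (decide (D.h a = t)) else r s) f F A :
        Basis (Qubit n L R)) := by
    split_ifs with h
    · rw [st, run_emit]
      simp only [D.patH_iff a t h]
    · have e : ¬ (D.h a = t) := by omega
      rw [runLayers]
      congr 1
      funext s
      by_cases h0 : s = 0 <;> simp [h0, e]
  rw [h1]
  split_ifs with h
  · rw [st, run_emit]
    have e : D.h a = t - (2 * L + R) ↔ D.h a + (2 * L + R) = t := by omega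
    simp only [D.patH_iff a _ (by omega : t - (2 * L + R) < H), e, if_true, Bool.xor_assoc]
    congr 1
    funext s
    by_cases h0 : s = 0 <;> simp [h0]
  · have e : ¬ (D.h a + (2 * L + R) = t) := by omega
    rw [runLayers]
    congr 1
    funext s
    by_cases h0 : s = 0 <;> simp [h0, e]

/-- The bits that a leaf loads for the requested address, by offset. -/
abbrev row (l : ℕ) : Bool := data (D.cell (D.b a) l (D.h a))

/-- The control emitted at tick h moves during tick t from cycle place t - 1 - h to t - h; if this
lies in the ring, the bit for that place is loaded. At tick h + 2L + R the control is back at place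
0, where the second emission cancels it. -/
theorem run_loadTick (t : ℕ) : runLayers data (D.loadTick t)
      (D.cycleState a o (fun j => decide (D.h a + j + 1 = t)) fun b i =>
        decide (b = D.b a ∧ D.h a + b + i + 1 ≤ t) && D.row data a ((b + i) % R)) =
    D.cycleState a o (fun j => decide (D.h a + j + 1 = t + 1)) fun b i =>
        decide (b = D.b a ∧ D.h a + b + i + 1 ≤ t + 1) && D.row data a ((b + i) % R) := by
  have hb := D.b_lt a
  have hh := D.h_lt a
  have hR := NeZero.pos R
  rw [loadTick, List.append_assoc, runLayers_append, run_rotate, runLayers_append,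
    run_emissions]
  simp only [runLayers]
  rw [run_cycle, run_load]
  have hc : (fun j => if j = 0 then xor (decide (D.h a + (2 * L + R - 1) + 1 = t))
      (xor (decide (D.h a = t)) (decide (D.h a + (2 * L + R) = t))) else
      decide (D.h a + (j - 1) + 1 = t)) = fun j => decide (D.h a + j + 1 = t + 1) := by
    funext j
    by_cases h0 : j = 0
    · subst h0
      have e1 : D.h a + (2 * L + R - 1) + 1 = t ↔ D.h a + (2 * L + R) = t := by omega
      simp only [if_true, e1, Bool.xor_comm (decide (D.h a = t)), ← Bool.xor_assoc, Bool.xor_self,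
        Bool.false_xor, decide_eq_decide]
      omega
    · simp only [h0, if_false, decide_eq_decide]
      omega
  rw [hc]
  refine cfg_congr (fun _ _ => rfl) rfl (fun s hs => rfl) (fun _ _ => rfl) (fun b' hb' i hi => rfl)
        fun b hb i hi => ?_
  simp only [ringOf]
  by_cases h1 : b = D.b a
  · subst h1
    -- This is the case that the control has just arrived at ring place `i`.
    by_cases h2 : D.h a + (D.b a + i) + 1 = t + 1
    · have e1 : D.b a + i ≤ t ∧ t - (D.b a + i) < H := by omega
      have e2 : t - (D.b a + i) = D.h a := by omega
      have e3 : ¬ (D.h a + D.b a + i + 1 ≤ t) := by omega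
      have e4 : D.h a + D.b a + i ≤ t := by omega
      rw [cells, if_pos e1, e2]
      simp [h2, e3, e4]
    · have e3 : D.h a + D.b a + i + 1 ≤ t ↔ D.h a + D.b a + i + 1 ≤ t + 1 := by omega
      simp only [h2, e3, decide_false, Bool.and_false, Bool.xor_false]
  · simp [h1]

/-- The contents of the cycle after loading. -/
def loaded (j : ℕ) : Bool := decide (D.b a ≤ j ∧ j < D.b a + R) && D.row data a (j % R)

theorem run_loadAll : runLayers data D.loadAll
      (D.cycleState a o (fun _ => false) fun _ _ => false) =
    D.cycleState a o (D.loaded data a) fun _ _ => false := by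
  have hb := D.b_lt a
  have hh := D.h_lt a
  have hR := NeZero.pos R
  have := runLayers_flatMap_range data D.loadTick (fun t => D.cycleState a o
    (fun j => decide (D.h a + j + 1 = t)) fun b i =>
        decide (b = D.b a ∧ D.h a + b + i + 1 ≤ t) && D.row data a ((b + i) % R))
    (H + (2 * L + R)) fun t _ => D.run_loadTick data a o t
  have h0 : D.cycleState a o (fun j => decide (D.h a + j + 1 = 0)) (fun b i =>
        decide (b = D.b a ∧ D.h a + b + i + 1 ≤ 0) && D.row data a ((b + i) % R)) =
      D.cycleState a o (fun _ => false) fun _ _ => false := by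
    simp
  rw [loadAll, runLayers_append, ← h0, this]
  simp only [runLayers]
  rw [run_stash]
  refine cfg_congr (fun _ _ => rfl) rfl (fun s hs => ?_) (fun _ _ => rfl) (fun b' hb' i hi => ?_)
        fun b hb i hi => ?_
  · simp only [railOf, loaded]
    split_ifs with h
    · have e1 : ¬ (D.h a + s + 1 = H + (2 * L + R)) := by omega
      have e2 : ¬ (D.b a ≤ s) := by omega
      simp [e1, e2]
    · have e1 : ¬ (D.h a + (s + R) + 1 = H + (2 * L + R)) := by omega
      have e2 : ¬ (s + R < D.b a + R) := by omega
      simp [e1, e2]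
  · simp only [ringOf, loaded]
    by_cases h : b' = D.b a
    · subst h
      have e1 : D.h a + D.b a + i + 1 ≤ H + (2 * L + R) := by omega
      simp [e1, hi]
    · simp [h]
  · simp only [ringOf]
    have e1 : ¬ (D.h a + (D.b a + i) + 1 = H + (2 * L + R)) := by omega
    simp [e1]

omit [NeZero L] in
-- Offsets are attached to cycle places modulo R rather than to ring places. The R consecutive
-- places of the ring then hold every offset once, while the offset that passes the output at a
-- given tick is the same for all leaves, as it must be for a circuit that cannot depend on `b`.
theorem exists_slot : ∃ j, D.b a ≤ j ∧ j < D.b a + R ∧ j % R = D.l a ∧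
    ∀ j', D.b a ≤ j' → j' < D.b a + R → j' % R = D.l a → j' = j := by
  have hl := D.l_lt a
  have hR := NeZero.pos R
  have hm := Nat.div_add_mod (D.b a) R
  have hmr := Nat.mod_lt (D.b a) hR
  have huniq : ∀ j j', D.b a ≤ j → j < D.b a + R → D.b a ≤ j' → j' < D.b a + R →
      j % R = j' % R → j ≤ j' := by
    intro j j' h1 h2 h3 h4 h5
    by_contra h
    have h6 : R ∣ j - j' := (Nat.modEq_iff_dvd' (by omega)).1 h5.symm
    have := Nat.eq_zero_of_dvd_of_lt h6 (by omega)
    omega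
  have hex : ∃ j, D.b a ≤ j ∧ j < D.b a + R ∧ j % R = D.l a := by
    by_cases h : D.b a % R ≤ D.l a
    · refine ⟨R * (D.b a / R) + D.l a, by omega, by omega, ?_⟩
      rw [Nat.mul_add_mod, Nat.mod_eq_of_lt hl]
    · refine ⟨R * (D.b a / R + 1) + D.l a, ?_, ?_, ?_⟩
      · rw [mul_add]; omega
      · rw [mul_add]; omega
      · rw [Nat.mul_add_mod, Nat.mod_eq_of_lt hl]
  obtain ⟨j, h1, h2, h3⟩ := hex
  exact ⟨j, h1, h2, h3, fun j' h4 h5 h6 => le_antisymm (huniq _ _ h4 h5 h1 h2 (h6.trans h3.symm))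
    (huniq _ _ h1 h2 h4 h5 (h3.trans h6.symm))⟩

/-- At tick t the former content of place j = 2L + R - 1 - t reaches rail place 0 and is added to
the output if `l` equals j mod R. Several j share this residue, but all places outside of the ring
are empty, so only the slot `j₀` counts. A full turn restores the cycle, which makes the
uncomputation possible. -/
theorem run_collectAll : runLayers data D.collectAll
      (D.cycleState a o (D.loaded data a) fun _ _ => false) =
    D.cycleState a (xor o (data a)) (D.loaded data a) fun _ _ => false := by
  have hb := D.b_lt a
  have hl := D.l_lt a
  have hR := NeZero.pos R
  obtain ⟨j₀, h1, h2, h3, h4⟩ := D.exists_slot a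
  set u := D.loaded data a with hu
  have := runLayers_flatMap_range data D.collectTick (fun t => D.cycleState a
    (xor o (decide (2 * L + R ≤ t + j₀) && data a))
    (fun j => if t ≤ j then u (j - t) else u (j + (2 * L + R) - t)) fun _ _ => false)
    (2 * L + R) ?_
  · rw [collectAll]
    convert this using 1
    · have e : ¬ (2 * L + R ≤ j₀) := by omega
      simp [e]
    · refine cfg_congr (fun _ _ => rfl) ?_ (fun s hs => ?_) (fun _ _ => rfl)
        (fun b' hb' i hi => ?_) fun b hb i hi => rfl
      · simp
      · simp only [railOf]
        split_ifs <;> first | omega | rw [Nat.add_sub_cancel]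
      · simp only [ringOf]
        rw [if_neg (by omega), Nat.add_sub_cancel]
  · intro t ht
    rw [collectTick, runLayers_append, runLayers_append, run_rotate, run_collect]
    simp only [runLayers]
    have hcyc := D.run_cycle data a
      (xor o (decide (2 * L + R ≤ t + 1 + j₀) && data a))
      (fun j => if t ≤ j then u (j - t) else u (j + (2 * L + R) - t)) (fun _ _ => false) false
    have e0 : railOf R (D.b a) (fun j => if t ≤ j then u (j - t) else u (j + (2 * L + R) - t))
        (cyclicPred (2 * L) 0) = u (2 * L + R - 1 - t) := by
      have e1 : ¬ (2 * L - 1 < D.b a) := by omega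
      have e2 : t ≤ 2 * L - 1 + R := by omega
      have e3 : 2 * L - 1 + R - t = 2 * L + R - 1 - t := by omega
      simp [railOf, cyclicPred, e1, e2, e3]
    have e4 : (2 * L + R - 1 - t) % R < R := Nat.mod_lt _ hR
    have e5 : (xor (xor o (decide (2 * L + R ≤ t + j₀) && data a))
        (decide (MatchesUpTo (D.patL ((2 * L + R - 1 - t) % R)) a n) &&
          u (2 * L + R - 1 - t))) = xor o (decide (2 * L + R ≤ t + 1 + j₀) && data a) := by
      rw [Bool.xor_assoc]
      congr 1
      simp only [D.patL_iff a _ e4]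
      by_cases h5 : j₀ = 2 * L + R - 1 - t
      · have e6 : ¬ (2 * L + R ≤ t + j₀) := by omega
        have e7 : 2 * L + R ≤ t + 1 + j₀ := by omega
        have e8 : u (2 * L + R - 1 - t) = data a := by
          rw [hu, ← h5, loaded, row, h3, D.cell_eq]
          simp [h1, h2]
        have e9 : D.l a = (2 * L + R - 1 - t) % R := by rw [← h5, h3]
        simp only [e8, e6, e7, ← e9]
        simp
      · have e6 : 2 * L + R ≤ t + j₀ ↔ 2 * L + R ≤ t + 1 + j₀ := by omega
        have e7 : (decide (D.l a = (2 * L + R - 1 - t) % R) && u (2 * L + R - 1 - t)) = false := by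
          rw [hu, loaded, Bool.and_eq_false_iff]
          by_contra h6
          simp only [not_or, Bool.not_eq_false, Bool.and_eq_true, decide_eq_true_eq] at h6
          exact h5 (h4 _ h6.2.1.1 h6.2.1.2 h6.1.symm).symm
        rw [e7, Bool.xor_false]
        simp only [e6]
    rw [e0, e5]
    have e6 : (fun s => railOf R (D.b a) (fun j => if t ≤ j then u (j - t) else
        u (j + (2 * L + R) - t)) (cyclicPred (2 * L) s)) = fun s => if s = 0 then
        xor (railOf R (D.b a) (fun j => if t ≤ j then u (j - t) else
        u (j + (2 * L + R) - t)) (cyclicPred (2 * L) 0)) false else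
        railOf R (D.b a) (fun j => if t ≤ j then u (j - t) else
        u (j + (2 * L + R) - t)) (cyclicPred (2 * L) s) := by
      funext s
      by_cases h0 : s = 0 <;> simp [h0]
    rw [e6, hcyc]
    have e7 : (fun j => if j = 0 then xor (if t ≤ 2 * L + R - 1 then u (2 * L + R - 1 - t) else
        u (2 * L + R - 1 + (2 * L + R) - t)) false else if t ≤ j - 1 then u (j - 1 - t) else
        u (j - 1 + (2 * L + R) - t)) =
        fun j => if t + 1 ≤ j then u (j - (t + 1)) else u (j + (2 * L + R) - (t + 1)) := by
      funext j
      by_cases h0 : j = 0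
      · subst h0
        rw [if_pos rfl, if_pos (by omega), if_neg (by omega), Bool.xor_false]
        congr 1
        omega
      · rw [if_neg h0]
        by_cases h5 : t + 1 ≤ j
        · rw [if_pos (by omega), if_pos h5]
          congr 1
          omega
        · rw [if_neg (by omega), if_neg h5]
          congr 1
          omega
    rw [e7]

end Addressing

end Qubit

end QLookup

namespace QLookup

/-! ### Shielding of layers, and its transport to renamed qubits -/

section Transport

variable {n : ℕ} {Q Q' : Type} [DecidableEq Q] [DecidableEq Q'] {ι : Type}
  {region : Q → Option ι} {ℓ : ι} {data : (Fin n → Bool) → Bool}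

/-- All operations of a sequence of time steps are shielded when they are executed. -/
def ShieldedLayers (region : Q → Option ι) (ℓ : ι) (data : (Fin n → Bool) → Bool) :
    List (Layer n Q) → Basis Q → Prop
  | [], _ => True
  | l :: ls, y => (∀ q, (l.gateAt q).Shielded region ℓ y) ∧
      ShieldedLayers region ℓ data ls (l.act data y)

theorem shieldedLayers_append {ls ls' : List (Layer n Q)} {y : Basis Q} :
    ShieldedLayers region ℓ data (ls ++ ls') y ↔ ShieldedLayers region ℓ data ls y ∧
      ShieldedLayers region ℓ data ls' (runLayers data ls y) := by
  induction ls generalizing y with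
  | nil => simp [ShieldedLayers, runLayers]
  | cons l ls ih => simp [ShieldedLayers, runLayers, ih, and_assoc]

theorem shieldedRun_append {gs gs' : List (Gate n Q)} {y : Basis Q} :
    ShieldedRun region ℓ data (gs ++ gs') y ↔ ShieldedRun region ℓ data gs y ∧
      ShieldedRun region ℓ data gs' (runActs data gs y) := by
  induction gs generalizing y with
  | nil => simp [ShieldedRun, runActs]
  | cons l ls ih => simp [ShieldedRun, runActs, ih, and_assoc]

theorem Gate.Shielded.congr {g : Gate n Q} {y y' : Basis Q} (h : g.Shielded region ℓ y)
    (hy : ∀ q ∈ g.support, y q = y' q) : g.Shielded region ℓ y' := by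
  rcases h with h | ⟨c, u, v, rfl, h1, h2, h3⟩
  · exact Or.inl h
  · refine Or.inr ⟨c, u, v, rfl, h1, h2, ?_⟩
    rwa [← hy c (by simp [Gate.support])]

theorem shieldedRun_of_pairwise {gs : List (Gate n Q)}
    (hgs : gs.Pairwise fun g g' => Disjoint g.support g'.support) {y : Basis Q}
    (h : ∀ g ∈ gs, g.Shielded region ℓ y) : ShieldedRun region ℓ data gs y := by
  induction gs generalizing y with
  | nil => trivial
  | cons g gs ih =>
    rw [List.pairwise_cons] at hgs
    refine ⟨h g List.mem_cons_self, ih hgs.2 fun g' hg' => ?_⟩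
    refine (h g' (List.mem_cons_of_mem g hg')).congr fun q hq => ?_
    exact (Gate.act_of_notMem data g y (Finset.disjoint_right.1 (hgs.1 g' hg') hq)).symm

theorem runActs_flatten_gates [Fintype Q] (data : (Fin n → Bool) → Bool) (ls : List (Layer n Q))
    (y : Basis Q) : runActs data (ls.map Layer.gates).flatten y = runLayers data ls y := by
  induction ls generalizing y with
  | nil => rfl
  | cons l ls ih =>
    rw [List.map_cons, List.flatten_cons, runActs_append, Layer.runActs_gates, ih, runLayers]

theorem ShieldedLayers.shieldedRun [Fintype Q] {ls : List (Layer n Q)} {y : Basis Q}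
    (h : ShieldedLayers region ℓ data ls y) :
    ShieldedRun region ℓ data (ls.map Layer.gates).flatten y := by
  induction ls generalizing y with
  | nil => trivial
  | cons l ls ih =>
    rw [List.map_cons, List.flatten_cons, shieldedRun_append, Layer.runActs_gates]
    refine ⟨shieldedRun_of_pairwise l.pairwise_gates fun g hg => ?_, ih h.2⟩
    obtain ⟨q, rfl⟩ := Layer.mem_gates.1 hg
    exact h.1 q

theorem runLayers_relabel (e : Q ≃ Q') (ls : List (Layer n Q)) (y : Basis Q') :
    runLayers data (ls.map (Layer.relabel e)) y = runLayers data ls (y ∘ e) ∘ e.symm := by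
  induction ls generalizing y with
  | nil => funext q; simp [runLayers]
  | cons l ls ih =>
    rw [List.map_cons, runLayers, ih, Layer.act_relabel, runLayers]
    congr 2
    funext q
    simp

theorem Gate.Shielded.relabel (e : Q ≃ Q') {g : Gate n Q} {y : Basis Q'}
    (h : g.Shielded region ℓ (y ∘ e)) : (g.relabel e).Shielded (region ∘ e.symm) ℓ y := by
  rcases h with ⟨r, hr⟩ | ⟨c, u, v, rfl, h1, h2, h3⟩
  · exact Or.inl ⟨r, fun q hq => hr _ ((Gate.mem_support_relabel e g q).1 hq)⟩
  · exact Or.inr ⟨e c, e u, e v, rfl, by simpa, by simpa, by simpa using h3⟩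

theorem ShieldedLayers.relabel (e : Q ≃ Q') {ls : List (Layer n Q)} {y : Basis Q'}
    (h : ShieldedLayers region ℓ data ls (y ∘ e)) :
    ShieldedLayers (region ∘ e.symm) ℓ data (ls.map (Layer.relabel e)) y := by
  induction ls generalizing y with
  | nil => trivial
  | cons l ls ih =>
    refine ⟨fun q => (h.1 (e.symm q)).relabel e, ih ?_⟩
    rw [Layer.act_relabel]
    convert h.2 using 1
    funext q
    simp

end Transport

/-! ### The planar layout and the locality of all gates -/

/-- Locality of an operation on qubits that are placed at points of the lattice. -/
def Gate.IsPlaced {n : ℕ} {Q : Type} (pos : Q → ℤ × ℤ) : Gate n Q → Prop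
  | .cnot c t => GridAdj (pos c) (pos t)
  | .swap a b => GridAdj (pos a) (pos b)
  | .ccnot c d t => GridTriple (pos c) (pos d) (pos t)
  | .cswap c a b => GridTriple (pos c) (pos a) (pos b)
  | .load _ c t => GridAdj (pos c) (pos t)
  | _ => True

theorem gridAdj_of {p q : ℤ × ℤ} (h : (p.1 = q.1 ∧ (p.2 = q.2 + 1 ∨ q.2 = p.2 + 1)) ∨
    (p.2 = q.2 ∧ (p.1 = q.1 + 1 ∨ q.1 = p.1 + 1))) : GridAdj p q := by
  rw [GridAdj]
  rcases h with ⟨h1, h2 | h2⟩ | ⟨h1, h2 | h2⟩ <;> rw [h1, h2] <;> simp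

theorem GridAdj.ne {p q : ℤ × ℤ} (h : GridAdj p q) : p ≠ q := by
  rintro rfl
  simp [GridAdj] at h

namespace Qubit

variable {n L R : ℕ}

/-- The position in a folded cycle of length `m`. -/
def site (m s : ℕ) : ℕ := if 2 * s < m then 2 * s else 2 * (m - 1 - s) + 1

theorem site_injective {m s s' : ℕ} (hs : s < m) (hs' : s' < m) (h : site m s = site m s') :
    s = s' := by
  simp only [site] at h
  split_ifs at h <;> omega

/-- Folding lists the cycle as 0, m-1, 1, m-2, …, so both s, m-1-s and s, m-s are neighbours. -/
theorem site_reflectOdd {m s : ℕ} (h : s < m - (s + 1)) :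
    site m (m - (s + 1)) = site m s + 1 := by
  simp only [site]
  split_ifs <;> omega

theorem site_reflectEven {m s : ℕ} (h0 : s ≠ 0) (h : s < m - s) :
    site m s = site m (m - s) + 1 := by
  simp only [site]
  split_ifs <;> omega

/-- The point of the lattice at which a qubit is placed. -/
def pos : Qubit n L R → ℤ × ℤ
  -- Address qubit i lies above chain qubit i + 1, which it helps to compute; the chain ends next to
  -- rail place 0, with the output below its end.
  | addr i => (-n + i, 1)
  | chain i => (-n - 1 + i, 0)
  | out => (-1, -1)
  -- On a folded rail of length 2L the places s < L occupy the even columns, with flag s above and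
  -- ring s below; the odd columns below are free for the accumulators.
  | rail s => (site (2 * L) s, 0)
  | flag b => (2 * b, 1)
  | ring b i => (2 * b, -1 - site R i)
  | acc b i => (2 * b + 1, -1 - site R i)

theorem pos_injective : Function.Injective (pos : Qubit n L R → ℤ × ℤ) := by
  intro q q' h
  have hs : ∀ (m : ℕ) (s s' : Fin m), site m s = site m s' → s = s' := fun m s s' h =>
    Fin.ext (site_injective s.2 s'.2 h)
  cases q <;> cases q' <;> simp only [pos, Prod.mk.injEq, addr.injEq, chain.injEq, rail.injEq,
    flag.injEq, ring.injEq, acc.injEq, Fin.ext_iff, reduceCtorEq] at h ⊢ <;>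
    first | omega | exact h.2.elim | skip
  case rail.rail s s' => exact congrArg Fin.val (hs _ s s' (by omega))
  case ring.ring b i b' i' => exact ⟨by omega, congrArg Fin.val (hs _ i i' (by omega))⟩
  case acc.acc b i b' i' => exact ⟨by omega, congrArg Fin.val (hs _ i i' (by omega))⟩

/-- The leaf to which a qubit belongs. -/
def region : Qubit n L R → Option (Fin L)
  | ring b _ => some b
  | acc b _ => some b
  | _ => none

/-- All qubits on which the operation acts belong to the same leaf, or all of them to none. -/
def IsUniform (g : Gate n (Qubit n L R)) : Prop := ∃ r, ∀ q ∈ g.support, region q = r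

variable [NeZero R]

/-- The properties of all operations of the circuit. -/
structure GateOK (g : Gate n (Qubit n L R)) : Prop where
  isReversible : g.IsReversible
  isPlaced : g.IsPlaced pos
  uniform_or : IsUniform g ∨ ∃ b, g = routeGate b

/-- The properties of all time steps of the circuit but the one that sets the flags. -/
structure LayerOK (l : Layer n (Qubit n L R)) : Prop where
  gateOK : ∀ q, GateOK (l.gateAt q)
  act_flag : ∀ data y b, l.act data y (flag b) = y (flag b)

theorem gateOK_idle (q : Qubit n L R) : GateOK (.idle q : Gate n (Qubit n L R)) :=
  ⟨trivial, trivial, Or.inl ⟨region q, by simp [Gate.support]⟩⟩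

theorem gateOK_swap {q q' : Qubit n L R} (h : GridAdj (pos q) (pos q'))
    (h' : region q = region q') : GateOK (.swap q q' : Gate n (Qubit n L R)) :=
  ⟨trivial, h, Or.inl ⟨region q, by simp [Gate.support, h']⟩⟩

theorem layerOK_single {g : Gate n (Qubit n L R)} (hg : GateOK g)
    (hf : ∀ b, flag b ∉ g.support) : LayerOK (Layer.single g) where
  gateOK q := by
    simp only [Layer.single]
    split_ifs
    · exact hg
    · exact gateOK_idle q
  act_flag data y b := by rw [Layer.act_single, Gate.act_of_notMem data g y (hf b)]

theorem gateOK_swaps {π : Qubit n L R → Qubit n L R} {key : Qubit n L R → ℕ}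
    {hπ : ∀ q, π (π q) = q} {hkey : ∀ q, key q = key (π q) → π q = q}
    (h : ∀ q, key q < key (π q) → GridAdj (pos q) (pos (π q)) ∧ region q = region (π q)) (q) :
    GateOK ((Layer.swaps (n := n) π key hπ hkey).gateAt q) := by
  simp only [Layer.swaps]
  split_ifs with h1 h2
  · exact gateOK_swap (h q h1).1 (h q h1).2
  · have := h (π q)
    rw [hπ] at this
    exact gateOK_swap (this h2).1 (this h2).2
  · exact gateOK_idle q

theorem layerOK_reflectOdd : LayerOK (reflectOddLayer : Layer n (Qubit n L R)) where
  gateOK := by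
    refine gateOK_swaps ?_
    rintro (_ | _ | _ | s | _ | ⟨b, i⟩ | _) h <;>
      simp only [reflectOdd, key, Fin.val_rev, lt_self_iff_false] at h ⊢
    · refine ⟨gridAdj_of (Or.inr ⟨rfl, ?_⟩), rfl⟩
      have := site_reflectOdd h
      simp only [pos, Fin.val_rev]
      omega
    · refine ⟨gridAdj_of (Or.inl ⟨rfl, ?_⟩), rfl⟩
      have := site_reflectOdd h
      simp only [pos, Fin.val_rev]
      omega
  act_flag data y b := by rw [reflectOddLayer, Layer.act_swaps]; rfl

theorem layerOK_reflectEven : LayerOK (reflectEvenLayer : Layer n (Qubit n L R)) where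
  gateOK := by
    refine gateOK_swaps ?_
    rintro (_ | _ | _ | s | _ | ⟨b, i⟩ | _) h <;>
      simp only [reflectEven, key, lt_self_iff_false] at h ⊢
    · refine ⟨gridAdj_of (Or.inr ⟨rfl, ?_⟩), rfl⟩
      simp only [pos]
      split_ifs at h ⊢ with h0
      · omega
      · have := site_reflectEven h0 h
        omega
    · refine ⟨gridAdj_of (Or.inl ⟨rfl, ?_⟩), rfl⟩
      simp only [pos]
      split_ifs at h ⊢ with h0
      · omega
      · have := site_reflectEven h0 h
        omega
  act_flag data y b := by rw [reflectEvenLayer, Layer.act_swaps]; rfl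

theorem layerOK_stash : LayerOK (stashLayer : Layer n (Qubit n L R)) where
  gateOK := by
    refine gateOK_swaps ?_
    rintro (_ | _ | _ | _ | _ | ⟨b, i⟩ | ⟨b, i⟩) h <;>
      simp only [stashMap, key, lt_self_iff_false] at h ⊢
    · exact ⟨gridAdj_of (by simp [pos]), rfl⟩
    · exact ⟨gridAdj_of (by simp [pos]), rfl⟩
  act_flag data y b := by rw [stashLayer, Layer.act_swaps]; rfl

theorem gateOK_dock (q : Qubit n L R) :
    GateOK ((dockLayer : Layer n (Qubit n L R)).gateAt q) := by
  refine gateOK_swaps ?_ q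
  rintro (_ | _ | _ | s | b | _ | _) h <;>
    simp only [dockMap, key, lt_self_iff_false] at h ⊢
  · split_ifs at h ⊢ with h'
    · refine ⟨gridAdj_of ?_, rfl⟩
      simp only [pos, site]
      split_ifs <;> omega
    · simp at h
  · omega

/-- This layer changes the flags, so `LayerOK` fails for it; but it acts on shared qubits or idles,
and is shielded whatever the flags are. -/
theorem isUniform_dock (q : Qubit n L R) :
    IsUniform ((dockLayer : Layer n (Qubit n L R)).gateAt q) := by
  rcases (gateOK_dock (n := n) q).uniform_or with h | ⟨b, h⟩
  · exact h
  · simp only [dockLayer, Layer.swaps, routeGate] at h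
    split_ifs at h

theorem layerOK_route : LayerOK (routeLayer : Layer n (Qubit n L R)) where
  gateOK := by
    have h : ∀ b, GateOK (routeGate b : Gate n (Qubit n L R)) := by
      intro b
      have h1 : site (2 * L) b = 2 * b := by
        rw [site, if_pos (by omega)]
      have h2 : site R 0 = 0 := by
        have := NeZero.pos R
        rw [site, if_pos (by omega), mul_zero]
      have a1 : GridAdj (pos (flag b : Qubit n L R)) (pos (rail ⟨b, by omega⟩ : Qubit n L R)) :=
        gridAdj_of (by simp [pos, h1])
      have a2 : GridAdj (pos (rail ⟨b, by omega⟩ : Qubit n L R)) (pos (ring b 0 : Qubit n L R)) :=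
        gridAdj_of (by simp [pos, h1, h2])
      exact ⟨by simp [Gate.IsReversible, routeGate],
        ⟨a1.ne, a2.ne, by simp [pos, h2], Or.inl ⟨a1, a2⟩⟩, Or.inr ⟨b, rfl⟩⟩
    rintro (_ | _ | _ | s | b | ⟨b, i⟩ | _)
    · exact gateOK_idle _
    · exact gateOK_idle _
    · exact gateOK_idle _
    · simp only [routeLayer]
      split_ifs
      · exact h _
      · exact gateOK_idle _
    · exact h b
    · simp only [routeLayer]
      split_ifs
      · exact h _
      · exact gateOK_idle _
    · exact gateOK_idle _
  act_flag data y b := by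
    simp only [Layer.act, routeLayer, routeGate, Gate.act]
    split_ifs
    · rw [Function.comp_apply, Equiv.swap_apply_of_ne_of_ne (by simp) (by simp)]
    · rfl

theorem layerOK_load (cell : ℕ → ℕ → Option (Fin n → Bool)) :
    LayerOK (loadLayer cell : Layer n (Qubit n L R)) where
  gateOK := by
    have h : ∀ x b i, GateOK (.load x (ring b i) (acc b i) : Gate n (Qubit n L R)) := fun x b i =>
      ⟨by simp [Gate.IsReversible], gridAdj_of (by simp [pos]),
        Or.inl ⟨some b, by simp [Gate.support, region]⟩⟩
    rintro (_ | _ | _ | _ | _ | ⟨b, i⟩ | ⟨b, i⟩)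
    · exact gateOK_idle _
    · exact gateOK_idle _
    · exact gateOK_idle _
    · exact gateOK_idle _
    · exact gateOK_idle _
    · simp only [loadLayer]
      cases cell b i
      · exact gateOK_idle _
      · exact h _ _ _
    · simp only [loadLayer]
      cases cell b i
      · exact gateOK_idle _
      · exact h _ _ _
  act_flag data y b := rfl

theorem layerOK_compareBits {pat : Fin n → Option Bool} {j : ℕ} {l : Layer n (Qubit n L R)}
    (hl : l ∈ compareBits pat j) : LayerOK l := by
  rcases mem_compareBits hl with rfl | ⟨i, rfl | rfl⟩
  · exact layerOK_single ⟨trivial, trivial, Or.inl ⟨none, by simp [Gate.support, region]⟩⟩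
      (by simp [Gate.support])
  · have a1 : GridAdj (pos (chain i.castSucc : Qubit n L R)) (pos (chain i.succ : Qubit n L R)) :=
      gridAdj_of (by simp [pos]; omega)
    exact layerOK_single ⟨fun h => a1.ne (by rw [h]), a1,
      Or.inl ⟨none, by simp [Gate.support, region]⟩⟩ (by simp [Gate.support])
  · have a1 : GridAdj (pos (chain i.castSucc : Qubit n L R)) (pos (chain i.succ : Qubit n L R)) :=
      gridAdj_of (by simp [pos]; omega)
    have a2 : GridAdj (pos (chain i.succ : Qubit n L R)) (pos (addr i : Qubit n L R)) :=
      gridAdj_of (by simp [pos])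
    exact layerOK_single ⟨⟨fun h => a1.ne (by rw [h]), by simp⟩,
      ⟨by simp [pos], a2.ne.symm, a1.ne, Or.inr (Or.inr ⟨a1, a2⟩)⟩,
      Or.inl ⟨none, by simp [Gate.support, region]⟩⟩ (by simp [Gate.support])

theorem forall_mem_conjLayers {Q : Type} [DecidableEq Q] {P : Layer n Q → Prop}
    {U M : List (Layer n Q)}
    (hU : ∀ l ∈ U, P l) (hM : ∀ l ∈ M, P l) : ∀ l ∈ conjLayers U M, P l := by
  intro l hl
  simp only [conjLayers, List.mem_append, List.mem_reverse] at hl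
  rcases hl with (hl | hl) | hl
  · exact hU l hl
  · exact hM l hl
  · exact hU l hl

variable [NeZero L]

theorem layerOK_emit (pat : Fin n → Option Bool) :
    ∀ l ∈ (emit pat : List (Layer n (Qubit n L R))), LayerOK l := by
  refine forall_mem_conjLayers (fun l hl => layerOK_compareBits hl) ?_
  intro l hl
  rw [List.mem_singleton] at hl
  subst hl
  refine layerOK_single ⟨by simp [Gate.IsReversible], gridAdj_of ?_,
    Or.inl ⟨none, by simp [Gate.support, region]⟩⟩ (by simp [Gate.support])
  have := NeZero.pos L
  simp [pos, site, this]
  omega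

theorem layerOK_collect (pat : Fin n → Option Bool) :
    ∀ l ∈ (collect pat : List (Layer n (Qubit n L R))), LayerOK l := by
  refine forall_mem_conjLayers (fun l hl => layerOK_compareBits hl) ?_
  intro l hl
  rw [List.mem_singleton] at hl
  subst hl
  have hL := NeZero.pos L
  have a1 : GridAdj (pos (rail ⟨0, by omega⟩ : Qubit n L R)) (pos (chain (Fin.last n) :
      Qubit n L R)) := gridAdj_of (by simp [pos, site, hL]; omega)
  have a2 : GridAdj (pos (chain (Fin.last n) : Qubit n L R)) (pos (out : Qubit n L R)) :=
    gridAdj_of (by simp [pos]; omega)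
  exact layerOK_single ⟨by simp [Gate.IsReversible],
    ⟨a1.ne.symm, by simp [pos], a2.ne, Or.inr (Or.inl ⟨a1, a2⟩)⟩,
    Or.inl ⟨none, by simp [Gate.support, region]⟩⟩ (by simp [Gate.support])

omit [NeZero L] in
theorem layerOK_rotate : ∀ l ∈ (rotate : List (Layer n (Qubit n L R))), LayerOK l := by
  simp only [rotate, List.mem_cons, List.not_mem_nil, or_false, forall_eq_or_imp, forall_eq]
  exact ⟨layerOK_reflectOdd, layerOK_reflectEven⟩

namespace Addressing

variable {H : ℕ} (D : Addressing n L R H)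

theorem layerOK_raiseFlag : ∀ l ∈ D.raiseFlag, LayerOK l := by
  intro l hl
  simp only [raiseFlag, List.mem_flatMap, List.mem_append] at hl
  obtain ⟨t, -, hl | hl⟩ := hl
  · exact layerOK_rotate l hl
  · exact layerOK_emit _ l hl

theorem layerOK_loadAll : ∀ l ∈ D.loadAll, LayerOK l := by
  intro l hl
  simp only [loadAll, loadTick, emissions, List.mem_flatMap, List.mem_append, List.mem_cons,
    List.not_mem_nil, or_false] at hl
  rcases hl with ⟨t, -, (hl | hl | hl) | rfl | rfl⟩ | rfl
  · exact layerOK_rotate l hl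
  · split_ifs at hl
    · exact layerOK_emit _ l hl
    · simp at hl
  · split_ifs at hl
    · exact layerOK_emit _ l hl
    · simp at hl
  · exact layerOK_route
  · exact layerOK_load _
  · exact layerOK_stash

theorem layerOK_collectAll : ∀ l ∈ D.collectAll, LayerOK l := by
  intro l hl
  simp only [collectAll, collectTick, List.mem_flatMap, List.mem_append, List.mem_cons,
    List.not_mem_nil, or_false] at hl
  obtain ⟨t, -, (hl | hl) | rfl⟩ := hl
  · exact layerOK_rotate l hl
  · exact layerOK_collect _ l hl
  · exact layerOK_route

theorem gateOK_program : ∀ l ∈ D.program, ∀ q, GateOK (l.gateAt q) := by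
  refine forall_mem_conjLayers ?_ fun l hl => (D.layerOK_collectAll l hl).gateOK
  intro l hl
  simp only [List.mem_append, List.mem_singleton] at hl
  rcases hl with (hl | rfl) | hl
  · exact (D.layerOK_raiseFlag l hl).gateOK
  · exact gateOK_dock
  · exact (D.layerOK_loadAll l hl).gateOK

variable (data : (Fin n → Bool) → Bool) (a : Fin n → Bool) (o : Bool)

omit [NeZero L] [NeZero R] in
theorem run_dock_raised : dockLayer.act data (st a o (fun s => decide (s = D.b a))
    (fun _ => false) (fun _ _ => false) fun _ _ => false) =
    D.cycleState a o (fun _ => false) fun _ _ => false := by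
  have hb := D.b_lt a
  rw [run_dock]
  refine cfg_congr (fun _ _ => rfl) rfl (fun s hs => ?_) (fun b hb => rfl)
    (fun b' hb' i hi => ?_) fun _ _ _ _ => rfl
  · simp only [railOf, ite_self]
    split_ifs
    · rfl
    · simp only [decide_eq_false_iff_not]
      omega
  · simp [ringOf]

theorem run_prepare : runLayers data (D.raiseFlag ++ [dockLayer] ++ D.loadAll)
    (st a o (fun _ => false) (fun _ => false) (fun _ _ => false) fun _ _ => false) =
    D.cycleState a o (D.loaded data a) fun _ _ => false := by
  rw [runLayers_append, runLayers_append, run_raiseFlag]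
  simp only [runLayers]
  rw [run_dock_raised, run_loadAll]

theorem run_program : runLayers data D.program
    (st a o (fun _ => false) (fun _ => false) (fun _ _ => false) fun _ _ => false) =
    st a (xor o (data a)) (fun _ => false) (fun _ => false) (fun _ _ => false)
      fun _ _ => false := by
  refine runLayers_conj data ?_ (D.run_prepare data a o) (D.run_collectAll data a o)
    (D.run_prepare data a _)
  intro l hl q
  exact (D.gateOK_program l (List.mem_append_left _ (List.mem_append_left _ hl)) q).isReversible

omit [NeZero L] in
-- Only routing gates connect a leaf with the outside, under the control of flags that these layers
-- preserve.
theorem shieldedLayers_of_flag {ls : List (Layer n (Qubit n L R))} (h : ∀ l ∈ ls, LayerOK l)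
    {y : Basis (Qubit n L R)} {ℓ : Fin L} (hy : ∀ b, y (flag b) = true → b = ℓ) :
    ShieldedLayers region ℓ data ls y := by
  induction ls generalizing y with
  | nil => trivial
  | cons l ls ih =>
    simp only [List.mem_cons, forall_eq_or_imp] at h
    refine ⟨fun q => ?_, ih h.2 fun b hb => hy b (by rwa [h.1.act_flag] at hb)⟩
    rcases (h.1.gateOK q).uniform_or with h' | ⟨b, h'⟩
    · exact Or.inl h'
    · refine Or.inr ⟨_, _, _, h', rfl, rfl, fun hb => ?_⟩
      rw [hy b hb]
      rfl

theorem shieldedLayers_program : ShieldedLayers region ⟨D.b a, D.b_lt a⟩ data D.program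
    (st a o (fun _ => false) (fun _ => false) (fun _ _ => false) fun _ _ => false) := by
  have hdock : ∀ y : Basis (Qubit n L R),
      ShieldedLayers region ⟨D.b a, D.b_lt a⟩ data [dockLayer] y := fun y =>
    ⟨fun q => Or.inl (isUniform_dock q), trivial⟩
  have hcyc : ∀ (o : Bool) (c : ℕ → Bool) (A : ℕ → ℕ → Bool) (b : Fin L),
      (D.cycleState a o c A : Basis (Qubit n L R))
      (flag b) = true → b = ⟨D.b a, D.b_lt a⟩ := by
    intro o c A b hb
    exact Fin.ext (by simpa [cfg] using hb)
  have hrl : ∀ l ∈ D.loadAll.reverse, LayerOK l := fun l hl =>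
    D.layerOK_loadAll l (List.mem_reverse.1 hl)
  have hrr : ∀ l ∈ D.raiseFlag.reverse, LayerOK l := fun l hl =>
    D.layerOK_raiseFlag l (List.mem_reverse.1 hl)
  have h1 := D.run_loadAll data a (xor o (data a))
  have h2 : runLayers data D.loadAll.reverse (D.cycleState a (xor o (data a)) (D.loaded data a)
      fun _ _ => false) = D.cycleState a (xor o (data a)) (fun _ => false) fun _ _ => false := by
    rw [← h1, runLayers_reverse data fun l hl q => ((D.layerOK_loadAll l hl).gateOK q).isReversible]
  have h3 : dockLayer.act data (D.cycleState a (xor o (data a)) (fun _ => false)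
      fun _ _ => false) = (st a (xor o (data a)) (fun s => decide (s = D.b a))
      (fun _ => false) (fun _ _ => false) fun _ _ => false : Basis (Qubit n L R)) := by
    rw [← run_dock_raised, Layer.act_act data _ fun q => (gateOK_dock q).isReversible]
  -- The program is cut at the two docks: outside of them no flag is up, and between them only that
  -- of the requested leaf.
  rw [program, conjLayers, shieldedLayers_append, shieldedLayers_append,
    runLayers_append data _ D.collectAll, run_prepare, run_collectAll]
  simp only [List.reverse_append, List.reverse_cons, List.reverse_nil, List.nil_append,
    shieldedLayers_append, h2, run_raiseFlag, runLayers, runLayers_append]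
  rw [run_dock_raised, h3]
  refine ⟨⟨⟨⟨?_, hdock _⟩, ?_⟩, ?_⟩, ?_, hdock _, ?_⟩
  · exact shieldedLayers_of_flag data D.layerOK_raiseFlag (by simp [cfg])
  · exact shieldedLayers_of_flag data D.layerOK_loadAll (hcyc _ _ _)
  · exact shieldedLayers_of_flag data D.layerOK_collectAll (hcyc _ _ _)
  · exact shieldedLayers_of_flag data hrl (hcyc _ _ _)
  · exact shieldedLayers_of_flag data hrr (by simp [cfg])

end Addressing

end Qubit

end QLookup

/-! ### Number of time steps and T count -/

namespace QLookup

theorem sum_map_flatMap_range_le {α : Type*} (f : α → ℕ) (tick : ℕ → List α) {T c : ℕ}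
    (h : ∀ t < T, ((tick t).map f).sum ≤ c) :
    (((List.range T).flatMap tick).map f).sum ≤ T * c := by
  induction T with
  | zero => simp
  | succ T ih =>
    have h1 := ih fun t ht => h t (by omega)
    have h2 := h T (by omega)
    rw [List.range_succ, List.flatMap_append, List.map_append, List.sum_append, add_mul, one_mul]
    simpa using add_le_add h1 h2

theorem sum_map_conjLayers {n : ℕ} {Q : Type} [DecidableEq Q] (f : Layer n Q → ℕ)
    (U M : List (Layer n Q)) :
    ((conjLayers U M).map f).sum = 2 * (U.map f).sum + (M.map f).sum := by
  simp only [conjLayers, List.map_append, List.sum_append, List.map_reverse, List.sum_reverse]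
  ring

namespace Qubit

variable {n L R : ℕ} [NeZero R]

/-- Bounds for the cost of all time steps that occur in the circuit. -/
structure CostBound (f : Layer n (Qubit n L R) → ℕ) (α β γ : ℕ) : Prop where
  single : ∀ g, f (.single g) ≤ α
  reflectOdd : f reflectOddLayer ≤ β
  reflectEven : f reflectEvenLayer ≤ β
  dock : f dockLayer ≤ β
  stash : f stashLayer ≤ β
  load : ∀ cell, f (loadLayer cell) ≤ β
  route : f routeLayer ≤ γ

namespace CostBound

variable {f : Layer n (Qubit n L R) → ℕ} {α β γ : ℕ} (hf : CostBound f α β γ)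
include hf

theorem rotate : ((rotate : List (Layer n (Qubit n L R))).map f).sum ≤ 2 * β := by
  have h1 := hf.reflectOdd
  have h2 := hf.reflectEven
  simp only [Qubit.rotate, List.map_cons, List.map_nil, List.sum_cons, List.sum_nil]
  omega

theorem compareBits (pat : Fin n → Option Bool) (j : ℕ) :
    ((compareBits pat j : List (Layer n (Qubit n L R))).map f).sum ≤ (2 * j + 1) * α := by
  induction j with
  | zero => simpa [Qubit.compareBits] using hf.single _
  | succ j ih =>
    have h : ((if h : j < n then compareBit pat ⟨j, h⟩ else [] :
        List (Layer n (Qubit n L R))).map f).sum ≤ 2 * α := by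
      split_ifs with h
      · have h1 := hf.single (.cnot (chain (Fin.castSucc ⟨j, h⟩)) (chain (Fin.succ ⟨j, h⟩)))
        have h2 := hf.single
          (.ccnot (chain (Fin.castSucc ⟨j, h⟩)) (addr ⟨j, h⟩) (chain (Fin.succ ⟨j, h⟩)))
        rw [compareBit]
        split <;> simp only [List.map_cons, List.map_nil, List.sum_cons, List.sum_nil] <;> omega
      · simp
    rw [Qubit.compareBits, List.map_append, List.sum_append]
    calc _ ≤ (2 * j + 1) * α + 2 * α := add_le_add ih h
      _ = _ := by ring

variable [NeZero L]

theorem emit (pat : Fin n → Option Bool) :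
    ((emit pat : List (Layer n (Qubit n L R))).map f).sum ≤ (4 * n + 3) * α := by
  rw [Qubit.emit, sum_map_conjLayers]
  have h1 := hf.compareBits pat n
  have h2 := hf.single (.cnot (chain (Fin.last n)) (rail ⟨0, by have := NeZero.pos L; omega⟩))
  simp only [List.map_cons, List.map_nil, List.sum_cons, List.sum_nil]
  calc _ ≤ 2 * ((2 * n + 1) * α) + (α + 0) := by gcongr
    _ = _ := by ring

theorem collect (pat : Fin n → Option Bool) :
    ((collect pat : List (Layer n (Qubit n L R))).map f).sum ≤ (4 * n + 3) * α := by
  rw [Qubit.collect, sum_map_conjLayers]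
  have h1 := hf.compareBits pat n
  have h2 := hf.single
    (.ccnot (chain (Fin.last n)) (rail ⟨0, by have := NeZero.pos L; omega⟩) out)
  simp only [List.map_cons, List.map_nil, List.sum_cons, List.sum_nil]
  calc _ ≤ 2 * ((2 * n + 1) * α) + (α + 0) := by gcongr
    _ = _ := by ring

/-- The cost of the circuit. -/
theorem program {H : ℕ} (D : Addressing n L R H) : (D.program.map f).sum ≤
    (2 * L + 2 * (H + (2 * L + R)) + (2 * L + R)) *
      (2 * ((4 * n + 3) * α) + 3 * β + γ) + 4 * β := by
  -- This bounds a tick of each of the three loops; the loading tick, with two emissions, two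
  -- reflections, a load and a routing layer, is the most expensive.
  set τ := 2 * ((4 * n + 3) * α) + 3 * β + γ with hτ
  have hrot := hf.rotate
  have hraise : (D.raiseFlag.map f).sum ≤ L * τ := by
    refine sum_map_flatMap_range_le f _ fun t _ => ?_
    have := hf.emit (D.patB (L - 1 - t))
    rw [List.map_append, List.sum_append]
    omega
  have hload : (D.loadAll.map f).sum ≤ (H + (2 * L + R)) * τ + β := by
    rw [Addressing.loadAll, List.map_append, List.sum_append]
    refine add_le_add (sum_map_flatMap_range_le f _ fun t _ => ?_) (by simpa using hf.stash)
    have h1 : (((if t < H then Qubit.emit (D.patH t) else [] :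
        List (Layer n (Qubit n L R)))).map f).sum ≤ (4 * n + 3) * α := by
      split_ifs
      · exact hf.emit _
      · simp
    have h2 : (((if 2 * L + R ≤ t ∧ t < H + (2 * L + R) then
        Qubit.emit (D.patH (t - (2 * L + R))) else [] :
        List (Layer n (Qubit n L R)))).map f).sum ≤ (4 * n + 3) * α := by
      split_ifs
      · exact hf.emit _
      · simp
    have h3 := hf.route
    have h4 := hf.load (D.cells t)
    simp only [Addressing.loadTick, Addressing.emissions, List.map_append, List.sum_append,
      List.map_cons, List.map_nil, List.sum_cons, List.sum_nil]
    omega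
  have hcollect : (D.collectAll.map f).sum ≤ (2 * L + R) * τ := by
    refine sum_map_flatMap_range_le f _ fun t _ => ?_
    have h1 := hf.collect (D.patL ((2 * L + R - 1 - t) % R))
    have h2 := hf.route
    simp only [Addressing.collectTick, List.map_append, List.sum_append,
      List.map_cons, List.map_nil, List.sum_cons, List.sum_nil]
    omega
  have hdock := hf.dock
  rw [Addressing.program, sum_map_conjLayers]
  simp only [List.map_append, List.sum_append, List.map_cons, List.map_nil, List.sum_cons,
    List.sum_nil]
  calc _ ≤ 2 * (L * τ + (β + 0) + ((H + (2 * L + R)) * τ + β)) + (2 * L + R) * τ := by gcongr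
    _ = _ := by ring

end CostBound

theorem length_program_le [NeZero L] {H : ℕ} (D : Addressing n L R H) : D.program.length ≤
    (2 * L + 2 * (H + (2 * L + R)) + (2 * L + R)) * (8 * n + 10) + 4 := by
  have h : CostBound (fun _ : Layer n (Qubit n L R) => 1) 1 1 1 := by constructor <;> simp
  have := h.program D
  simp only [List.map_const', List.sum_replicate, smul_eq_mul, mul_one] at this
  refine this.trans (le_of_eq ?_)
  ring

end Qubit

section TCount

theorem Gate.tCost_le {n : ℕ} {Q : Type} (g : Gate n Q) : g.tCost ≤ 7 := by
  cases g <;> simp [Gate.tCost]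

variable {n : ℕ} {Q Q' : Type} [DecidableEq Q]

theorem Gate.support_nonempty (g : Gate n Q) : g.support.Nonempty := by
  cases g <;> simp [Gate.support]

theorem Layer.tCost_swaps (π : Q → Q) (key : Q → ℕ) (hπ : ∀ q, π (π q) = q)
    (hkey : ∀ q, key q = key (π q) → π q = q) (q : Q) :
    ((Layer.swaps (n := n) π key hπ hkey).gateAt q).tCost = 0 := by
  simp only [Layer.swaps]
  split_ifs <;> rfl

variable [DecidableEq Q'] [Fintype Q] [Fintype Q']

theorem Layer.tCost_relabel_le (e : Q ≃ Q') (l : Layer n Q) (bound : Q → ℕ)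
    (h : ∀ q, ∃ r, l.gateAt r = l.gateAt q ∧ (l.gateAt q).tCost ≤ bound r) :
    ((l.relabel e).gates.map Gate.tCost).sum ≤ ∑ q, bound q := by
  rw [← Equiv.sum_comp e.symm]
  refine Layer.sum_gates_le _ _ _ (fun _ => Nat.zero_le _) fun q => ?_
  obtain ⟨r, h1, h2⟩ := h (e.symm q)
  refine ⟨e r, ?_, ?_⟩
  · simp only [Layer.relabel, Equiv.symm_apply_apply, h1]
  · simpa [Layer.relabel, Gate.tCost_relabel] using h2

theorem Layer.tCost_relabel_eq_zero (e : Q ≃ Q') (l : Layer n Q)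
    (h : ∀ q, (l.gateAt q).tCost = 0) : ((l.relabel e).gates.map Gate.tCost).sum ≤ 0 :=
  (l.tCost_relabel_le e (fun _ => 0) fun q => ⟨q, rfl, (h q).le⟩).trans (by simp)

theorem Layer.tCost_relabel_single_le (e : Q ≃ Q') (g : Gate n Q) :
    (((Layer.single g).relabel e).gates.map Gate.tCost).sum ≤ 7 := by
  obtain ⟨r, hr⟩ := g.support_nonempty
  refine ((Layer.single g).tCost_relabel_le e (fun q => if q = r then 7 else 0)
    fun q => ?_).trans (by simp)
  by_cases hq : q ∈ g.support
  · exact ⟨r, by simp [Layer.single, hr, hq], by simpa [Layer.single, hq] using g.tCost_le⟩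
  · exact ⟨q, rfl, by simp [Layer.single, hq, Gate.tCost]⟩

/-- Swaps and loads are free of T gates. The LR leaf qubits cost nothing but the one controlled swap
per leaf at the entrance of its ring. -/
theorem Qubit.costBound_tCost {L R : ℕ} [NeZero L] [NeZero R] (e : Qubit n L R ≃ Q') :
    CostBound (fun l : Layer n (Qubit n L R) => ((l.relabel e).gates.map Gate.tCost).sum)
      7 0 (7 * L) where
  single := Layer.tCost_relabel_single_le e
  reflectOdd := Layer.tCost_relabel_eq_zero e _ (Layer.tCost_swaps _ _ _ _)
  reflectEven := Layer.tCost_relabel_eq_zero e _ (Layer.tCost_swaps _ _ _ _)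
  dock := Layer.tCost_relabel_eq_zero e _ (Layer.tCost_swaps _ _ _ _)
  stash := Layer.tCost_relabel_eq_zero e _ (Layer.tCost_swaps _ _ _ _)
  load cell := by
    refine Layer.tCost_relabel_eq_zero e _ ?_
    rintro (_ | _ | _ | _ | _ | ⟨b, i⟩ | ⟨b, i⟩) <;> try rfl
    · simp only [loadLayer]
      cases cell b i <;> rfl
    · simp only [loadLayer]
      cases cell b i <;> rfl
  route := by
    refine (Layer.tCost_relabel_le e _
      (fun q => if q ∈ Finset.univ.image flag then 7 else 0) ?_).trans ?_
    · rintro (_ | _ | _ | s | b | ⟨b, i⟩ | _) <;> try exact ⟨_, rfl, Nat.zero_le _⟩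
      · by_cases h : s.val < L
        · exact ⟨flag ⟨s, h⟩, by simp [routeLayer, h], by simp [Gate.tCost_le]⟩
        · exact ⟨_, rfl, by simp [routeLayer, h, Gate.tCost]⟩
      · exact ⟨flag b, rfl, by simp [Gate.tCost_le]⟩
      · by_cases h : i = 0
        · exact ⟨flag b, by simp [routeLayer, h], by simp [Gate.tCost_le]⟩
        · exact ⟨_, rfl, by simp [routeLayer, h, Gate.tCost]⟩
    · rw [Finset.sum_ite_mem, Finset.univ_inter, Finset.sum_const, smul_eq_mul, mul_comm]
      refine Nat.mul_le_mul_left 7 (Finset.card_image_le.trans ?_)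
      simp

end TCount

/-- The circuit permutes basis states, so amplitudes are merely transported; injectivity ensures
that no other state is sent to the support of the answer. -/
theorem LookupScheme.isLookup_of_runActs {n : ℕ} (S : LookupScheme n)
    (hrev : ∀ g ∈ S.ops, g.IsReversible)
    (hrun : ∀ data a, runActs data S.ops (S.config (a, false)) = S.config (a, data a)) :
    S.IsLookup := by
  intro data ψ
  have hbij := runActs_bijective data hrev
  have hkey : ∀ y, S.withAncillas (answer data ψ) (runActs data S.ops y) =
      S.withAncillas (query ψ) y := by
    intro y
    by_cases hy : ∃ a, y = S.config (a, false)
    · obtain ⟨a, rfl⟩ := hy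
      rw [hrun, withAncillas_config, withAncillas_config]
      simp [answer, query]
    · rw [S.withAncillas_eq_zero, S.withAncillas_eq_zero]
      · rintro ⟨a, v⟩ hv rfl
        cases v
        · exact hy ⟨a, rfl⟩
        · simp [query] at hv
      · rintro ⟨a, v⟩ hv h
        have hv' : v = data a := by
          by_contra h'
          simp [answer, h'] at hv
        rw [hv', ← hrun] at h
        exact hy ⟨a, hbij.1 h⟩
  ext z z'
  obtain ⟨y, rfl⟩ := hbij.2 z
  obtain ⟨y', rfl⟩ := hbij.2 z'
  rw [idealRun_apply data hrev]
  simp only [pureState, Matrix.vecMulVec_apply, Pi.star_apply, hkey]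

/-! ### The scheme on the lattice -/

namespace Qubit

variable {n L R : ℕ}

/-- The lattice points that carry qubits. -/
def sites (n L R : ℕ) : Finset (ℤ × ℤ) :=
  Finset.univ.map ⟨(pos : Qubit n L R → ℤ × ℤ), pos_injective⟩

/-- The qubits correspond to the lattice points. -/
def placement : Qubit n L R ≃ sites n L R :=
  Equiv.ofBijective (fun q => ⟨pos q, Finset.mem_map.2 ⟨q, Finset.mem_univ q, rfl⟩⟩)
    ⟨fun _ _ h => pos_injective (congrArg Subtype.val h), fun ⟨p, hp⟩ => by
      obtain ⟨q, -, rfl⟩ := Finset.mem_map.1 hp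
      exact ⟨q, rfl⟩⟩

/-- The scheme with the given time steps. -/
abbrev scheme (ls : List (Layer n (Qubit n L R))) : LookupScheme n where
  sites := sites n L R
  addr i := placement (addr i)
  out := placement out
  addr_injective i j h := by simpa using h
  out_ne_addr i h := by simp at h
  steps := (ls.map (Layer.relabel placement)).map Layer.gates
  disjoint_in_step st hst := by
    obtain ⟨l, -, rfl⟩ := List.mem_map.1 hst
    exact l.pairwise_gates
  covered_in_step st hst q := by
    obtain ⟨l, -, rfl⟩ := List.mem_map.1 hst
    exact ⟨l.gateAt q, Layer.mem_gates.2 ⟨q, rfl⟩, l.mem_support q⟩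

theorem mem_ops_scheme {ls : List (Layer n (Qubit n L R))} {g : Gate n (sites n L R)} :
    g ∈ (scheme ls).ops ↔ ∃ l ∈ ls, ∃ q, (l.gateAt q).relabel placement = g := by
  simp only [LookupScheme.ops, scheme, List.mem_flatten, List.mem_map, exists_exists_and_eq_and,
    Layer.mem_gates, Layer.relabel]
  constructor
  · rintro ⟨l, hl, q, rfl⟩
    exact ⟨l, hl, placement.symm q, rfl⟩
  · rintro ⟨l, hl, q, rfl⟩
    exact ⟨l, hl, placement q, by simp⟩

theorem isPlanarLocal_scheme {ls : List (Layer n (Qubit n L R))}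
    (h : ∀ l ∈ ls, ∀ q, (l.gateAt q).IsPlaced pos) : (scheme ls).IsPlanarLocal := by
  intro g hg
  obtain ⟨l, hl, q, rfl⟩ := mem_ops_scheme.1 hg
  have := h l hl q
  revert this
  cases l.gateAt q <;> exact id

theorem config_scheme (ls : List (Layer n (Qubit n L R))) (a : Fin n → Bool) (o : Bool) :
    (scheme ls).config (a, o) = cfg a (fun _ => false) o (fun _ => false) (fun _ => false)
      (fun _ _ => false) (fun _ _ => false) ∘ placement.symm := by
  refine (scheme ls).eq_of_readout_eq ?_ fun q hq => ?_
  · rw [LookupScheme.readout_config]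
    simp only [LookupScheme.readout, Function.comp_apply, Equiv.symm_apply_apply, cfg]
  · rw [LookupScheme.config_ancilla _ _ hq]
    obtain ⟨q, rfl⟩ := placement.surjective q
    rw [Function.comp_apply, Equiv.symm_apply_apply]
    cases q with
    | addr i => exact absurd rfl (hq.2 i)
    | out => exact absurd rfl hq.1
    | _ => rfl

theorem ops_scheme (ls : List (Layer n (Qubit n L R))) :
    (scheme ls).ops = ((ls.map (Layer.relabel placement)).map Layer.gates).flatten := rfl

theorem runActs_scheme (data : (Fin n → Bool) → Bool) (ls : List (Layer n (Qubit n L R)))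
    (y : Basis (Qubit n L R)) : runActs data (scheme ls).ops (y ∘ placement.symm) =
      runLayers data ls y ∘ placement.symm := by
  have h : (y ∘ placement.symm) ∘ placement = y := by
    funext q
    simp
  rw [ops_scheme, runActs_flatten_gates, runLayers_relabel, h]

theorem tCount_scheme (ls : List (Layer n (Qubit n L R))) : (scheme ls).tCount =
    (ls.map fun l => ((l.relabel placement).gates.map Gate.tCost).sum).sum := by
  rw [LookupScheme.tCount, ops_scheme, List.map_flatten, List.sum_flatten, List.map_map,
    List.map_map, List.map_map]
  rfl

theorem card_region_some_le (b : Fin L) :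
    (Finset.univ.filter fun q : Qubit n L R => region q = some b).card ≤ 2 * R := by
  have h : (Finset.univ.filter fun q : Qubit n L R => region q = some b) ⊆
      Finset.univ.image (ring b) ∪ Finset.univ.image (acc b) := by
    intro q hq
    replace hq := (Finset.mem_filter.1 hq).2
    cases q <;> simp_all [region]
  refine (Finset.card_le_card h).trans ((Finset.card_union_le _ _).trans ?_)
  refine (add_le_add Finset.card_image_le Finset.card_image_le).trans ?_
  rw [Finset.card_univ, Fintype.card_fin]
  omega

theorem card_region_none_le :
    (Finset.univ.filter fun q : Qubit n L R => region q = none).card ≤ 2 * n + 2 + 3 * L := by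
  have h : (Finset.univ.filter fun q : Qubit n L R => region q = none) ⊆
      Finset.univ.image addr ∪ (Finset.univ.image chain ∪ ({out} ∪
        (Finset.univ.image rail ∪ Finset.univ.image flag))) := by
    intro q hq
    replace hq := (Finset.mem_filter.1 hq).2
    cases q <;> simp_all [region]
  refine (Finset.card_le_card h).trans ?_
  have h1 := (Finset.card_image_le (s := Finset.univ) (f := (addr : _ → Qubit n L R)))
  have h2 := (Finset.card_image_le (s := Finset.univ) (f := (chain : _ → Qubit n L R)))
  have h3 := (Finset.card_image_le (s := Finset.univ) (f := (rail : _ → Qubit n L R)))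
  have h4 := (Finset.card_image_le (s := Finset.univ) (f := (flag : _ → Qubit n L R)))
  rw [Finset.card_univ, Fintype.card_fin] at h1 h2 h3 h4
  refine (Finset.card_union_le _ _).trans ?_
  refine (add_le_add_right (Finset.card_union_le _ _) _).trans ?_
  refine (add_le_add_right (add_le_add_right (Finset.card_union_le _ _) _) _).trans ?_
  refine (add_le_add_right (add_le_add_right (add_le_add_right
    (Finset.card_union_le _ _) _) _) _).trans ?_
  rw [Finset.card_singleton]
  omega

theorem qubitCount_scheme_le (ls : List (Layer n (Qubit n L R))) :
    (scheme ls).qubitCount ≤ 2 * n + 2 + 3 * L + L * (2 * R) := by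
  have h : (scheme ls).qubitCount = (Finset.univ : Finset (Qubit n L R)).card :=
    Finset.card_map _
  have h' : (Finset.univ : Finset (Qubit n L R)) =
      (Finset.univ.filter fun q => region q = none) ∪
        Finset.univ.biUnion fun b => Finset.univ.filter fun q => region q = some b := by
    ext q
    cases h : region q <;> simp [h]
  rw [h, h']
  refine (Finset.card_union_le _ _).trans (add_le_add card_region_none_le ?_)
  refine (Finset.card_biUnion_le_card_mul _ _ _ fun b _ => card_region_some_le b).trans ?_
  simp

section Program

variable [NeZero L] [NeZero R] {H : ℕ} (D : Addressing n L R H)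

theorem isReversible_ops_program : ∀ g ∈ (scheme D.program).ops, g.IsReversible := by
  intro g hg
  obtain ⟨l, hl, q, rfl⟩ := mem_ops_scheme.1 hg
  exact Gate.isReversible_relabel _ (D.gateOK_program l hl q).isReversible

theorem runActs_program (data : (Fin n → Bool) → Bool) (a : Fin n → Bool) :
    runActs data (scheme D.program).ops ((scheme D.program).config (a, false)) =
      (scheme D.program).config (a, data a) := by
  rw [config_scheme, config_scheme]
  refine (runActs_scheme data _ _).trans ?_
  rw [D.run_program, Bool.false_xor]

theorem isLookup_program : (scheme D.program).IsLookup :=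
  LookupScheme.isLookup_of_runActs _ (isReversible_ops_program D) (runActs_program D)

theorem isPlanarLocal_program : (scheme D.program).IsPlanarLocal :=
  isPlanarLocal_scheme fun l hl q => (D.gateOK_program l hl q).isPlaced

theorem tCount_program_le : (scheme D.program).tCount ≤
    (2 * L + 2 * (H + (2 * L + R)) + (2 * L + R)) * (14 * (4 * n + 3) + 7 * L) := by
  rw [tCount_scheme]
  refine ((costBound_tCost placement).program D).trans (le_of_eq ?_)
  ring

theorem infidelity_program_le (data : (Fin n → Bool) → Bool) {ε : ℝ} (h0 : 0 ≤ ε) (h1 : ε ≤ 1)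
    (noise : Noise n (sites n L R)) {ψ : (Fin n → Bool) → ℂ} (hψ : ∑ a, ‖ψ a‖ ^ 2 = 1) :
    (scheme D.program).infidelity data ε noise ψ ≤
      ε * (D.program.length * ((2 * n + 2 + 3 * L) + 4 * (2 * R)) : ℕ) := by
  have hcard : ∀ r : Option (Fin L),
      (Finset.univ.filter fun q : sites n L R => region (placement.symm q) = r).card =
        (Finset.univ.filter fun q : Qubit n L R => region q = r).card := by
    intro r
    refine Finset.card_equiv placement.symm fun q => ?_
    simp
  have := (scheme D.program).infidelity_le (region := region ∘ placement.symm)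
    (fun q hq => ?_) (fun a => ⟨D.b a, D.b_lt a⟩) data (isReversible_ops_program D) (fun a => ?_)
    (runActs_program D data) _ rfl (2 * R) (fun b => ?_) h0 h1 noise hψ
  · refine this.trans (mul_le_mul_of_nonneg_left ?_ h0)
    have hn := card_region_none_le (n := n) (L := L) (R := R)
    rw [← hcard] at hn
    rw [List.length_map]
    push_cast
    refine mul_le_mul_of_nonneg_left ?_ (Nat.cast_nonneg _)
    refine add_le_add_left ?_ _
    refine le_trans (le_of_eq ?_) (le_trans (Nat.cast_le.2 hn) (by push_cast; rfl))
    exact congrArg Nat.cast (by congr)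
  · obtain ⟨q, rfl⟩ := placement.surjective q
    constructor
    · rintro h
      have : q = out := placement.injective h
      subst this
      exact hq (by simp [region])
    · rintro i h
      have : q = addr i := placement.injective h
      subst this
      exact hq (by simp [region])
  · rw [config_scheme]
    refine ShieldedLayers.shieldedRun (ShieldedLayers.relabel placement ?_)
    convert D.shieldedLayers_program data a false using 1
    funext q
    simp
  · refine le_trans (le_of_eq ?_) (card_region_some_le (n := n) b)
    rw [← hcard]
    congr

end Program

end Qubit

end QLookup

/-! ### Balanced parameters and final estimates -/

namespace QLookup

namespace Qubit

section Segments

variable {n : ℕ}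

/-- The number whose binary digits are the `w` address bits from the `s`-th on. -/
def segment (s w : ℕ) (a : Fin n → Bool) : ℕ :=
  Nat.ofBits fun i : Fin w => if h : s + i < n then a ⟨s + i, h⟩ else false

/-- The pattern of the addresses with the given segment. -/
def segmentPattern (s w e : ℕ) (k : Fin n) : Option Bool :=
  if s ≤ k ∧ k < s + w then some (e.testBit (k - s)) else none

theorem segment_lt (s w : ℕ) (a : Fin n → Bool) : segment s w a < 2 ^ w :=
  Nat.ofBits_lt_two_pow _

theorem testBit_segment {s w i : ℕ} (hi : i < w) (h : s + i < n) (a : Fin n → Bool) :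
    (segment s w a).testBit i = a ⟨s + i, h⟩ := by
  rw [segment, Nat.testBit_ofBits_lt _ i hi, dif_pos h]

theorem matchesUpTo_segmentPattern {s w : ℕ} (hsw : s + w ≤ n) (a : Fin n → Bool) {e : ℕ}
    (he : e < 2 ^ w) : MatchesUpTo (segmentPattern s w e) a n ↔ segment s w a = e := by
  constructor
  · intro h
    refine Nat.eq_of_testBit_eq fun i => ?_
    by_cases hi : i < w
    · rw [testBit_segment hi (by omega)]
      refine h ⟨s + i, by omega⟩ (by simp only; omega) _ ?_
      simp [segmentPattern, hi]
    · have hw : 2 ^ w ≤ 2 ^ i := Nat.pow_le_pow_right two_pos (not_lt.1 hi)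
      rw [Nat.testBit_lt_two_pow ((segment_lt s w a).trans_le hw),
        Nat.testBit_lt_two_pow (he.trans_le hw)]
  · rintro rfl k - v hv
    rw [segmentPattern] at hv
    split_ifs at hv with hk
    rw [Option.some.injEq, testBit_segment (by omega) (by omega)] at hv
    rw [← hv]
    congr 1
    ext
    simp only
    omega

/-- The division of addresses into three segments. -/
def threeSegments (u v w : ℕ) (h : u + v + w = n) : Addressing n (2 ^ u) (2 ^ v) (2 ^ w) where
  b := segment 0 u
  l := segment u v
  h := segment (u + v) w
  b_lt := segment_lt 0 u
  l_lt := segment_lt u v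
  h_lt := segment_lt (u + v) w
  patB := segmentPattern 0 u
  patL := segmentPattern u v
  patH := segmentPattern (u + v) w
  patB_iff a _ he := matchesUpTo_segmentPattern (by omega) a he
  patL_iff a _ he := matchesUpTo_segmentPattern (by omega) a he
  patH_iff a _ he := matchesUpTo_segmentPattern (by omega) a he
  cell b l h k := if k < u then b.testBit k else
    if k < u + v then l.testBit (k - u) else h.testBit (k - (u + v))
  cell_eq a := by
    funext k
    have hk := k.2
    split_ifs
    · rw [testBit_segment (by omega) (by omega)]
      congr 1
      ext
      simp only
      omega
    · rw [testBit_segment (by omega) (by omega)]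
      congr 1
      ext
      simp only
      omega
    · rw [testBit_segment (by omega) (by omega)]
      congr 1
      ext
      simp only
      omega

end Segments

/-- The division of addresses that balances the costs. -/
def balanced (n : ℕ) : Addressing n (2 ^ (n / 4)) (2 ^ (n / 2 - n / 4)) (2 ^ (n - n / 2)) :=
  threeSegments _ _ _ (by omega)

/-- The lookup scheme for `2 ^ n` memory locations. -/
abbrev balancedScheme (n : ℕ) : LookupScheme n := scheme (balanced n).program

section Bounds

variable (n : ℕ)

theorem two_pow_offset_le : 2 ^ (n / 2 - n / 4) ≤ 2 * 2 ^ (n / 4) :=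
  (Nat.pow_le_pow_right two_pos (by omega : n / 2 - n / 4 ≤ n / 4 + 1)).trans (by rw [pow_succ'])

theorem two_pow_rest_le : 2 ^ (n - n / 2) ≤ 4 * (2 ^ (n / 4)) ^ 2 :=
  (Nat.pow_le_pow_right two_pos (by omega : n - n / 2 ≤ n / 4 * 2 + 2)).trans
    (by rw [pow_add, pow_mul, mul_comm]; norm_num)

theorem lt_four_mul_two_pow : n + 1 ≤ 4 * 2 ^ (n / 4) := by
  have : n / 4 < 2 ^ (n / 4) := Nat.lt_two_pow_self
  omega

/-- With X = 2^⌊n/4⌋, rounding gives R ≤ 2X and H ≤ 4X², hence 8X² + 14X. -/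
theorem ticks_le : 2 * 2 ^ (n / 4) + 2 * (2 ^ (n - n / 2) + (2 * 2 ^ (n / 4) +
    2 ^ (n / 2 - n / 4))) + (2 * 2 ^ (n / 4) + 2 ^ (n / 2 - n / 4)) ≤ 22 * (2 ^ (n / 4)) ^ 2 := by
  have h1 := two_pow_offset_le n
  have h2 := two_pow_rest_le n
  have h3 : 2 ^ (n / 4) ≤ (2 ^ (n / 4)) ^ 2 := Nat.le_self_pow two_ne_zero _
  omega

theorem qubitCount_balancedScheme_le : (balancedScheme n).qubitCount ≤ 17 * (2 ^ (n / 4)) ^ 2 := by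
  refine (qubitCount_scheme_le _).trans ?_
  have h1 := two_pow_offset_le n
  have h2 := lt_four_mul_two_pow n
  have h3 : 2 ^ (n / 4) ≤ (2 ^ (n / 4)) ^ 2 := Nat.le_self_pow two_ne_zero _
  have h4 : 2 ^ (n / 4) * (2 * 2 ^ (n / 2 - n / 4)) ≤ 4 * (2 ^ (n / 4)) ^ 2 := by
    calc _ ≤ 2 ^ (n / 4) * (2 * (2 * 2 ^ (n / 4))) := by gcongr
      _ = _ := by ring
  omega

/-- There is no logarithm: each tick pays 7X for routing anyway, and the O(n) Toffolis of the
comparisons are absorbed by n + 1 ≤ 4X. -/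
theorem tCount_balancedScheme_le : (balancedScheme n).tCount ≤ 6006 * (2 ^ (n / 4)) ^ 3 := by
  refine (tCount_program_le _).trans ?_
  have h1 := lt_four_mul_two_pow n
  have h2 : 14 * (4 * n + 3) + 7 * 2 ^ (n / 4) ≤ 273 * 2 ^ (n / 4) := by
    have := Nat.one_le_two_pow (n := n / 4)
    omega
  calc _ ≤ 22 * (2 ^ (n / 4)) ^ 2 * (273 * 2 ^ (n / 4)) := Nat.mul_le_mul (ticks_le n) h2
    _ = _ := by ring

variable {n}

/-- The factor n is the depth of a comparison, during which all qubits are exposed to errors; it is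
the only logarithm in the infidelity. -/
theorem noise_volume_le (hn : 1 ≤ n) : (balanced n).program.length *
    ((2 * n + 2 + 3 * 2 ^ (n / 4)) + 4 * (2 * 2 ^ (n / 2 - n / 4))) ≤
      11600 * (2 ^ (n / 4)) ^ 3 * n := by
  have h1 := two_pow_offset_le n
  have h2 := lt_four_mul_two_pow n
  have h3 : (2 * n + 2 + 3 * 2 ^ (n / 4)) + 4 * (2 * 2 ^ (n / 2 - n / 4)) ≤ 29 * 2 ^ (n / 4) := by
    omega
  have h4 : (balanced n).program.length ≤ 400 * (2 ^ (n / 4)) ^ 2 * n := by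
    calc _ ≤ 22 * (2 ^ (n / 4)) ^ 2 * (8 * n + 10) + 4 :=
          (length_program_le _).trans
            (Nat.add_le_add_right (Nat.mul_le_mul_right _ (ticks_le n)) 4)
      _ ≤ 22 * (2 ^ (n / 4)) ^ 2 * (8 * n + 10 * n) + 4 * ((2 ^ (n / 4)) ^ 2 * n) := by
          have : 0 < (2 ^ (n / 4)) ^ 2 * n := by positivity
          gcongr <;> omega
      _ = _ := by ring
  calc _ ≤ 400 * (2 ^ (n / 4)) ^ 2 * n * (29 * 2 ^ (n / 4)) := Nat.mul_le_mul h4 h3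
    _ = _ := by ring

theorem pow_four_le : ((2 : ℝ) ^ (n / 4)) ^ 4 ≤ 2 ^ n := by
  rw [← pow_mul]
  exact pow_le_pow_right₀ one_le_two (by omega)

theorem sq_le_sqrt : ((2 : ℝ) ^ (n / 4)) ^ 2 ≤ Real.sqrt (2 ^ n) := by
  refine Real.le_sqrt_of_sq_le ?_
  rw [← pow_mul]
  exact pow_four_le

theorem cube_le_rpow : ((2 : ℝ) ^ (n / 4)) ^ 3 ≤ ((2 : ℝ) ^ n) ^ (3 / 4 : ℝ) := by
  have h : ((2 : ℝ) ^ (n / 4)) ^ 3 = (((2 : ℝ) ^ (n / 4)) ^ 4) ^ (3 / 4 : ℝ) := by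
    rw [← Real.rpow_natCast (_ ^ (n / 4)) 4, ← Real.rpow_mul (by positivity),
      ← Real.rpow_natCast (_ ^ (n / 4)) 3]
    norm_num
  rw [h]
  exact Real.rpow_le_rpow (by positivity) pow_four_le (by norm_num)

theorem natCast_le_log : (n : ℝ) ≤ 2 * Real.log (2 ^ n) := by
  rw [Real.log_pow]
  nlinarith [Real.log_two_gt_d9, Nat.cast_nonneg (α := ℝ) n]

end Bounds

end Qubit

end QLookup

end

theorem corollary1 :
    ∃ (S : ∀ n : ℕ, QLookup.LookupScheme n) (C : ℝ) (k : ℕ), 0 < C ∧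
      ∀ n : ℕ, 1 ≤ n → ∀ N : ℝ, N = (2 : ℝ) ^ n →
        (S n).IsLookup ∧
        (S n).IsPlanarLocal ∧
        ((S n).qubitCount : ℝ) ≤ C * Real.sqrt N ∧
        ((S n).tCount : ℝ) ≤ C * N ^ (3 / 4 : ℝ) ∧
        ∀ (data : (Fin n → Bool) → Bool) (ε : ℝ), 0 ≤ ε → ε ≤ 1 →
          ∀ (noise : QLookup.Noise n (S n).sites) (ψ : (Fin n → Bool) → ℂ),
            ∑ a, ‖ψ a‖ ^ 2 = 1 →
              (S n).infidelity data ε noise ψ ≤ C * N ^ (3 / 4 : ℝ) * Real.log N ^ k * ε := by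
  -- 23200 = 2 · 11600, where the 2 comes from n ≤ 2 log 2^n; it also exceeds the constants 17 and
  -- 6006 of the other bounds.
  refine ⟨QLookup.Qubit.balancedScheme, 23200, 1, by norm_num, ?_⟩
  rintro n hn N rfl
  have hsqrt := QLookup.Qubit.sq_le_sqrt (n := n)
  have hcube := QLookup.Qubit.cube_le_rpow (n := n)
  have hpos : (0 : ℝ) < ((2 : ℝ) ^ n) ^ (3 / 4 : ℝ) := by positivity
  refine ⟨QLookup.Qubit.isLookup_program _, QLookup.Qubit.isPlanarLocal_program _, ?_, ?_, ?_⟩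
  · have h := (Nat.cast_le (α := ℝ)).2 (QLookup.Qubit.qubitCount_balancedScheme_le n)
    push_cast at h
    linarith [Real.sqrt_nonneg ((2 : ℝ) ^ n)]
  · have h := (Nat.cast_le (α := ℝ)).2 (QLookup.Qubit.tCount_balancedScheme_le n)
    push_cast at h
    linarith
  · intro data ε h0 h1 noise ψ hψ
    have h := (Nat.cast_le (α := ℝ)).2 (QLookup.Qubit.noise_volume_le hn)
    have hlog := QLookup.Qubit.natCast_le_log (n := n)
    refine (QLookup.Qubit.infidelity_program_le _ data h0 h1 noise hψ).trans ?_
    rw [mul_comm ε, pow_one]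
    refine mul_le_mul_of_nonneg_right (h.trans ?_) h0
    push_cast
    calc 11600 * ((2 : ℝ) ^ (n / 4)) ^ 3 * n
        ≤ 11600 * ((2 : ℝ) ^ n) ^ (3 / 4 : ℝ) * (2 * Real.log (2 ^ n)) := by gcongr
      _ = _ := by ring
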